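/- Let $T>0$, let $k\ge 1$ be an integer, let $\alpha=\alpha(x)$ be smooth on $[0,2\pi]$ with $\alpha(0)=\alpha(2\pi)$ (sign changes and zeros are allowed), and let $g=g(x,t)$ be smooth. Consider $$u_t+(\alpha u)_x=g\ \text{ on } [0,2\pi]\times[0,T],\qquad u(x,0)=u_0(x),\qquad u(0,t)=u(2\pi,t).$$ **Scheme.** Let $0=x_{1/2}<x_{3/2}<\dots<x_{N+1/2}=2\pi$, $V_i=[x_{i-1/2},x_{i+1/2}]$, $h_i=x_{i+1/2}-x_{i-1/2}$, $h=\max_i h_i$, and assume the shape regularity $h\le\rho h_i$ for all $i$. In every $V_i$ points $-1=s_0<s_1<\dots<s_{k+1}=1$ (which may depend on $i$) define $x_{i,j}=\frac{h_i}{2}s_j+\frac12(x_{i-1/2}+x_{i+1/2})$. With $L_n$ the Legendre polynomials, the LSV method takes $s_1,\dots,s_k$ to be the zeros of $L_k$ in every element. The RSV method takes $s_1,\dots,s_{k+1}$ to be the zeros of $L_{k+1}-L_k$ (right Radau points) if $\alpha(x_{i\pm1/2})>0$, takes $s_0,\dots,s_k$ to be the zeros of $L_{k+1}+L_k$ (left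 Radau points) if $\alpha(x_{i\pm1/2})<0$, and takes either of the two families in any other element. The solution $u_h(\cdot,t)$ is a piecewise polynomial of degree at most $k$, differentiable in $t$, with $$\int_{x_{i,j}}^{x_{i,j+1}}(u_h)_t\,dx+\alpha\hat u_h\big|_{x_{i,j+1}}-\alpha\hat u_h\big|_{x_{i,j}}=\int_{x_{i,j}}^{x_{i,j+1}}g\,dx,\qquad 1\le i\le N,\ 0\le j\le k,\ t\in[0,T],$$ where $\hat u_h=u_h$ at the interior points of an element and, with periodic continuation, $\hat u_h(x_{i+1/2})=u_h(x_{i+1/2}^-)$ if $\alpha(x_{i+1/2})>0$ and $\hat u_h(x_{i+1/2})=u_h(x_{i+1/2}^+)$ otherwise. The initial value is $u_h(\cdot,0)=I_hu_0$, where $I_h\varphi|_{V_i}$ is the polynomial of degree at most $k$ that interpolates $\varphi$ at nodes $y_{i,1},\dots,y_{i,k+1}$; these are $x_{i,1},\dots,x_{i,k+1}$ if $\alpha(x_{i-1/2})\ge0$ and $\alpha(x_{i+1/2})>0$; they are $x_{i,0},\dots,x_{i,k}$ if $\alpha(x_{i-1/2})\le0$ and $\alpha(x_{i+1/2})<0$;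 and they are $x_{i,0},x_{i,1},\dots,x_{i,k-1},x_{i,k+1}$ otherwise. Let $z_{i,1},\dots,z_{i,k}$ be the roots of $\partial_x\prod_{j=1}^{k+1}(x-y_{i,j})$. **Theorem 5.2.** There is a constant $C$ that depends only on $k,\alpha,g,T,\rho$ (not on the mesh, $u$, $u_h$ or $t$) such that the following holds for every solution $u$ with $u(\cdot,t)\in W^{k+3,\infty}(0,2\pi)$ and $\|u\|_{k+3,\infty}:=\sup_{t\in[0,T]}\|u(\cdot,t)\|_{W^{k+3,\infty}(0,2\pi)}<\infty$, for every such mesh, and for every $t\in[0,T]$. For the RSV method with $k\ge1$ and for the LSV method with $k\ge2$, $$e_f:=\|\alpha u_h-\alpha I_hu\|_{L^2(0,2\pi)}\le C h^{k+2}\|u\|_{k+3,\infty},\qquad e_{f,n}+e_{f,c}+e_{f,r}\le C h^{k+2}\|u\|_{k+3,\infty}.$$ For the RSV and the LSV method with $k\ge1$, $$e_{f,l}\le C h^{k+1}\|u\|_{k+3,\infty}.$$ Here all functions are taken at time $t$ and $$e_{f,n}^2=\frac1N\sum_{i=1}^N(\alpha u-\alpha\hat u_h)^2(x_{i+1/2}),\qquad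 e_{f,c}^2=\frac1N\sum_{i=1}^N\Big(\frac1{h_i}\int_{V_i}(\alpha u-\alpha u_h)\,dx\Big)^2,$$ $$e_{f,r}^2=\frac1N\sum_{i=1}^N\sum_{j=1}^{k+1}(\alpha u-\alpha u_h)^2(y_{i,j}),\qquad e_{f,l}^2=\frac1N\sum_{i=1}^N\sum_{j=1}^{k}(\alpha\partial_xu-\alpha\partial_xu_h)^2(z_{i,j}),$$ where at an end point of $V_i$ the value $u_h(y_{i,j})$ is the trace from inside $V_i$. -/

import Mathlib

open Real Set MeasureTheory Polynomial
open scoped ENNReal ContDiff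

noncomputable section

namespace SpectralVolume

/-! ### Sobolev norms on the interval `Ω = (0, 2π)` -/

/-- `v` is the weak derivative of order `n` of `f` on the open interval `(0, 2π)`. -/
def IsWeakDeriv (n : ℕ) (f v : ℝ → ℝ) : Prop :=
  LocallyIntegrableOn f (Ioo 0 (2 * π)) ∧ LocallyIntegrableOn v (Ioo 0 (2 * π)) ∧
    ∀ φ : ℝ → ℝ, ContDiff ℝ ∞ φ → HasCompactSupport φ → tsupport φ ⊆ Ioo 0 (2 * π) →
      ∫ x in Ioo 0 (2 * π), f x * iteratedDeriv n φ x =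
        (-1) ^ n * ∫ x in Ioo 0 (2 * π), v x * φ x

/-- The norm `‖f‖_{m,∞}` of `W^{m,∞}(0, 2π)`: the largest of the essential suprema of the weak
derivatives of order `0, …, m`. Weak derivatives are unique almost everywhere, so all the
competitors of the infimum give the same value; the norm is `∞` exactly when `f` is not in
`W^{m,∞}(0, 2π)`. -/
def sobolevNormInf (m : ℕ) (f : ℝ → ℝ) : ℝ≥0∞ :=
  ⨅ (v : ℕ → ℝ → ℝ) (_ : ∀ n ≤ m, IsWeakDeriv n f (v n)),
    (Finset.range (m + 1)).sup
      fun n => eLpNorm (v n) ∞ (volume.restrict (Ioo 0 (2 * π)))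

/-- `sup_{t ∈ [0,T]} ‖u(·,t)‖_{m,∞}`, where `u t x` is the value at time `t` and position `x`. -/
def supSobolevNormInf (m : ℕ) (T : ℝ) (u : ℝ → ℝ → ℝ) : ℝ≥0∞ :=
  ⨆ t ∈ Icc 0 T, sobolevNormInf m (u t)

/-! ### The continuous problem -/

/-- `u` solves `u_t + (α u)_x = g` on `[0, 2π] × [0, T]` with `u(x, 0) = u₀(x)` and periodic
boundary condition. Every `u(·, t)` is represented by a continuous function. -/
structure IsExactSolution (α : ℝ → ℝ) (g : ℝ → ℝ → ℝ) (u₀ : ℝ → ℝ) (T : ℝ)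
    (u : ℝ → ℝ → ℝ) : Prop where
  continuousOn : ∀ t ∈ Icc 0 T, ContinuousOn (u t) (Icc 0 (2 * π))
  initial : ∀ x ∈ Icc 0 (2 * π), u 0 x = u₀ x
  periodic : ∀ t ∈ Icc 0 T, u t 0 = u t (2 * π)
  equation : ∀ t ∈ Icc 0 T, ∀ x ∈ Icc 0 (2 * π), ∃ p q : ℝ,
    HasDerivWithinAt (fun τ => u τ x) p (Icc 0 T) t ∧
    HasDerivWithinAt (fun y => α y * u t y) q (Icc 0 (2 * π)) x ∧
    p + q = g t x

/-! ### Meshes -/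

/-- A partition of `[0, 2π]` into `N` elements. -/
structure Mesh (N : ℕ) where
  node : Fin (N + 1) → ℝ
  strictMono : StrictMono node
  node_zero : node 0 = 0
  node_last : node (Fin.last N) = 2 * π

variable {N k : ℕ}

/-- Left end point of the `i`-th element. -/
def Mesh.left (M : Mesh N) (i : Fin N) : ℝ := M.node i.castSucc

/-- Right end point of the `i`-th element. -/
def Mesh.right (M : Mesh N) (i : Fin N) : ℝ := M.node i.succ

/-- Length `h_i` of the `i`-th element. -/
def Mesh.len (M : Mesh N) (i : Fin N) : ℝ := M.right i - M.left i

/-- The mesh size `h = max_i h_i`. -/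
def Mesh.size (M : Mesh N) : ℝ := ⨆ i, M.len i

/-- Shape regularity with constant `ρ`: `h ≤ ρ h_i` for all `i`. -/
def Mesh.ShapeRegular (M : Mesh N) (ρ : ℝ) : Prop := ∀ i, M.size ≤ ρ * M.len i

/-- The affine image in the `i`-th element of a point `r` of the reference element `[-1, 1]`. -/
def Mesh.point (M : Mesh N) (i : Fin N) (r : ℝ) : ℝ :=
  M.len i / 2 * r + (M.left i + M.right i) / 2

/-! ### Gauss-Legendre and Radau points -/

/-- The Legendre polynomial `L_n`, by Rodrigues' formula. -/
def legendre (n : ℕ) : ℝ[X] :=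
  C (1 / (2 ^ n * (n.factorial : ℝ))) * derivative^[n] ((X ^ 2 - 1) ^ n)

/-- `-1 = s_0 < s_1 < ⋯ < s_{k+1} = 1`. -/
def IsRefPartition (s : Fin (k + 2) → ℝ) : Prop :=
  StrictMono s ∧ s 0 = -1 ∧ s (Fin.last (k + 1)) = 1

/-- `s_1, …, s_k` are the zeros of `L_k`. -/
def IsGaussPartition (s : Fin (k + 2) → ℝ) : Prop :=
  IsRefPartition s ∧ ∀ j, j ≠ 0 → j ≠ Fin.last (k + 1) → (legendre k).eval (s j) = 0

/-- `s_1, …, s_{k+1}` are the right Radau points, the zeros of `L_{k+1} - L_k`. -/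
def IsRightRadauPartition (s : Fin (k + 2) → ℝ) : Prop :=
  IsRefPartition s ∧ ∀ j, j ≠ 0 → (legendre (k + 1) - legendre k).eval (s j) = 0

/-- `s_0, …, s_k` are the left Radau points, the zeros of `L_{k+1} + L_k`. -/
def IsLeftRadauPartition (s : Fin (k + 2) → ℝ) : Prop :=
  IsRefPartition s ∧
    ∀ j, j ≠ Fin.last (k + 1) → (legendre (k + 1) + legendre k).eval (s j) = 0

/-- The choice of points of the LSV method: Gauss-Legendre points in every element. -/
def IsLSV (s : Fin N → Fin (k + 2) → ℝ) : Prop := ∀ i, IsGaussPartition (s i)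

/-- The choice of points of the RSV method: right (left) Radau points in an element at whose two
end points `α` is positive (negative), and either of the two families in any other element. -/
def IsRSV (α : ℝ → ℝ) (M : Mesh N) (s : Fin N → Fin (k + 2) → ℝ) : Prop :=
  ∀ i, (0 < α (M.left i) → 0 < α (M.right i) → IsRightRadauPartition (s i)) ∧
    (α (M.left i) < 0 → α (M.right i) < 0 → IsLeftRadauPartition (s i)) ∧
    (IsRightRadauPartition (s i) ∨ IsLeftRadauPartition (s i))

/-- The partition point `x_{i,j}`. -/
def pt (M : Mesh N) (s : Fin N → Fin (k + 2) → ℝ) (i : Fin N) (j : Fin (k + 2)) : ℝ :=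
  M.point i (s i j)

/-! ### The spectral volume scheme

A piecewise polynomial `v_h` is given by the family of its restrictions to the elements, each a
polynomial in the global variable `x`; `finRotate N` sends an element to its right neighbour and,
by periodicity, the last element to the first one. -/

/-- The upwind flux `v̂_h` at the right end point `x_{i+1/2}` of the `i`-th element. -/
def upwind (α : ℝ → ℝ) (M : Mesh N) (v : Fin N → ℝ[X]) (i : Fin N) : ℝ :=
  if 0 < α (M.right i) then (v i).eval (M.right i)
  else (v (finRotate N i)).eval (M.left (finRotate N i))

/-- `v̂_h` at `x_{i,j}`: the upwind flux at the end points of the `i`-th element and the value of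
`v_h` at its interior points. -/
def numFlux (α : ℝ → ℝ) (M : Mesh N) (s : Fin N → Fin (k + 2) → ℝ) (v : Fin N → ℝ[X])
    (i : Fin N) (j : Fin (k + 2)) : ℝ :=
  if j = 0 then upwind α M v ((finRotate N).symm i)
  else if j = Fin.last (k + 1) then upwind α M v i
  else (v i).eval (pt M s i j)

/-- `U t`, for `t ∈ [0, T]`, is the semi-discrete spectral volume solution: a piecewise polynomial
of degree at most `k`, differentiable in time, that satisfies the local conservation law
`∫ (u_h)_t dx + α û_h|_{i,j+1} - α û_h|_{i,j} = ∫ g dx` on each control volume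
`[x_{i,j}, x_{i,j+1}]`. -/
structure IsSVSolution (α : ℝ → ℝ) (g : ℝ → ℝ → ℝ) (T : ℝ) (M : Mesh N)
    (s : Fin N → Fin (k + 2) → ℝ) (U : ℝ → Fin N → ℝ[X]) : Prop where
  natDegree_le : ∀ t ∈ Icc 0 T, ∀ i, (U t i).natDegree ≤ k
  conservation : ∀ t ∈ Icc 0 T, ∃ Ut : Fin N → ℝ[X],
    (∀ i m, HasDerivWithinAt (fun τ => (U τ i).coeff m) ((Ut i).coeff m) (Icc 0 T) t) ∧
    ∀ (i : Fin N) (j : Fin (k + 1)),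
      (∫ x in (pt M s i j.castSucc)..(pt M s i j.succ), (Ut i).eval x)
        + α (pt M s i j.succ) * numFlux α M s (U t) i j.succ
        - α (pt M s i j.castSucc) * numFlux α M s (U t) i j.castSucc
      = ∫ x in (pt M s i j.castSucc)..(pt M s i j.succ), g t x

/-! ### The interpolation operator -/

/-- The `k + 1` interpolation nodes `y_{i,j}` of `I_h` in the `i`-th element. They are
`x_{i,1}, …, x_{i,k+1}` in the first case, `x_{i,0}, …, x_{i,k}` in the second case, and
`x_{i,0}, …, x_{i,k-1}, x_{i,k+1}` otherwise. -/
def interpNode (α : ℝ → ℝ) (M : Mesh N) (s : Fin N → Fin (k + 2) → ℝ) (i : Fin N)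
    (j : Fin (k + 1)) : ℝ :=
  if 0 ≤ α (M.left i) ∧ 0 < α (M.right i) then pt M s i j.succ
  else if α (M.left i) ≤ 0 ∧ α (M.right i) < 0 then pt M s i j.castSucc
  else if j = Fin.last k then pt M s i (Fin.last (k + 1)) else pt M s i j.castSucc

/-- The Lagrange interpolation `I_h φ`. -/
def interp (α : ℝ → ℝ) (M : Mesh N) (s : Fin N → Fin (k + 2) → ℝ) (φ : ℝ → ℝ) (i : Fin N) :
    ℝ[X] :=
  Lagrange.interpolate Finset.univ (interpNode α M s i) fun j => φ (interpNode α M s i j)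

/-- The roots `z_{i,1}, …, z_{i,k}` of `∂ₓ ∏_j (x - y_{i,j})`. -/
def derivRoots (α : ℝ → ℝ) (M : Mesh N) (s : Fin N → Fin (k + 2) → ℝ) (i : Fin N) :
    Multiset ℝ :=
  (derivative (∏ j, (X - C (interpNode α M s i j)))).roots

/-! ### The errors at a fixed time

Here `v` is the piecewise polynomial `u_h(·, t)` and `w` is the exact solution `u(·, t)`. -/

/-- `e_f = ‖α u_h - α I_h u‖_0`, the norm being that of `L²(0, 2π)`. -/
def errFlux (α : ℝ → ℝ) (M : Mesh N) (s : Fin N → Fin (k + 2) → ℝ) (w : ℝ → ℝ)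
    (v : Fin N → ℝ[X]) : ℝ :=
  √(∑ i, ∫ x in (M.left i)..(M.right i),
    (α x * (v i).eval x - α x * (interp α M s w i).eval x) ^ 2)

/-- `e_{f,n}`: the error of the numerical flux at the points `x_{i+1/2}`. -/
def errDownwind (α : ℝ → ℝ) (M : Mesh N) (w : ℝ → ℝ) (v : Fin N → ℝ[X]) : ℝ :=
  √(1 / N * ∑ i, (α (M.right i) * w (M.right i) - α (M.right i) * upwind α M v i) ^ 2)

/-- `e_{f,c}`: the error of the cell averages of the flux. -/
def errCell (α : ℝ → ℝ) (M : Mesh N) (w : ℝ → ℝ) (v : Fin N → ℝ[X]) : ℝ :=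
  √(1 / N * ∑ i, (1 / M.len i *
    ∫ x in (M.left i)..(M.right i), (α x * w x - α x * (v i).eval x)) ^ 2)

/-- `e_{f,r}`: the error of the flux at the interpolation nodes; at an end point of the element
the trace of `u_h` from inside the element is used. -/
def errNode (α : ℝ → ℝ) (M : Mesh N) (s : Fin N → Fin (k + 2) → ℝ) (w : ℝ → ℝ)
    (v : Fin N → ℝ[X]) : ℝ :=
  √(1 / N * ∑ i, ∑ j, (α (interpNode α M s i j) * w (interpNode α M s i j)
    - α (interpNode α M s i j) * (v i).eval (interpNode α M s i j)) ^ 2)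

/-- `e_{f,l}`: the error of `α ∂ₓu_h` at the points `z_{i,j}`, which are interior to the
elements. -/
def errDeriv (α : ℝ → ℝ) (M : Mesh N) (s : Fin N → Fin (k + 2) → ℝ) (w : ℝ → ℝ)
    (v : Fin N → ℝ[X]) : ℝ :=
  √(1 / N * ∑ i, ((derivRoots α M s i).map fun z =>
    (α z * deriv w z - α z * (derivative (v i)).eval z) ^ 2).sum)

end SpectralVolume

end

/-!
The argument is an energy estimate for the difference `ξ` of the numerical solution and the
interpolant `I_h u`, with weights that depend on the size of `α`.

The spectral volume scheme is a Petrov-Galerkin method. The Gauss or Radau points of an element are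
the nodes of a quadrature rule that is exact up to degree `2k`, or just short of it by a term of a
fixed sign (`IsSVQuad`). A polynomial `v` is paired with the piecewise constant function that jumps
by `A_i v'(s_i)` at the point `s_i`. Summation by parts (`sum_testWeight_mul_sub`) then shows that
the resulting form is symmetric and bounded below by the `L²` norm (`svForm_comm`,
`polyInt_sq_le_svForm`), and that the flux terms are, up to `O(h)`, those of an upwind discontinuous
Galerkin method. This gives stability in every energy whose weights vary slowly where `α` is not
small (`IsDiscretization.energy_le`).

The residual of the scheme at `ξ` consists of interpolation errors (`schemeRes_refErr`). The
interpolation nodes are chosen such that `I_h u` has the exact upwind flux at the interfaces; at the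
other partition points `u` is interpolated or `α = O(h)`. Hence the residual is of the order of the
interpolation error of `u_t`, which is not enough for order `k + 2`. But where `α` is not small, the
leading part of this error is a multiple of the Lagrange basis polynomial of the inflow end, since
this end is the one partition point that is not a node. This polynomial has mean value zero, for the
Radau points by `∫ L_{k+1} = ∫ L_k = 0`, for the Gauss points only if `k ≥ 2`, by `∫ (x ± 1) L_k =
0`. It is therefore the flux difference of a correction that vanishes at the outflow end
(`IsRefElement.exists_corrector`, `IsDiscretization.flux_corrector`). The correction contains a
factor `h / α`, and is absorbed by the weights `α² + h²`, which are admissible for the stability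
estimate (`IsDiscretization.isWeight`). On the elements where `α = O(h)` there is no correction: the
weight itself is of size `h²` there. The result is `IsErrorSystem.weighted_le`, which controls `α ξ`
with one additional order, and with it the errors of the flux at nodes and interfaces and in the
cell averages.

For the space derivative the time derivative of `ξ` is needed. The coefficient does not depend on
time, so the unweighted stability estimate applies to the time differences of `ξ`
(`IsErrorSystem.energy_deriv_le`). Inside an element the scheme expresses the flux increments of `ξ`
through `ξ_t` and the residual, which gains a factor `h` and thus makes up for the inverse
inequality (`IsErrorSystem.abs_mul_derivative_le`). The derivative of the interpolation error gains
one order at the roots of the derivative of the nodal polynomial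
(`IsRefElement.abs_sub_derivative_ipol_le`).

The constant is uniform for two reasons. For given `k` there are only finitely many Gauss and Radau
partitions of the reference element (`exists_isRefElement`). And the norms of `u_t`, `u_tt` are
bounded linearly in the norm of `u` through the equation (`exists_isSmoothSol`). The latter also
requires that `g` is bounded by a multiple of the norm of `u`; this holds because a right-hand side
other than zero keeps the norm of the solution away from zero (`exists_pos_le_of_ne_zero`).
-/

noncomputable section

namespace SpectralVolume

section

/-! ### Integration of polynomials -/

/-- Integration over `[a, b]`, as a linear functional on polynomials. -/
def polyInt (a b : ℝ) : ℝ[X] →ₗ[ℝ] ℝ where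
  toFun p := ∫ x in a..b, p.eval x
  map_add' p q := by
    simp only [eval_add]
    exact intervalIntegral.integral_add (p.continuous.intervalIntegrable a b)
      (q.continuous.intervalIntegrable a b)
  map_smul' c p := by
    simp only [eval_smul, smul_eq_mul, RingHom.id_apply]
    exact intervalIntegral.integral_const_mul c _

theorem polyInt_apply (a b : ℝ) (p : ℝ[X]) : polyInt a b p = ∫ x in a..b, p.eval x := rfl

theorem polyInt_derivative (a b : ℝ) (p : ℝ[X]) :
    polyInt a b (derivative p) = p.eval b - p.eval a :=
  intervalIntegral.integral_eq_sub_of_hasDerivAt (fun x _ => p.hasDerivAt x)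
    ((derivative p).continuous.intervalIntegrable a b)

theorem exists_antiderivative (k : ℕ) (p : ℝ[X]) (hp : p.natDegree ≤ k) :
    ∃ W : ℝ[X], derivative W = p ∧ W.natDegree ≤ k + 1 ∧ W.coeff (k + 1) = p.coeff k / (k + 1) := by
  refine ⟨∑ m ∈ Finset.range (k + 1), monomial (m + 1) (p.coeff m / (m + 1)), ?_, ?_, ?_⟩
  · rw [derivative_sum]
    conv_rhs => rw [p.as_sum_range' (k + 1) (by omega)]
    refine Finset.sum_congr rfl fun m _ => ?_
    rw [derivative_monomial]
    push_cast
    rw [div_mul_cancel₀ _ (by positivity)]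
  · refine natDegree_sum_le_of_forall_le _ _ fun m hm => (natDegree_monomial_le _).trans ?_
    have := Finset.mem_range.1 hm
    omega
  · rw [finsetSum_coeff]
    simp only [coeff_monomial]
    rw [Finset.sum_eq_single k]
    · simp
    · intro b _ hb; rw [if_neg (by omega)]
    · simp

theorem abs_polyInt_le {a b B : ℝ} (hab : a ≤ b) {p : ℝ[X]} (h : ∀ x ∈ Icc a b, |p.eval x| ≤ B) :
    |polyInt a b p| ≤ B * (b - a) := by
  have := intervalIntegral.norm_integral_le_of_norm_le_const (a := a) (b := b)
    (f := fun x => p.eval x) (C := B) fun x hx => h x ⟨?_, ?_⟩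
  · simpa [polyInt_apply, abs_of_nonneg (sub_nonneg.2 hab)] using this
  · rw [uIoc_of_le hab] at hx; exact hx.1.le
  · rw [uIoc_of_le hab] at hx; exact hx.2

theorem polyInt_sq_nonneg (v : ℝ[X]) : 0 ≤ polyInt (-1) 1 (v ^ 2) :=
  intervalIntegral.integral_nonneg (by norm_num) fun x _ => by simp only [eval_pow]; positivity

theorem polyInt_sq_pos {v : ℝ[X]} (hv : v ≠ 0) : 0 < polyInt (-1) 1 (v ^ 2) := by
  refine (polyInt_sq_nonneg v).lt_of_ne fun h => hv ?_
  have h0 := h.symm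
  rw [polyInt_apply, intervalIntegral.integral_eq_zero_iff_of_le_of_nonneg_ae (by norm_num)
    (Filter.Eventually.of_forall fun x => by simp only [eval_pow]; exact sq_nonneg _)
    ((v ^ 2).continuous.intervalIntegrable _ _)] at h0
  by_contra hne
  have hfin : {x : ℝ | v.eval x = 0}.Finite := by
    refine (v.roots.toFinset.finite_toSet).subset fun x hx => ?_
    simp [hne]; exact hx
  have : (volume.restrict (Ioc (-1 : ℝ) 1)) {x : ℝ | v.eval x = 0} = 0 := by
    exact Measure.restrict_le_self _ |>.trans_eq (hfin.measure_zero _) |> nonpos_iff_eq_zero.1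
  have h2 : (volume.restrict (Ioc (-1 : ℝ) 1)) univ = 0 := by
    rw [← nonpos_iff_eq_zero, ← this]
    refine measure_mono_ae ?_
    filter_upwards [h0] with x hx _
    exact pow_eq_zero_iff (two_ne_zero) |>.1 (by simpa using hx)
  simp at h2
  norm_num at h2

/-! ### Legendre polynomials on the reference element -/

/-- Integration by parts, `n` times, against an `n`-th derivative whose boundary terms vanish. -/
theorem polyInt_iterate_derivative_mul (n : ℕ) (F q : ℝ[X])
    (hF : ∀ j < n, (derivative^[j] F).eval (-1) = 0 ∧ (derivative^[j] F).eval 1 = 0)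
    (hq : q.degree < n) :
    polyInt (-1) 1 (derivative^[n] F * q) = 0 := by
  induction n generalizing q with
  | zero =>
    have : q = 0 := by
      rw [← Polynomial.degree_eq_bot]; simpa using hq
    simp [this]
  | succ n ih =>
    have h1 : derivative^[n + 1] F * q
        = derivative (derivative^[n] F * q) - derivative^[n] F * derivative q := by
      rw [derivative_mul, Function.iterate_succ_apply']; ring
    have hq' : (derivative q).degree < n := by
      rcases eq_or_ne q 0 with rfl | h0
      · simp
      · refine (degree_derivative_lt h0).trans_le ?_
        rw [Polynomial.degree_eq_natDegree h0] at hq ⊢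
        norm_cast at hq ⊢
        omega
    rw [h1, map_sub, ih _ (fun j hj => hF j (by omega)) hq', polyInt_derivative]
    simp [(hF n (by omega)).1, (hF n (by omega)).2]

theorem polyInt_legendre_mul (n : ℕ) (q : ℝ[X]) (hq : q.degree < n) :
    polyInt (-1) 1 (legendre n * q) = 0 := by
  have h : ∀ j < n, ∀ x : ℝ, x ^ 2 = 1 →
      (derivative^[j] ((X ^ 2 - 1 : ℝ[X]) ^ n)).eval x = 0 := fun j hj x hx => by
    obtain ⟨d, hd⟩ := pow_sub_dvd_iterate_derivative_pow (X ^ 2 - 1 : ℝ[X]) n j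
    rw [hd, eval_mul, eval_pow, eval_sub, eval_pow, eval_X, eval_one, hx, sub_self,
      zero_pow (by omega), zero_mul]
  rw [legendre, mul_assoc, ← smul_eq_C_mul, map_smul, polyInt_iterate_derivative_mul n _ q
    (fun j hj => ⟨h j hj _ (by norm_num), h j hj _ (by norm_num)⟩) hq, smul_zero]

theorem natDegree_legendre_le (n : ℕ) : (legendre n).natDegree ≤ n := by
  refine (natDegree_C_mul_le _ _).trans ((natDegree_iterate_derivative _ _).trans ?_)
  have : ((X ^ 2 - 1 : ℝ[X]) ^ n).natDegree ≤ n * 2 := natDegree_pow_le_of_le n (by compute_degree)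
  omega

theorem coeff_legendre_ne_zero (n : ℕ) : (legendre n).coeff n ≠ 0 := by
  have h1 : ((X ^ 2 - 1 : ℝ[X]) ^ n).coeff (n + n) = 1 := by
    have hm : (X ^ 2 - 1 : ℝ[X]).Monic := by
      simpa using monic_X_pow_sub_C (1 : ℝ) (n := 2) (by norm_num)
    have hd : (X ^ 2 - 1 : ℝ[X]).natDegree = 2 := by
      simpa using natDegree_X_pow_sub_C (n := 2) (r := (1 : ℝ))
    have := (hm.pow n).coeff_natDegree
    rwa [hm.natDegree_pow, hd, mul_two] at this
  rw [legendre, coeff_C_mul, coeff_iterate_derivative, h1]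
  have : (n + n).descFactorial n ≠ 0 := by
    rw [Ne, Nat.descFactorial_eq_zero_iff_lt]; omega
  simp [this, Nat.factorial_ne_zero]

end

section

/-! ### Quadrature at the partition points -/

theorem eq_C_mul_nodal {ι : Type*} [DecidableEq ι] {J : Finset ι} {s : ι → ℝ}
    (hs : Set.InjOn s J) {P : ℝ[X]} (hdeg : P.natDegree ≤ J.card)
    (hP : ∀ j ∈ J, P.eval (s j) = 0) : P = C (P.coeff J.card) * Lagrange.nodal J s := by
  refine Polynomial.eq_of_degree_sub_lt_of_eval_index_eq J hs ?_ fun j hj => ?_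
  · rw [degree_lt_iff_coeff_zero]
    intro m hm
    rw [coeff_sub, coeff_C_mul]
    rcases hm.eq_or_lt with rfl | hlt
    · have := (Lagrange.nodal_monic (s := J) (v := s)).coeff_natDegree
      rw [Lagrange.natDegree_nodal] at this
      rw [this]; ring
    · rw [coeff_eq_zero_of_natDegree_lt (p := P) (n := m) (by omega),
        coeff_eq_zero_of_natDegree_lt (p := Lagrange.nodal J s) (n := m)
          (by rw [Lagrange.natDegree_nodal]; omega)]
      ring
  · rw [hP j hj, eval_mul, Lagrange.eval_nodal_at_node hj, mul_zero]

/-- `A` are the weights of a quadrature rule on `[-1, 1]` with the partition points as nodes that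
is exact in degree less than `2k`, and in degree `2k` up to the term `κ` times the leading
coefficient. For the Radau points `κ = 0`; for the Gauss points `κ` is the squared `L²` norm of
the monic Legendre polynomial. -/
structure IsSVQuad {k : ℕ} (s A : Fin (k + 2) → ℝ) (κ : ℝ) : Prop where
  nonneg : 0 ≤ κ
  exact : ∀ q : ℝ[X], q.natDegree ≤ 2 * k →
    ∑ j, A j * q.eval (s j) = polyInt (-1) 1 q - κ * q.coeff (2 * k)

/-- The interpolatory quadrature rule with nodes indexed by `J`: it integrates the remainder modulo
the nodal polynomial. -/
theorem exists_quadrature {ι : Type*} [Fintype ι] [DecidableEq ι] {s : ι → ℝ}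
    (hs : Function.Injective s) (J : Finset ι) :
    ∃ A : ι → ℝ, (∀ j, j ∉ J → A j = 0) ∧
      ∀ q : ℝ[X], ∑ j, A j * q.eval (s j) = polyInt (-1) 1 (q %ₘ Lagrange.nodal J s) := by
  refine ⟨fun j => if j ∈ J then polyInt (-1) 1 (Lagrange.basis J s j) else 0,
    fun j hj => if_neg hj, fun q => ?_⟩
  have h : q %ₘ Lagrange.nodal J s = Lagrange.interpolate J s fun j => q.eval (s j) := by
    refine Lagrange.eq_interpolate_of_eval_eq _ hs.injOn ?_ fun j hj => ?_
    · rw [← Lagrange.degree_nodal (s := J) (v := s)]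
      exact degree_modByMonic_lt _ Lagrange.nodal_monic
    · have := congrArg (eval (s j)) (modByMonic_add_div q (Lagrange.nodal J s))
      simpa [Lagrange.eval_nodal_at_node hj] using this
  rw [h, Lagrange.interpolate_apply, map_sum]
  simp only [ite_mul, zero_mul, ← smul_eq_C_mul, map_smul, smul_eq_mul]
  rw [Finset.sum_ite_mem, Finset.univ_inter]
  exact Finset.sum_congr rfl fun j _ => mul_comm _ _

/-- Orthogonality of the nodal polynomial to degree less than `k` gives exactness in degree less
than `2k` for `k` nodes, and in degree `2k` for `k + 1` nodes. -/
theorem exists_isSVQuad {k : ℕ} (hk : 1 ≤ k) {s : Fin (k + 2) → ℝ} (hs : Function.Injective s)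
    (J : Finset (Fin (k + 2))) (hJ : J.card = k ∨ J.card = k + 1) {P : ℝ[X]}
    (hdeg : P.natDegree ≤ J.card) (hlead : P.coeff J.card ≠ 0) (hP : ∀ j ∈ J, P.eval (s j) = 0)
    (horth : ∀ d : ℝ[X], d.degree < k → polyInt (-1) 1 (P * d) = 0) :
    ∃ (A : Fin (k + 2) → ℝ) (κ : ℝ), IsSVQuad s A κ ∧ ∀ j, j ∉ J → A j = 0 := by
  obtain ⟨A, hA0, hA⟩ := exists_quadrature hs J
  set w := Lagrange.nodal J s with hw
  have hmon : w.Monic := Lagrange.nodal_monic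
  have hwdeg : w.natDegree = J.card := Lagrange.natDegree_nodal
  have hw0 : ∀ d : ℝ[X], d.degree < k → polyInt (-1) 1 (w * d) = 0 := fun d hd => by
    have h1 := horth d hd
    rw [eq_C_mul_nodal hs.injOn hdeg hP, mul_assoc, ← smul_eq_C_mul, map_smul, smul_eq_mul] at h1
    exact (mul_eq_zero.1 h1).resolve_left hlead
  have key : ∀ q : ℝ[X], ∑ j, A j * q.eval (s j)
      = polyInt (-1) 1 q - polyInt (-1) 1 (w * (q /ₘ w)) := fun q => by
    rw [hA q, eq_sub_iff_add_eq, ← map_add, modByMonic_add_div]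
  have hddeg : ∀ q : ℝ[X], (q /ₘ w).natDegree = q.natDegree - J.card := fun q => by
    rw [natDegree_divByMonic _ hmon, hwdeg]
  rcases hJ with hJ | hJ
  · refine ⟨A, polyInt (-1) 1 (w ^ 2), ⟨polyInt_sq_nonneg _, fun q hq => ?_⟩, hA0⟩
    rw [key q]
    congr 1
    set d := q /ₘ w
    have hdk : d.natDegree ≤ k := by rw [hddeg]; omega
    have hwk : w.coeff k = 1 := by rw [← hJ, ← hwdeg]; exact hmon.coeff_natDegree
    have hqc : q.coeff (2 * k) = d.coeff k := by
      rw [← modByMonic_add_div q w, coeff_add, two_mul,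
        coeff_mul_add_eq_of_natDegree_le (by omega) hdk, hwk, one_mul]
      have h3 : (q %ₘ w).degree < (k : ℕ) := by
        rw [← hJ, ← hwdeg, ← degree_eq_natDegree hmon.ne_zero]
        exact degree_modByMonic_lt _ hmon
      rw [coeff_eq_zero_of_degree_lt (h3.trans_le (by norm_cast; omega)), zero_add]
    have h2 : polyInt (-1) 1 (w * (d - C (d.coeff k) * w)) = 0 := by
      refine hw0 _ ?_
      rw [degree_lt_iff_coeff_zero]
      intro m hm
      rw [coeff_sub, coeff_C_mul]
      rcases hm.eq_or_lt with rfl | hlt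
      · rw [hwk]; ring
      · rw [coeff_eq_zero_of_natDegree_lt (p := d) (n := m) (by omega),
          coeff_eq_zero_of_natDegree_lt (p := w) (n := m) (by omega)]
        ring
    have h4 : w * (d - C (d.coeff k) * w) = w * d - C (d.coeff k) * w ^ 2 := by ring
    rw [h4, map_sub, ← smul_eq_C_mul, map_smul, smul_eq_mul, sub_eq_zero] at h2
    rw [h2, hqc, mul_comm]
  · refine ⟨A, 0, ⟨le_rfl, fun q hq => ?_⟩, hA0⟩
    rw [key q, hw0 _ ?_, zero_mul]
    have := hddeg q
    exact degree_le_natDegree.trans_lt (by norm_cast; omega)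

theorem IsRefPartition.mem_Icc {k : ℕ} {s : Fin (k + 2) → ℝ} (hs : IsRefPartition s)
    (j : Fin (k + 2)) : s j ∈ Icc (-1 : ℝ) 1 :=
  ⟨hs.2.1 ▸ hs.1.monotone (Fin.zero_le j), hs.2.2 ▸ hs.1.monotone (Fin.le_last j)⟩

theorem IsGaussPartition.exists_isSVQuad {k : ℕ} (hk : 1 ≤ k) {s : Fin (k + 2) → ℝ}
    (h : IsGaussPartition s) :
    ∃ (A : Fin (k + 2) → ℝ) (κ : ℝ), IsSVQuad s A κ ∧ A 0 = 0 ∧ A (Fin.last (k + 1)) = 0 := by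
  have hcard : ((Finset.univ.erase (0 : Fin (k + 2))).erase (Fin.last (k + 1))).card = k := by
    rw [Finset.card_erase_of_mem, Finset.card_erase_of_mem] <;> simp
  obtain ⟨A, κ, hA, hA0⟩ := SpectralVolume.exists_isSVQuad hk h.1.1.injective
    ((Finset.univ.erase 0).erase (Fin.last (k + 1))) (Or.inl hcard) (P := legendre k)
    (by rw [hcard]; exact natDegree_legendre_le k) (by rw [hcard]; exact coeff_legendre_ne_zero k)
    (fun j hj => h.2 j (by simp at hj; exact hj.2) (by simp at hj; exact hj.1))
    (fun d hd => polyInt_legendre_mul k d hd)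
  exact ⟨A, κ, hA, hA0 _ (by simp), hA0 _ (by simp)⟩

theorem IsRightRadauPartition.exists_isSVQuad {k : ℕ} (hk : 1 ≤ k) {s : Fin (k + 2) → ℝ}
    (h : IsRightRadauPartition s) :
    ∃ (A : Fin (k + 2) → ℝ) (κ : ℝ), IsSVQuad s A κ ∧ A 0 = 0 := by
  have hcard : (Finset.univ.erase (0 : Fin (k + 2))).card = k + 1 := by
    rw [Finset.card_erase_of_mem] <;> simp
  obtain ⟨A, κ, hA, hA0⟩ := SpectralVolume.exists_isSVQuad hk h.1.1.injective
    (Finset.univ.erase 0) (Or.inr hcard) (P := legendre (k + 1) - legendre k)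
    (by
      rw [hcard]
      exact (natDegree_sub_le_of_le (natDegree_legendre_le _) (natDegree_legendre_le k)).trans
        (by simp))
    (by
      rw [hcard, coeff_sub,
        coeff_eq_zero_of_natDegree_lt (Nat.lt_succ_of_le (natDegree_legendre_le k)), sub_zero]
      exact coeff_legendre_ne_zero _)
    (fun j hj => h.2 j (by simpa using hj))
    (fun d hd => by
      rw [sub_mul, map_sub, polyInt_legendre_mul k d hd,
        polyInt_legendre_mul _ d (hd.trans (by norm_cast; omega)), sub_zero])
  exact ⟨A, κ, hA, hA0 _ (by simp)⟩

theorem IsLeftRadauPartition.exists_isSVQuad {k : ℕ} (hk : 1 ≤ k) {s : Fin (k + 2) → ℝ}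
    (h : IsLeftRadauPartition s) :
    ∃ (A : Fin (k + 2) → ℝ) (κ : ℝ), IsSVQuad s A κ ∧ A (Fin.last (k + 1)) = 0 := by
  have hcard : (Finset.univ.erase (Fin.last (k + 1))).card = k + 1 := by
    rw [Finset.card_erase_of_mem] <;> simp
  obtain ⟨A, κ, hA, hA0⟩ := SpectralVolume.exists_isSVQuad hk h.1.1.injective
    (Finset.univ.erase (Fin.last (k + 1))) (Or.inr hcard) (P := legendre (k + 1) + legendre k)
    (by
      rw [hcard]
      exact natDegree_add_le_of_degree_le (natDegree_legendre_le _)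
        ((natDegree_legendre_le k).trans (Nat.le_succ k)))
    (by
      rw [hcard, coeff_add,
        coeff_eq_zero_of_natDegree_lt (Nat.lt_succ_of_le (natDegree_legendre_le k)), add_zero]
      exact coeff_legendre_ne_zero _)
    (fun j hj => h.2 j (by simpa using hj))
    (fun d hd => by
      rw [add_mul, map_add, polyInt_legendre_mul k d hd,
        polyInt_legendre_mul _ d (hd.trans (by norm_cast; omega)), add_zero])
  exact ⟨A, κ, hA, hA0 _ (by simp)⟩

end

section

/-! ### The Petrov-Galerkin form of the spectral volume method -/

variable {k : ℕ}

/-- The integral over the `j`-th control volume of the reference element. -/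
def cellInt (s : Fin (k + 2) → ℝ) (j : Fin (k + 1)) : ℝ[X] →ₗ[ℝ] ℝ :=
  polyInt (s j.castSucc) (s j.succ)

/-- The value on the `j`-th control volume of the piecewise constant test function that is
associated with a polynomial `v`: it jumps by `A_i v'(s_i)` at `s_i`, starting from `v(-1)`. -/
def testWeight (s A : Fin (k + 2) → ℝ) (j : Fin (k + 1)) : ℝ[X] →ₗ[ℝ] ℝ :=
  leval (-1) + ∑ i ∈ Finset.Iic j.castSucc, A i • (leval (s i) ∘ₗ derivative)

theorem testWeight_apply (s A : Fin (k + 2) → ℝ) (j : Fin (k + 1)) (v : ℝ[X]) :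
    testWeight s A j v
      = v.eval (-1) + ∑ i ∈ Finset.Iic j.castSucc, A i * (derivative v).eval (s i) := by
  simp [testWeight, LinearMap.sum_apply, leval]

/-- The form `(u, v*)`, where `v*` is the piecewise constant test function of `v`. -/
def svForm (s A : Fin (k + 2) → ℝ) (u v : ℝ[X]) : ℝ :=
  ∑ j, testWeight s A j v * cellInt s j u

theorem sum_abel (n : ℕ) (c₀ : ℝ) (d G : Fin (n + 2) → ℝ) :
    ∑ j : Fin (n + 1), (c₀ + ∑ i ∈ Finset.Iic j.castSucc, d i) * (G j.succ - G j.castSucc)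
      = G (Fin.last (n + 1)) * (c₀ + ∑ i, d i) - G 0 * c₀ - ∑ i, d i * G i := by
  have hstep : ∀ j : Fin (n + 1), ∑ i ∈ Finset.Iic j.succ, d i
      = ∑ i ∈ Finset.Iic j.castSucc, d i + d j.succ := fun j => by
    have : Finset.Iic j.succ = insert j.succ (Finset.Iic j.castSucc) := by
      ext i
      simp only [Finset.mem_Iic, Finset.mem_insert, Fin.le_def, Fin.ext_iff, Fin.val_succ,
        Fin.val_castSucc]
      omega
    rw [this, Finset.sum_insert (by simp [Fin.le_def]), add_comm]
  set Q : Fin (n + 2) → ℝ := fun i => (c₀ + ∑ i' ∈ Finset.Iic i, d i') * G i with hQ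
  have h1 : ∀ j : Fin (n + 1),
      (c₀ + ∑ i ∈ Finset.Iic j.castSucc, d i) * (G j.succ - G j.castSucc)
        = Q j.succ - Q j.castSucc - d j.succ * G j.succ := fun j => by
    simp only [hQ, hstep]; ring
  have h2 := (Fin.sum_univ_succ Q).symm.trans (Fin.sum_univ_castSucc Q)
  have h3 := Fin.sum_univ_succ fun i => d i * G i
  have h4 : Q 0 = (c₀ + d 0) * G 0 := by
    simp only [hQ]
    rw [show Finset.Iic (0 : Fin (n + 2)) = {0} from by ext i; simp, Finset.sum_singleton]
  have h5 : Q (Fin.last (n + 1)) = (c₀ + ∑ i, d i) * G (Fin.last (n + 1)) := by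
    simp only [hQ]
    rw [show Finset.Iic (Fin.last (n + 1)) = Finset.univ from by ext i; simp [Fin.le_last]]
  rw [Finset.sum_congr rfl fun j _ => h1 j, Finset.sum_sub_distrib, Finset.sum_sub_distrib, h3]
  linarith

section Form

variable {s A : Fin (k + 2) → ℝ} {κ : ℝ}

/-- Summation by parts against the test function of `v`. -/
theorem sum_testWeight_mul_sub (hA : IsSVQuad s A κ) (hk : 1 ≤ k)
    {v : ℝ[X]} (hv : v.natDegree ≤ k) (G : Fin (k + 2) → ℝ) :
    ∑ j, testWeight s A j v * (G j.succ - G j.castSucc)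
      = G (Fin.last (k + 1)) * v.eval 1 - G 0 * v.eval (-1)
        - ∑ j, A j * (G j * (derivative v).eval (s j)) := by
  have hd : (derivative v).natDegree ≤ k - 1 := (natDegree_derivative_le v).trans (by omega)
  have h1 := hA.exact (derivative v) (by omega)
  rw [polyInt_derivative, coeff_eq_zero_of_natDegree_lt (by omega), mul_zero, sub_zero] at h1
  simp only [testWeight_apply]
  rw [sum_abel, h1]
  simp only [mul_assoc, mul_comm (G _)]
  ring

/-- The antiderivative of `u`, summation by parts and the quadrature rule turn the form into the
`L²` product, up to a rank one term that is symmetric and nonnegative. It is zero for Radau points.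
-/
theorem svForm_eq (hs : IsRefPartition s) (hA : IsSVQuad s A κ) (hk : 1 ≤ k)
    {u v : ℝ[X]} (hu : u.natDegree ≤ k) (hv : v.natDegree ≤ k) :
    svForm s A u v = polyInt (-1) 1 (u * v) + κ * (k / (k + 1)) * (u.coeff k * v.coeff k) := by
  obtain ⟨W, rfl, hW, hWc⟩ := exists_antiderivative k u hu
  have hd : (derivative v).natDegree ≤ k - 1 := (natDegree_derivative_le v).trans (by omega)
  have h1 := hA.exact (W * derivative v) (natDegree_mul_le.trans (by omega))
  have h2 : (W * derivative v).coeff (2 * k) = W.coeff (k + 1) * (v.coeff k * k) := by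
    rw [show 2 * k = (k + 1) + (k - 1) by omega, coeff_mul_add_eq_of_natDegree_le hW hd,
      coeff_derivative, Nat.sub_add_cancel hk, Nat.cast_sub hk]
    simp
  have h3 : W * derivative v = derivative (W * v) - derivative W * v := by
    rw [derivative_mul]; ring
  rw [h2, h3, map_sub, polyInt_derivative, ← h3, hWc] at h1
  simp only [eval_mul] at h1
  simp only [svForm, cellInt, polyInt_derivative]
  rw [sum_testWeight_mul_sub hA hk hv fun j => W.eval (s j), h1, hs.2.1, hs.2.2]
  ring

theorem svForm_comm (hs : IsRefPartition s) (hA : IsSVQuad s A κ) (hk : 1 ≤ k)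
    {u v : ℝ[X]} (hu : u.natDegree ≤ k) (hv : v.natDegree ≤ k) :
    svForm s A u v = svForm s A v u := by
  rw [svForm_eq hs hA hk hu hv, svForm_eq hs hA hk hv hu, mul_comm u v, mul_comm (u.coeff k)]

theorem polyInt_sq_le_svForm (hs : IsRefPartition s) (hA : IsSVQuad s A κ) (hk : 1 ≤ k)
    {v : ℝ[X]} (hv : v.natDegree ≤ k) : polyInt (-1) 1 (v ^ 2) ≤ svForm s A v v := by
  rw [svForm_eq hs hA hk hv hv, ← sq, ← sq]
  have := hA.nonneg
  have : 0 ≤ κ * (k / (k + 1)) * v.coeff k ^ 2 := by positivity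
  linarith

end Form

/-! ### Uniform constants on the reference element -/

theorem exists_coeff_sq_le (k : ℕ) : ∃ K : ℝ, 0 ≤ K ∧ ∀ v : ℝ[X], v.natDegree ≤ k →
    ∀ m, v.coeff m ^ 2 ≤ K * polyInt (-1) 1 (v ^ 2) := by
  set Φ : (Fin (k + 1) → ℝ) → ℝ[X] := fun c => ∑ m, C (c m) * X ^ (m : ℕ) with hΦ
  have hcont : Continuous fun c => polyInt (-1) 1 (Φ c ^ 2) := by
    have : ∀ c, polyInt (-1) 1 (Φ c ^ 2)
        = ∑ m, ∑ n, c m * (c n * polyInt (-1) 1 (X ^ (m : ℕ) * X ^ (n : ℕ))) := fun c => by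
      rw [sq, hΦ, Finset.sum_mul_sum, map_sum]
      refine Finset.sum_congr rfl fun m _ => ?_
      rw [map_sum]
      refine Finset.sum_congr rfl fun n _ => ?_
      rw [show C (c m) * X ^ (m : ℕ) * (C (c n) * X ^ (n : ℕ))
        = C (c m) * (C (c n) * (X ^ (m : ℕ) * X ^ (n : ℕ))) by ring, ← smul_eq_C_mul,
        ← smul_eq_C_mul, map_smul, map_smul, smul_eq_mul, smul_eq_mul]
    simp only [this]
    fun_prop
  have hcoeff : ∀ c (m : Fin (k + 1)), (Φ c).coeff m = c m := fun c m => by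
    simp [hΦ, finsetSum_coeff, coeff_C_mul, coeff_X_pow, Fin.val_inj]
  obtain ⟨c₀, hc₀, hmin⟩ := (isCompact_sphere (0 : Fin (k + 1) → ℝ) 1).exists_isMinOn
    (NormedSpace.sphere_nonempty.2 zero_le_one) hcont.continuousOn
  have hpos : 0 < polyInt (-1) 1 (Φ c₀ ^ 2) := by
    refine polyInt_sq_pos fun h0 => ?_
    have : c₀ = 0 := by ext m; exact (hcoeff c₀ m).symm.trans (by rw [h0]; simp)
    simp [this] at hc₀
  refine ⟨(polyInt (-1) 1 (Φ c₀ ^ 2))⁻¹, by positivity, fun v hv m => ?_⟩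
  set c : Fin (k + 1) → ℝ := fun m => v.coeff m with hc
  have hvc : v = Φ c := by
    rw [v.as_sum_range_C_mul_X_pow' (by omega : v.natDegree < k + 1), hΦ]
    exact Finset.sum_range fun i => C (v.coeff i) * X ^ i
  have hnorm : ‖c‖ ^ 2 * polyInt (-1) 1 (Φ c₀ ^ 2) ≤ polyInt (-1) 1 (v ^ 2) := by
    rcases eq_or_ne c 0 with h0 | h0
    · rw [h0, norm_zero]
      simpa using polyInt_sq_nonneg v
    · have hn : 0 < ‖c‖ := norm_pos_iff.2 h0
      have h1 : polyInt (-1) 1 (Φ c₀ ^ 2) ≤ polyInt (-1) 1 (Φ (‖c‖⁻¹ • c) ^ 2) :=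
        hmin (by simp [norm_smul, hn.ne'])
      have h2 : v = C ‖c‖ * Φ (‖c‖⁻¹ • c) := by
        conv_lhs => rw [hvc]
        simp only [hΦ, Finset.mul_sum, Pi.smul_apply, smul_eq_mul, ← mul_assoc, ← C_mul]
        simp [hn.ne']
      rw [h2, mul_pow, ← C_pow, ← smul_eq_C_mul, map_smul, smul_eq_mul]
      gcongr
  rw [inv_mul_eq_div, le_div_iff₀ hpos]
  refine le_trans (mul_le_mul_of_nonneg_right ?_ hpos.le) hnorm
  rw [← sq_abs]
  gcongr
  by_cases hm : m < k + 1
  · exact norm_le_pi_norm c ⟨m, hm⟩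
  · rw [coeff_eq_zero_of_natDegree_lt (by omega)]; simp

theorem abs_eval_le_of_abs_coeff_le {k : ℕ} {v : ℝ[X]} (hv : v.natDegree ≤ k) {B : ℝ}
    (hB : ∀ m, |v.coeff m| ≤ B) {r : ℝ} (hr : r ∈ Icc (-1 : ℝ) 1) :
    |v.eval r| ≤ (k + 1) * B := by
  have hr1 : |r| ≤ 1 := abs_le.2 hr
  rw [eval_eq_sum_range' (Nat.lt_succ_of_le hv)]
  refine (Finset.abs_sum_le_sum_abs _ _).trans ?_
  refine (Finset.sum_le_sum (g := fun _ => B) fun m _ => ?_).trans_eq (by simp)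
  rw [abs_mul, abs_pow]
  have : |r| ^ m ≤ 1 := pow_le_one₀ (abs_nonneg r) hr1
  nlinarith [abs_nonneg (v.coeff m), hB m]

/-- Norm equivalence on polynomials of degree at most `k`. -/
theorem exists_eval_sq_le (k : ℕ) : ∃ K : ℝ, 0 ≤ K ∧ ∀ v : ℝ[X], v.natDegree ≤ k →
    ∀ r ∈ Icc (-1 : ℝ) 1, v.eval r ^ 2 ≤ K * polyInt (-1) 1 (v ^ 2) ∧
      (derivative v).eval r ^ 2 ≤ K * polyInt (-1) 1 (v ^ 2) := by
  obtain ⟨K, hK, h⟩ := exists_coeff_sq_le k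
  refine ⟨(k + 1) ^ 4 * K, by positivity, fun v hv r hr => ?_⟩
  set I := polyInt (-1) 1 (v ^ 2) with hI
  have hI0 : 0 ≤ I := polyInt_sq_nonneg v
  have hB : ∀ m, |v.coeff m| ≤ √(K * I) := fun m => Real.abs_le_sqrt (h v hv m)
  have hsq : √(K * I) ^ 2 = K * I := Real.sq_sqrt (by positivity)
  have h1 := abs_eval_le_of_abs_coeff_le hv hB hr
  have h2 : |(derivative v).eval r| ≤ (k + 1) * ((k + 1) * √(K * I)) := by
    refine abs_eval_le_of_abs_coeff_le ((natDegree_derivative_le v).trans (by omega)) ?_ hr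
    intro m
    rw [coeff_derivative, abs_mul, mul_comm]
    by_cases hm : m ≤ k
    · have : |(m : ℝ) + 1| ≤ k + 1 := by
        rw [abs_of_nonneg (by positivity)]; gcongr
      gcongr
      exact hB _
    · rw [coeff_eq_zero_of_natDegree_lt (by omega)]
      simp only [abs_zero, mul_zero]; positivity
  have hk1 : (1 : ℝ) ≤ k + 1 := by simp
  have hKI : 0 ≤ K * I := by positivity
  constructor
  · rw [← sq_abs]
    calc |v.eval r| ^ 2 ≤ ((k + 1) * √(K * I)) ^ 2 := by gcongr
      _ = (k + 1) ^ 2 * (K * I) := by rw [mul_pow, hsq]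
      _ ≤ (k + 1) ^ 4 * (K * I) := by gcongr; norm_num
      _ = _ := by ring
  · rw [← sq_abs]
    calc |(derivative v).eval r| ^ 2 ≤ ((k + 1) * ((k + 1) * √(K * I))) ^ 2 := by gcongr
      _ = (k + 1) ^ 4 * √(K * I) ^ 2 := by ring
      _ = _ := by rw [hsq]; ring

end

section

variable {k : ℕ}

/-- The data of a reference element: partition points `s`, quadrature weights `A`, and one constant
`K` for all the norm equivalences on polynomials of degree at most `k` that are used. -/
structure IsRefElement (K : ℝ) (s A : Fin (k + 2) → ℝ) : Prop where
  one_le : 1 ≤ K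
  partition : IsRefPartition s
  quad : ∃ κ, IsSVQuad s A κ
  abs_weight_le : ∀ j, |A j| ≤ K
  eval_sq_le : ∀ v : ℝ[X], v.natDegree ≤ k → ∀ r ∈ Icc (-1 : ℝ) 1,
    v.eval r ^ 2 ≤ K * polyInt (-1) 1 (v ^ 2) ∧
      (derivative v).eval r ^ 2 ≤ K * polyInt (-1) 1 (v ^ 2)
  testWeight_sq_le : ∀ v : ℝ[X], v.natDegree ≤ k → ∀ j,
    testWeight s A j v ^ 2 ≤ K * polyInt (-1) 1 (v ^ 2)
  svForm_le : ∀ v : ℝ[X], v.natDegree ≤ k → ∀ B : ℝ, (∀ r ∈ Icc (-1 : ℝ) 1, |v.eval r| ≤ B) →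
    svForm s A v v ≤ K * B ^ 2
  lebesgue : ∀ e : Fin (k + 1) → Fin (k + 2), Function.Injective e → ∀ P : ℝ[X],
    P.natDegree ≤ k → ∀ B : ℝ, (∀ j, |P.eval (s (e j))| ≤ B) → ∀ r ∈ Icc (-1 : ℝ) 1,
      |P.eval r| ≤ K * B ∧ |(derivative P).eval r| ≤ K * B
  abs_basis_le : ∀ m, ∀ r ∈ Icc (-1 : ℝ) 1, |(Lagrange.basis Finset.univ s m).eval r| ≤ K

theorem polyInt_sq_le {v : ℝ[X]} {B : ℝ} (h : ∀ r ∈ Icc (-1 : ℝ) 1, |v.eval r| ≤ B) :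
    polyInt (-1) 1 (v ^ 2) ≤ 2 * B ^ 2 := by
  refine (le_abs_self _).trans ((abs_polyInt_le (B := B ^ 2) (by norm_num) fun x hx => ?_).trans_eq
    (by ring))
  rw [eval_pow, abs_pow]
  have := h x hx
  gcongr

theorem IsRefElement.mono {K K' : ℝ} {s A : Fin (k + 2) → ℝ} (h : IsRefElement K s A)
    (hK : K ≤ K') : IsRefElement K' s A where
  one_le := h.one_le.trans hK
  partition := h.partition
  quad := h.quad
  abs_weight_le j := (h.abs_weight_le j).trans hK
  eval_sq_le v hv r hr := by
    have := polyInt_sq_nonneg v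
    have h1 := h.eval_sq_le v hv r hr
    exact ⟨h1.1.trans (by gcongr), h1.2.trans (by gcongr)⟩
  testWeight_sq_le v hv j := by
    have := polyInt_sq_nonneg v
    exact (h.testWeight_sq_le v hv j).trans (by gcongr)
  svForm_le v hv B hB := (h.svForm_le v hv B hB).trans (by gcongr)
  lebesgue e he P hP B hB r hr := by
    have h1 := h.lebesgue e he P hP B hB r hr
    have h0 : 0 ≤ B := (abs_nonneg _).trans (hB 0)
    exact ⟨h1.1.trans (by gcongr), h1.2.trans (by gcongr)⟩
  abs_basis_le m r hr := (h.abs_basis_le m r hr).trans hK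

/-- Bounds for a polynomial and its derivative in terms of its values at interpolation nodes. -/
theorem exists_lebesgue_bound {σ : Fin (k + 1) → ℝ} (hσ : Function.Injective σ) :
    ∃ K : ℝ, ∀ P : ℝ[X], P.natDegree ≤ k → ∀ B : ℝ, (∀ j, |P.eval (σ j)| ≤ B) →
      ∀ r ∈ Icc (-1 : ℝ) 1, |P.eval r| ≤ K * B ∧ |(derivative P).eval r| ≤ K * B := by
  have hb : ∀ p : ℝ[X], ∃ b : ℝ, ∀ r ∈ Icc (-1 : ℝ) 1, |p.eval r| ≤ b := fun p =>
    isCompact_Icc.exists_bound_of_continuousOn p.continuous.continuousOn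
  choose b hb using hb
  set ℓ := Lagrange.basis Finset.univ σ with hℓ
  refine ⟨∑ j, (b (ℓ j) + b (derivative (ℓ j))), fun P hP B hB r hr => ?_⟩
  have hB0 : 0 ≤ B := (abs_nonneg _).trans (hB 0)
  have hPe : P = ∑ j, C (P.eval (σ j)) * ℓ j := by
    rw [← Lagrange.interpolate_apply]
    refine Lagrange.eq_interpolate hσ.injOn (degree_le_natDegree.trans_lt ?_)
    simp only [Finset.card_univ, Fintype.card_fin]
    norm_cast; omega
  have hb0 : ∀ p, 0 ≤ b p := fun p => (abs_nonneg _).trans (hb p r hr)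
  constructor
  · rw [hPe, eval_finsetSum, Finset.sum_mul]
    refine (Finset.abs_sum_le_sum_abs _ _).trans (Finset.sum_le_sum fun j _ => ?_)
    rw [eval_mul, eval_C, abs_mul, mul_comm]
    have h1 := hb (ℓ j) r hr
    have h2 := hb0 (derivative (ℓ j))
    exact mul_le_mul (by linarith) (hB j) (abs_nonneg _) (add_nonneg (hb0 _) h2)
  · rw [hPe, derivative_sum, eval_finsetSum, Finset.sum_mul]
    refine (Finset.abs_sum_le_sum_abs _ _).trans (Finset.sum_le_sum fun j _ => ?_)
    rw [derivative_C_mul, eval_mul, eval_C, abs_mul, mul_comm]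
    have h1 := hb (derivative (ℓ j)) r hr
    have h2 := hb0 (ℓ j)
    exact mul_le_mul (by linarith) (hB j) (abs_nonneg _) (add_nonneg h2 (hb0 _))

theorem exists_isRefElement_of_quad (hk : 1 ≤ k) {s A : Fin (k + 2) → ℝ} {κ : ℝ}
    (hs : IsRefPartition s) (hA : IsSVQuad s A κ) : ∃ K, IsRefElement K s A := by
  obtain ⟨K₁, hK₁, h₁⟩ := exists_eval_sq_le k
  obtain ⟨K₀, hK₀, h₀⟩ := exists_coeff_sq_le k
  have hL : ∀ e : Fin (k + 1) → Fin (k + 2), ∃ K : ℝ, Function.Injective e → ∀ P : ℝ[X],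
      P.natDegree ≤ k → ∀ B : ℝ, (∀ j, |P.eval (s (e j))| ≤ B) → ∀ r ∈ Icc (-1 : ℝ) 1,
      |P.eval r| ≤ K * B ∧ |(derivative P).eval r| ≤ K * B := fun e => by
    by_cases he : Function.Injective e
    · obtain ⟨K, hK⟩ := exists_lebesgue_bound (hs.1.injective.comp he)
      exact ⟨K, fun _ => hK⟩
    · exact ⟨0, fun h => absurd h he⟩
  choose K₂ h₂ using hL
  have hb : ∀ m, ∃ b : ℝ, ∀ r ∈ Icc (-1 : ℝ) 1, |(Lagrange.basis Finset.univ s m).eval r| ≤ b :=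
    fun m => isCompact_Icc.exists_bound_of_continuousOn (Polynomial.continuous _).continuousOn
  choose b hb using hb
  have hb0 : ∀ m, 0 ≤ b m := fun m => (abs_nonneg _).trans (hb m 0 (by norm_num))
  set a := ∑ j, |A j| with ha
  have ha0 : 0 ≤ a := by positivity
  have haj : ∀ j, |A j| ≤ a := fun j =>
    Finset.single_le_sum (f := fun j => |A j|) (fun _ _ => abs_nonneg _) (Finset.mem_univ j)
  set K : ℝ := 3 + a + K₁ + 2 * ((1 + a) ^ 2 * K₁) + 2 * (κ * K₀) + ∑ e, |K₂ e| + ∑ m, b m with hK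
  have hκ := hA.nonneg
  have hs2 : ∀ e, |K₂ e| ≤ ∑ e, |K₂ e| := fun e =>
    Finset.single_le_sum (f := fun e => |K₂ e|) (fun _ _ => abs_nonneg _) (Finset.mem_univ e)
  have hsb : ∀ m, b m ≤ ∑ m, b m := fun m =>
    Finset.single_le_sum (f := b) (fun _ _ => hb0 _) (Finset.mem_univ m)
  have hsum2 : 0 ≤ ∑ e, |K₂ e| := by positivity
  have hsumb : 0 ≤ ∑ m, b m := Finset.sum_nonneg fun m _ => hb0 m
  have hp1 : 0 ≤ (1 + a) ^ 2 * K₁ := by positivity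
  have hp2 : 0 ≤ κ * K₀ := by positivity
  refine ⟨K, by linarith, hs, ⟨κ, hA⟩, fun j => (haj j).trans (by linarith), ?_, ?_, ?_, ?_, ?_⟩
  · intro v hv r hr
    have h3 := h₁ v hv r hr
    have h4 : K₁ * polyInt (-1) 1 (v ^ 2) ≤ K * polyInt (-1) 1 (v ^ 2) :=
      mul_le_mul_of_nonneg_right (by linarith) (polyInt_sq_nonneg v)
    exact ⟨h3.1.trans h4, h3.2.trans h4⟩
  · intro v hv j
    set I := polyInt (-1) 1 (v ^ 2) with hI
    have hI0 : 0 ≤ I := polyInt_sq_nonneg v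
    have hsq : √(K₁ * I) ^ 2 = K₁ * I := Real.sq_sqrt (by positivity)
    have h3 : |testWeight s A j v| ≤ (1 + a) * √(K₁ * I) := by
      rw [testWeight_apply, add_mul, one_mul]
      refine (abs_add_le _ _).trans (add_le_add
        (Real.abs_le_sqrt (h₁ v hv (-1) (by norm_num)).1) ?_)
      refine (Finset.abs_sum_le_sum_abs _ _).trans ?_
      refine (Finset.sum_le_univ_sum_of_nonneg fun _ => abs_nonneg _).trans ?_
      rw [ha, Finset.sum_mul]
      refine Finset.sum_le_sum fun i _ => ?_
      rw [abs_mul]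
      gcongr
      exact Real.abs_le_sqrt (h₁ v hv (s i) (hs.mem_Icc i)).2
    rw [← sq_abs]
    calc |testWeight s A j v| ^ 2 ≤ ((1 + a) * √(K₁ * I)) ^ 2 := by gcongr
      _ = ((1 + a) ^ 2 * K₁) * I := by rw [mul_pow, hsq]; ring
      _ ≤ K * I := mul_le_mul_of_nonneg_right (by linarith) hI0
  · intro v hv B hB
    have h3 := polyInt_sq_le hB
    have hI0 := polyInt_sq_nonneg v
    rw [svForm_eq hs hA hk hv hv, ← sq, ← sq]
    have h4 := h₀ v hv k
    have h5 : (k : ℝ) / (k + 1) ≤ 1 := by rw [div_le_one (by positivity)]; linarith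
    calc polyInt (-1) 1 (v ^ 2) + κ * (k / (k + 1)) * v.coeff k ^ 2
        ≤ 2 * B ^ 2 + κ * 1 * (K₀ * (2 * B ^ 2)) := by
          gcongr
          exact h4.trans (by gcongr)
      _ = (2 + 2 * (κ * K₀)) * B ^ 2 := by ring
      _ ≤ K * B ^ 2 := mul_le_mul_of_nonneg_right (by linarith) (sq_nonneg B)
  · intro e he P hP B hB r hr
    have hB0 : 0 ≤ B := (abs_nonneg _).trans (hB 0)
    have h3 := h₂ e he P hP B hB r hr
    have h4 : K₂ e * B ≤ K * B :=
      mul_le_mul_of_nonneg_right ((le_abs_self _).trans ((hs2 e).trans (by linarith))) hB0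
    exact ⟨h3.1.trans h4, h3.2.trans h4⟩
  · intro m r hr
    exact (hb m r hr).trans ((hsb m).trans (by linarith))

theorem exists_forall_of_finite {ι : Type*} {S : Set ι} (hS : S.Finite) {P : ℝ → ι → Prop}
    (hP : ∀ i K K', K ≤ K' → P K i → P K' i) (h : ∀ i ∈ S, ∃ K, P K i) :
    ∃ K, ∀ i ∈ S, P K i := by
  choose! K hK using h
  obtain ⟨b, hb⟩ := (hS.image K).bddAbove
  exact ⟨b, fun i hi => hP i _ _ (hb (mem_image_of_mem K hi)) (hK i hi)⟩

theorem legendre_succ_sub_ne_zero (k : ℕ) : legendre (k + 1) - legendre k ≠ 0 := fun h => by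
  have := congrArg (fun p => coeff p (k + 1)) h
  simp only [coeff_sub, coeff_zero,
    coeff_eq_zero_of_natDegree_lt (Nat.lt_succ_of_le (natDegree_legendre_le k)), sub_zero] at this
  exact coeff_legendre_ne_zero _ this

theorem legendre_succ_add_ne_zero (k : ℕ) : legendre (k + 1) + legendre k ≠ 0 := fun h => by
  have := congrArg (fun p => coeff p (k + 1)) h
  simp only [coeff_add, coeff_zero,
    coeff_eq_zero_of_natDegree_lt (Nat.lt_succ_of_le (natDegree_legendre_le k)), add_zero] at this
  exact coeff_legendre_ne_zero _ this

theorem legendre_ne_zero (k : ℕ) : legendre k ≠ 0 := fun h =>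
  coeff_legendre_ne_zero k (by rw [h, coeff_zero])

/-- For a given `k`, there are only finitely many Gauss and Radau partitions. -/
theorem finite_partitions (k : ℕ) : {s : Fin (k + 2) → ℝ |
    IsGaussPartition s ∨ IsRightRadauPartition s ∨ IsLeftRadauPartition s}.Finite := by
  set S : Set ℝ := {-1, 1} ∪ ((legendre k).rootSet ℝ ∪ ((legendre (k + 1) - legendre k).rootSet ℝ ∪
    (legendre (k + 1) + legendre k).rootSet ℝ)) with hS
  have hfin : S.Finite := ((Set.finite_singleton _).insert _).union
    ((rootSet_finite _ _).union ((rootSet_finite _ _).union (rootSet_finite _ _)))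
  refine (Set.Finite.pi' (t := fun _ : Fin (k + 2) => S) fun _ => hfin).subset ?_
  rintro s hs j
  have hj : j = 0 ∨ j = Fin.last (k + 1) ∨ (j ≠ 0 ∧ j ≠ Fin.last (k + 1)) := by tauto
  have hends : IsRefPartition s → (j = 0 ∨ j = Fin.last (k + 1)) → s j ∈ S := by
    rintro h (rfl | rfl)
    · exact Or.inl (Or.inl h.2.1)
    · exact Or.inl (Or.inr h.2.2)
  rcases hs with h | h | h
  · rcases or_assoc.2 hj with h1 | h1
    · exact hends h.1 h1
    · refine Or.inr (Or.inl ?_)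
      rw [mem_rootSet]
      exact ⟨legendre_ne_zero k, by simpa using h.2 j h1.1 h1.2⟩
  · rcases or_assoc.2 hj with h1 | h1
    · exact hends h.1 h1
    · refine Or.inr (Or.inr (Or.inl ?_))
      rw [mem_rootSet]
      exact ⟨legendre_succ_sub_ne_zero k, by simpa using h.2 j h1.1⟩
  · rcases or_assoc.2 hj with h1 | h1
    · exact hends h.1 h1
    · refine Or.inr (Or.inr (Or.inr ?_))
      rw [mem_rootSet]
      exact ⟨legendre_succ_add_ne_zero k, by simpa using h.2 j h1.2⟩

/-- One constant serves all Gauss and Radau partitions for a given `k`, since there are finitely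
many. The weights vanish at the end points that are not quadrature nodes. -/
theorem exists_isRefElement (hk : 1 ≤ k) : ∃ K : ℝ, ∀ s : Fin (k + 2) → ℝ,
    (IsGaussPartition s → ∃ A, IsRefElement K s A ∧ A 0 = 0 ∧ A (Fin.last (k + 1)) = 0) ∧
    (IsRightRadauPartition s → ∃ A, IsRefElement K s A ∧ A 0 = 0) ∧
    (IsLeftRadauPartition s → ∃ A, IsRefElement K s A ∧ A (Fin.last (k + 1)) = 0) := by
  have hfin := finite_partitions k
  obtain ⟨K₁, h₁⟩ := exists_forall_of_finite (S := {s | IsGaussPartition s})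
    (P := fun K s => ∃ A, IsRefElement K s A ∧ A 0 = 0 ∧ A (Fin.last (k + 1)) = 0)
    (hfin.subset fun s hs => Or.inl hs)
    (fun _ _ _ h => fun ⟨A, hA⟩ => ⟨A, hA.1.mono h, hA.2⟩) (fun s hs => by
      obtain ⟨A, κ, hA, h0⟩ := IsGaussPartition.exists_isSVQuad hk hs
      obtain ⟨K, hK⟩ := exists_isRefElement_of_quad hk hs.1 hA
      exact ⟨K, A, hK, h0⟩)
  obtain ⟨K₂, h₂⟩ := exists_forall_of_finite (S := {s | IsRightRadauPartition s})
    (P := fun K s => ∃ A, IsRefElement K s A ∧ A 0 = 0)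
    (hfin.subset fun s hs => Or.inr (Or.inl hs))
    (fun _ _ _ h => fun ⟨A, hA⟩ => ⟨A, hA.1.mono h, hA.2⟩) (fun s hs => by
      obtain ⟨A, κ, hA, h0⟩ := IsRightRadauPartition.exists_isSVQuad hk hs
      obtain ⟨K, hK⟩ := exists_isRefElement_of_quad hk hs.1 hA
      exact ⟨K, A, hK, h0⟩)
  obtain ⟨K₃, h₃⟩ := exists_forall_of_finite (S := {s | IsLeftRadauPartition s})
    (P := fun K s => ∃ A, IsRefElement K s A ∧ A (Fin.last (k + 1)) = 0)
    (hfin.subset fun s hs => Or.inr (Or.inr hs))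
    (fun _ _ _ h => fun ⟨A, hA⟩ => ⟨A, hA.1.mono h, hA.2⟩) (fun s hs => by
      obtain ⟨A, κ, hA, h0⟩ := IsLeftRadauPartition.exists_isSVQuad hk hs
      obtain ⟨K, hK⟩ := exists_isRefElement_of_quad hk hs.1 hA
      exact ⟨K, A, hK, h0⟩)
  refine ⟨max K₁ (max K₂ K₃), fun s => ⟨fun hs => ?_, fun hs => ?_, fun hs => ?_⟩⟩
  · obtain ⟨A, hA, h⟩ := h₁ s hs
    exact ⟨A, hA.mono (le_max_left _ _), h⟩
  · obtain ⟨A, hA, h⟩ := h₂ s hs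
    exact ⟨A, hA.mono ((le_max_left _ _).trans (le_max_right _ _)), h⟩
  · obtain ⟨A, hA, h⟩ := h₃ s hs
    exact ⟨A, hA.mono ((le_max_right _ _).trans (le_max_right _ _)), h⟩

end

section

/-! ### Vanishing mean of the nodal polynomials -/

variable {k : ℕ}

theorem eq_C_mul_basis {s : Fin (k + 2) → ℝ} (hs : Function.Injective s) (m : Fin (k + 2))
    {P : ℝ[X]} (hdeg : P.natDegree ≤ k + 1) (hP : ∀ j, j ≠ m → P.eval (s j) = 0) :
    P = C (P.eval (s m)) * Lagrange.basis Finset.univ s m := by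
  have hdegb : (Lagrange.basis Finset.univ s m).natDegree ≤ k + 1 := by
    rw [Lagrange.natDegree_basis hs.injOn (Finset.mem_univ m)]; simp
  refine Polynomial.eq_of_degrees_lt_of_eval_index_eq (v := s) Finset.univ hs.injOn
    (degree_le_natDegree.trans_lt ?_) (degree_le_natDegree.trans_lt ?_) fun j _ => ?_
  · simp only [Finset.card_univ, Fintype.card_fin]; norm_cast; omega
  · have := (natDegree_C_mul_le (P.eval (s m)) (Lagrange.basis Finset.univ s m)).trans hdegb
    simp only [Finset.card_univ, Fintype.card_fin]; norm_cast; omega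
  · rw [eval_mul, eval_C]
    rcases eq_or_ne j m with rfl | hj
    · rw [Lagrange.eval_basis_self hs.injOn (Finset.mem_univ _), mul_one]
    · rw [hP j hj, Lagrange.eval_basis_of_ne hj.symm (Finset.mem_univ _), mul_zero]

theorem polyInt_basis_eq_zero {s : Fin (k + 2) → ℝ} (hs : Function.Injective s) (m : Fin (k + 2))
    {P : ℝ[X]} (hdeg : P.natDegree ≤ k + 1) (hP0 : P ≠ 0) (hP : ∀ j, j ≠ m → P.eval (s j) = 0)
    (hint : polyInt (-1) 1 P = 0) : polyInt (-1) 1 (Lagrange.basis Finset.univ s m) = 0 := by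
  have h := eq_C_mul_basis hs m hdeg hP
  rw [h, ← smul_eq_C_mul, map_smul, smul_eq_mul] at hint
  refine (mul_eq_zero.1 hint).resolve_left fun h0 => hP0 ?_
  rw [h, h0, C_0, zero_mul]

theorem polyInt_legendre (n : ℕ) (hn : 1 ≤ n) : polyInt (-1) 1 (legendre n) = 0 := by
  have := polyInt_legendre_mul n 1 (by rw [degree_one]; exact_mod_cast hn)
  rwa [mul_one] at this

theorem IsRightRadauPartition.polyInt_basis (hk : 1 ≤ k) {s : Fin (k + 2) → ℝ}
    (h : IsRightRadauPartition s) : polyInt (-1) 1 (Lagrange.basis Finset.univ s 0) = 0 :=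
  polyInt_basis_eq_zero h.1.1.injective 0
    ((natDegree_sub_le_of_le (natDegree_legendre_le _) (natDegree_legendre_le k)).trans (by simp))
    (legendre_succ_sub_ne_zero k) h.2
    (by rw [map_sub, polyInt_legendre _ (by omega), polyInt_legendre _ hk, sub_zero])

theorem IsLeftRadauPartition.polyInt_basis (hk : 1 ≤ k) {s : Fin (k + 2) → ℝ}
    (h : IsLeftRadauPartition s) :
    polyInt (-1) 1 (Lagrange.basis Finset.univ s (Fin.last (k + 1))) = 0 :=
  polyInt_basis_eq_zero h.1.1.injective _
    (natDegree_add_le_of_degree_le (natDegree_legendre_le _)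
      ((natDegree_legendre_le k).trans (Nat.le_succ k)))
    (legendre_succ_add_ne_zero k) h.2
    (by rw [map_add, polyInt_legendre _ (by omega), polyInt_legendre _ hk, add_zero])

/-- For `k ≥ 2` the polynomials `(x ± 1) L_k` have mean zero, because `L_k` is orthogonal to the
polynomials of degree one. For `k = 1` this fails. -/
theorem IsGaussPartition.polyInt_basis (hk : 2 ≤ k) {s : Fin (k + 2) → ℝ}
    (h : IsGaussPartition s) (m : Fin (k + 2)) (hm : m = 0 ∨ m = Fin.last (k + 1)) :
    polyInt (-1) 1 (Lagrange.basis Finset.univ s m) = 0 := by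
  have key : ∀ c : ℝ, (∀ j, j ≠ m → j = 0 ∨ j = Fin.last (k + 1) → s j = c) →
      polyInt (-1) 1 (Lagrange.basis Finset.univ s m) = 0 := fun c hc => by
    refine polyInt_basis_eq_zero h.1.1.injective m (P := legendre k * (X - C c))
      (natDegree_mul_le.trans ?_) (mul_ne_zero (legendre_ne_zero k) (X_sub_C_ne_zero c))
      (fun j hj => ?_) (polyInt_legendre_mul k _ ?_)
    · rw [natDegree_X_sub_C]
      have := natDegree_legendre_le k
      omega
    · rw [eval_mul]
      by_cases h0 : j = 0 ∨ j = Fin.last (k + 1)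
      · simp [hc j hj h0]
      · rw [h.2 j (fun h1 => h0 (Or.inl h1)) (fun h1 => h0 (Or.inr h1)), zero_mul]
    · rw [degree_X_sub_C]; exact_mod_cast hk
  rcases hm with rfl | rfl
  · exact key 1 fun j hj h0 => by rw [h0.resolve_left hj, h.1.2.2]
  · exact key (-1) fun j hj h0 => by rw [h0.resolve_right hj, h.1.2.1]

end

section

/-! ### Differentiable families of polynomials -/

variable {k N : ℕ}

/-- `V'` is the derivative at `t` within `S` of the polynomial-valued function `V`, tested by all
linear functionals. -/
def HasPolyDerivWithinAt (V : ℝ → ℝ[X]) (V' : ℝ[X]) (S : Set ℝ) (t : ℝ) : Prop :=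
  ∀ F : ℝ[X] →ₗ[ℝ] ℝ, HasDerivWithinAt (fun τ => F (V τ)) (F V') S t

theorem HasPolyDerivWithinAt.sub {V W : ℝ → ℝ[X]} {V' W' : ℝ[X]} {S : Set ℝ} {t : ℝ}
    (hV : HasPolyDerivWithinAt V V' S t) (hW : HasPolyDerivWithinAt W W' S t) :
    HasPolyDerivWithinAt (fun τ => V τ - W τ) (V' - W') S t := fun F => by
  simpa only [map_sub] using (hV F).fun_sub (hW F)

theorem HasPolyDerivWithinAt.map {V : ℝ → ℝ[X]} {V' : ℝ[X]} {S : Set ℝ} {t : ℝ}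
    (hV : HasPolyDerivWithinAt V V' S t) (T : ℝ[X] →ₗ[ℝ] ℝ[X]) :
    HasPolyDerivWithinAt (fun τ => T (V τ)) (T V') S t := fun F => hV (F ∘ₗ T)

theorem HasPolyDerivWithinAt.smul_const {c : ℝ → ℝ} {c' : ℝ} {S : Set ℝ} {t : ℝ}
    (hc : HasDerivWithinAt c c' S t) (P : ℝ[X]) :
    HasPolyDerivWithinAt (fun τ => c τ • P) (c' • P) S t := fun F => by
  simpa only [map_smul, smul_eq_mul] using hc.mul_const (F P)

theorem HasPolyDerivWithinAt.sum {ι : Type*} (J : Finset ι) {V : ι → ℝ → ℝ[X]} {V' : ι → ℝ[X]}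
    {S : Set ℝ} {t : ℝ} (hV : ∀ i ∈ J, HasPolyDerivWithinAt (V i) (V' i) S t) :
    HasPolyDerivWithinAt (fun τ => ∑ i ∈ J, V i τ) (∑ i ∈ J, V' i) S t := fun F => by
  simpa only [map_sum] using HasDerivWithinAt.fun_sum fun i hi => hV i hi F

theorem HasPolyDerivWithinAt.of_coeff {V : ℝ → ℝ[X]} {V' : ℝ[X]} {S : Set ℝ} {t : ℝ}
    (hV : ∀ τ ∈ S, (V τ).natDegree ≤ k) (hV' : V'.natDegree ≤ k) (ht : t ∈ S)
    (h : ∀ m, HasDerivWithinAt (fun τ => (V τ).coeff m) (V'.coeff m) S t) :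
    HasPolyDerivWithinAt V V' S t := by
  have hP : ∀ P : ℝ[X], P.natDegree ≤ k →
      P = ∑ m ∈ Finset.range (k + 1), P.coeff m • (X ^ m : ℝ[X]) := fun P hP => by
    conv_lhs => rw [P.as_sum_range_C_mul_X_pow' (by omega : P.natDegree < k + 1)]
    simp only [smul_eq_C_mul]
  have h1 : HasPolyDerivWithinAt
      (fun τ => ∑ m ∈ Finset.range (k + 1), (V τ).coeff m • (X ^ m : ℝ[X])) V' S t := by
    rw [hP V' hV']
    exact HasPolyDerivWithinAt.sum _ fun m _ => HasPolyDerivWithinAt.smul_const (h m) _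
  intro F
  refine (h1 F).congr (fun τ hτ => ?_) ?_
  · exact congrArg F (hP _ (hV τ hτ))
  · exact congrArg F (hP _ (hV t ht))

theorem HasPolyDerivWithinAt.svForm_self {s A : Fin (k + 2) → ℝ} {V : ℝ → ℝ[X]} {V' : ℝ[X]}
    {S : Set ℝ} {t : ℝ} (h : HasPolyDerivWithinAt V V' S t) :
    HasDerivWithinAt (fun τ => svForm s A (V τ) (V τ))
      (svForm s A (V t) V' + svForm s A V' (V t)) S t := by
  have := HasDerivWithinAt.fun_sum (u := Finset.univ)
    fun j (_ : j ∈ Finset.univ) => (h (testWeight s A j)).fun_mul (h (cellInt s j))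
  refine this.congr_deriv ?_
  rw [Finset.sum_add_distrib]
  rfl

theorem HasPolyDerivWithinAt.mono {V : ℝ → ℝ[X]} {V' : ℝ[X]} {S S' : Set ℝ} {t : ℝ}
    (h : HasPolyDerivWithinAt V V' S t) (hS : S' ⊆ S) : HasPolyDerivWithinAt V V' S' t :=
  fun F => (h F).mono hS

/-! ### The semi-discrete scheme in reference coordinates -/

/-- The upwind value at the right end point of the `i`-th element; `a i` is the value of the
coefficient there. -/
def refUpwind (a : Fin N → ℝ) (V : Fin N → ℝ[X]) (i : Fin N) : ℝ :=
  if 0 < a i then (V i).eval 1 else (V (finRotate N i)).eval (-1)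

/-- The upwind value at the end points of the `i`-th element and the value of `V i` at the interior
partition points. -/
def refFlux (a : Fin N → ℝ) (s : Fin N → Fin (k + 2) → ℝ) (V : Fin N → ℝ[X]) (i : Fin N)
    (j : Fin (k + 2)) : ℝ :=
  if j = 0 then refUpwind a V ((finRotate N).symm i)
  else if j = Fin.last (k + 1) then refUpwind a V i
  else (V i).eval (s i j)

/-- The residual of the scheme: `∫ V_t dx + [α V̂]` over the `j`-th control volume of the `i`-th
element, which has length `H i` and the coefficient values `αp i` at its partition points. -/
def schemeRes (a H : Fin N → ℝ) (αp s : Fin N → Fin (k + 2) → ℝ) (V V' : Fin N → ℝ[X])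
    (i : Fin N) (j : Fin (k + 1)) : ℝ :=
  H i / 2 * cellInt (s i) j (V' i) + (αp i j.succ * refFlux a s V i j.succ
    - αp i j.castSucc * refFlux a s V i j.castSucc)

/-- The weighted energy `∑ β_i (V_i, V_i*)_{V_i}`. -/
def energy (H β : Fin N → ℝ) (s A : Fin N → Fin (k + 2) → ℝ) (V : Fin N → ℝ[X]) : ℝ :=
  ∑ i, β i * (H i / 2 * svForm (s i) (A i) (V i) (V i))

/-- The assumptions on mesh, coefficient and reference elements for the stability estimate. If the
quadrature rule of an element uses an end point at which the upwind value comes from the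
neighbouring element, then the coefficient has to be of size `O(h)` there. -/
structure IsDiscretization (K L ρ h : ℝ) (a H : Fin N → ℝ) (αp s A : Fin N → Fin (k + 2) → ℝ) :
    Prop where
  ref : ∀ i, IsRefElement K (s i) (A i)
  h_pos : 0 < h
  L_nonneg : 0 ≤ L
  rho_pos : 0 < ρ
  H_le : ∀ i, H i ≤ h
  le_H : ∀ i, h ≤ ρ * H i
  sum_H : ∑ i, H i = 2 * π
  first : ∀ i, αp i 0 = a ((finRotate N).symm i)
  last : ∀ i, αp i (Fin.last (k + 1)) = a i
  near : ∀ i j, |αp i j - a i| ≤ L * h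
  right : ∀ i, A i (Fin.last (k + 1)) ≠ 0 → a i ≤ 0 → |a i| ≤ L * h
  left : ∀ i, A i 0 ≠ 0 → 0 < a ((finRotate N).symm i) → |a ((finRotate N).symm i)| ≤ L * h

/-- Admissible energy weights: `β` varies slowly between neighbours, where the flux is not small. -/
structure IsWeight (Kβ h : ℝ) (a β : Fin N → ℝ) : Prop where
  nonneg : 0 ≤ Kβ
  pos : ∀ i, 0 < β i
  diff_left : ∀ i, |a i| * |β i - β (finRotate N i)| ≤ Kβ * h * β i
  diff_right : ∀ i, |a i| * |β i - β (finRotate N i)| ≤ Kβ * h * β (finRotate N i)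
  le_next : ∀ i, β i ≤ Kβ * β (finRotate N i)
  next_le : ∀ i, β (finRotate N i) ≤ Kβ * β i

section Stability

variable {K L ρ h Kβ : ℝ} {a H β : Fin N → ℝ} {αp s A : Fin N → Fin (k + 2) → ℝ}

/-- The quadrature part of the form agrees with its constant coefficient version up to `O(h)`. -/
theorem IsDiscretization.abs_quad_sub_le (hD : IsDiscretization K L ρ h a H αp s A) (hk : 1 ≤ k)
    {V : Fin N → ℝ[X]} (hV : ∀ i, (V i).natDegree ≤ k) (i : Fin N) :
    |∑ j, A i j * (αp i j * refFlux a s V i j * (derivative (V i)).eval (s i j))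
      - a i * ((V i).eval 1 ^ 2 - (V i).eval (-1) ^ 2) / 2|
      ≤ 5 * L * K ^ 2 * (k + 2) * h * (polyInt (-1) 1 (V i ^ 2)
        + polyInt (-1) 1 (V (finRotate N i) ^ 2)
        + polyInt (-1) 1 (V ((finRotate N).symm i) ^ 2)) := by
  set S := polyInt (-1) 1 (V i ^ 2) + polyInt (-1) 1 (V (finRotate N i) ^ 2)
        + polyInt (-1) 1 (V ((finRotate N).symm i) ^ 2) with hS
  have hI1 := polyInt_sq_nonneg (V i)
  have hI2 := polyInt_sq_nonneg (V (finRotate N i))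
  have hI3 := polyInt_sq_nonneg (V ((finRotate N).symm i))
  have hS0 : 0 ≤ S := by positivity
  have hR := hD.ref i
  have hK0 : 0 ≤ K := zero_le_one.trans hR.one_le
  have hL := hD.L_nonneg
  have hh := hD.h_pos
  set m := √(K * S) with hm
  have hm2 : m ^ 2 = K * S := Real.sq_sqrt (by positivity)
  have hb : ∀ i', polyInt (-1) 1 (V i' ^ 2) ≤ S → ∀ r ∈ Icc (-1 : ℝ) 1,
      |(V i').eval r| ≤ m := fun i' hi' r hr => by
    refine Real.abs_le_sqrt (((hR.eval_sq_le _ (hV i') r hr).1).trans ?_)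
    gcongr
  have hbi := hb i (by linarith)
  have hbn := hb (finRotate N i) (by linarith)
  have hbp := hb ((finRotate N).symm i) (by linarith)
  have hbd : ∀ r ∈ Icc (-1 : ℝ) 1, |(derivative (V i)).eval r| ≤ m := fun r hr => by
    refine Real.abs_le_sqrt (((hR.eval_sq_le _ (hV i) r hr).2).trans ?_)
    gcongr; linarith
  have hm0 : 0 ≤ m := Real.sqrt_nonneg _
  have h1 : (1 : ℝ) ∈ Icc (-1 : ℝ) 1 := by norm_num
  have h_1 : (-1 : ℝ) ∈ Icc (-1 : ℝ) 1 := by norm_num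
  -- the constant coefficient rule is exact
  have hex : ∑ j, A i j * (a i * (V i).eval (s i j) * (derivative (V i)).eval (s i j))
      = a i * ((V i).eval 1 ^ 2 - (V i).eval (-1) ^ 2) / 2 := by
    obtain ⟨κ, hκ⟩ := hR.quad
    have hd : (derivative (V i)).natDegree ≤ k - 1 :=
      (natDegree_derivative_le _).trans (by have := hV i; omega)
    have hdeg : (V i * derivative (V i)).natDegree ≤ k + (k - 1) :=
      natDegree_mul_le_of_le (hV i) hd
    have h2 := hκ.exact (V i * derivative (V i)) (by omega)
    rw [coeff_eq_zero_of_natDegree_lt (by omega), mul_zero, sub_zero] at h2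
    have h3 : (2 : ℝ) • (V i * derivative (V i)) = derivative (V i ^ 2) := by
      rw [derivative_pow, smul_eq_C_mul]; simp; ring
    have h4 := congrArg (polyInt (-1) 1) h3
    rw [map_smul, polyInt_derivative, eval_pow, eval_pow, smul_eq_mul, ← h2] at h4
    rw [← h4]
    simp only [Finset.mul_sum, Finset.sum_div, eval_mul]
    refine Finset.sum_congr rfl fun j _ => ?_
    ring
  rw [← hex, ← Finset.sum_sub_distrib]
  refine (Finset.abs_sum_le_sum_abs _ _).trans ?_
  have hterm : ∀ j, |A i j * (αp i j * refFlux a s V i j * (derivative (V i)).eval (s i j))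
      - A i j * (a i * (V i).eval (s i j) * (derivative (V i)).eval (s i j))|
      ≤ 5 * L * K ^ 2 * h * S := fun j => by
    have hG : A i j ≠ 0 → |αp i j * refFlux a s V i j - a i * (V i).eval (s i j)|
        ≤ L * h * (5 * m) := fun hA => by
      have hLm : 0 ≤ L * h := by positivity
      have hnear := hD.near i j
      unfold refFlux
      split_ifs with h0 hl
      · subst h0
        rw [hR.partition.2.1, hD.first] at *
        unfold refUpwind
        split_ifs with hpos
        · have h5 := hD.left i hA hpos
          have hai : |a i| ≤ 2 * (L * h) := by
            rw [abs_sub_comm] at hnear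
            calc |a i| = |(a i - a ((finRotate N).symm i)) + a ((finRotate N).symm i)| := by
                  ring_nf
              _ ≤ _ := abs_add_le _ _
              _ ≤ _ := by linarith
          refine (abs_sub _ _).trans ?_
          rw [abs_mul, abs_mul]
          have h6 := hbp 1 h1
          have h7 := hbi (-1) h_1
          calc _ ≤ (L * h) * m + (2 * (L * h)) * m := by gcongr
            _ ≤ _ := by nlinarith
        · rw [Equiv.apply_symm_apply, ← sub_mul, abs_mul]
          have h7 := hbi (-1) h_1
          calc _ ≤ (L * h) * m := by gcongr
            _ ≤ _ := by nlinarith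
      · subst hl
        rw [hR.partition.2.2, hD.last] at *
        unfold refUpwind
        split_ifs with hpos
        · rw [sub_self, abs_zero]; positivity
        · have h5 := hD.right i hA (not_lt.1 hpos)
          rw [← mul_sub, abs_mul]
          have h6 := hbn (-1) h_1
          have h7 := hbi 1 h1
          calc _ ≤ (L * h) * (m + m) := by
                gcongr
                exact (abs_sub _ _).trans (add_le_add h6 h7)
            _ ≤ _ := by nlinarith
      · rw [← sub_mul, abs_mul]
        have h7 := hbi _ (hR.partition.mem_Icc j)
        calc _ ≤ (L * h) * m := by gcongr
          _ ≤ _ := by nlinarith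
    by_cases hA : A i j = 0
    · rw [hA]; simp only [zero_mul, sub_zero, abs_zero]; positivity
    · rw [← mul_sub, ← sub_mul, abs_mul, abs_mul]
      have h8 := hbd _ (hR.partition.mem_Icc j)
      calc _ ≤ K * ((L * h * (5 * m)) * m) := by
            gcongr
            · exact hR.abs_weight_le j
            · exact hG hA
        _ = 5 * L * K * h * m ^ 2 := by ring
        _ = _ := by rw [hm2]; ring
  refine (Finset.sum_le_sum fun j _ => hterm j).trans_eq ?_
  simp
  ring

end Stability

end

section

variable {k N : ℕ}

section Stability

variable {K L ρ h Kβ : ℝ} {a H β : Fin N → ℝ} {αp s A : Fin N → Fin (k + 2) → ℝ}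

/-- Testing the scheme with the weighted solution: the interface terms are the nonnegative upwind
dissipation plus a perturbation of size `O(h)` coming from the variation of coefficient and
weight. -/
theorem IsDiscretization.sum_svForm_le (hD : IsDiscretization K L ρ h a H αp s A) (hk : 1 ≤ k)
    (hβ : IsWeight Kβ h a β) {V V' : Fin N → ℝ[X]} (hV : ∀ i, (V i).natDegree ≤ k) :
    ∑ i, β i * (H i / 2 * svForm (s i) (A i) (V' i) (V i))
      ≤ ∑ i, β i * ∑ j, |testWeight (s i) (A i) j (V i)| * |schemeRes a H αp s V V' i j|
        + (5 * L * K ^ 2 * (k + 2) * (1 + 2 * Kβ) + L * K / 2 + Kβ * K)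
          * (h * ∑ i, β i * polyInt (-1) 1 (V i ^ 2)) := by
  set nx := finRotate N with hnx
  set I : Fin N → ℝ := fun i => polyInt (-1) 1 (V i ^ 2) with hI
  have hI0 : ∀ i, 0 ≤ I i := fun i => polyInt_sq_nonneg _
  set x : Fin N → ℝ := fun i => (V i).eval 1 with hx
  set y : Fin N → ℝ := fun i => (V i).eval (-1) with hy
  set up := refUpwind a V with hup
  have hh := hD.h_pos
  have hL := hD.L_nonneg
  have hKβ := hβ.nonneg
  have hx2 : ∀ i, x i ^ 2 ≤ K * I i := fun i =>
    ((hD.ref i).eval_sq_le _ (hV i) 1 (by norm_num)).1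
  have hy2 : ∀ i, y i ^ 2 ≤ K * I i := fun i =>
    ((hD.ref i).eval_sq_le _ (hV i) (-1) (by norm_num)).1
  set c₁ := 5 * L * K ^ 2 * (k + 2) with hc₁
  have hc₁0 : 0 ≤ c₁ := by positivity
  -- the element identity
  have helem : ∀ i, H i / 2 * svForm (s i) (A i) (V' i) (V i)
      ≤ ∑ j, |testWeight (s i) (A i) j (V i)| * |schemeRes a H αp s V V' i j|
        - (a i * up i * x i - a (nx.symm i) * up (nx.symm i) * y i
            - a i * (x i ^ 2 - y i ^ 2) / 2)
        + c₁ * h * (I i + I (nx i) + I (nx.symm i)) := fun i => by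
    obtain ⟨κ, hκ⟩ := (hD.ref i).quad
    have h1 : H i / 2 * svForm (s i) (A i) (V' i) (V i)
        = ∑ j, testWeight (s i) (A i) j (V i) * schemeRes a H αp s V V' i j
          - ∑ j, testWeight (s i) (A i) j (V i)
            * (αp i j.succ * refFlux a s V i j.succ
              - αp i j.castSucc * refFlux a s V i j.castSucc) := by
      rw [← Finset.sum_sub_distrib, svForm, Finset.mul_sum]
      refine Finset.sum_congr rfl fun j _ => ?_
      rw [schemeRes]; ring
    rw [h1, sum_testWeight_mul_sub hκ hk (hV i) fun j => αp i j * refFlux a s V i j]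
    have h2 := hD.abs_quad_sub_le hk hV i
    have h3 : refFlux a s V i (Fin.last (k + 1)) = up i := by
      rw [refFlux, if_neg (Fin.last_pos.ne'), if_pos rfl]
    have h4 : refFlux a s V i 0 = up (nx.symm i) := by rw [refFlux, if_pos rfl]
    rw [h3, h4, hD.first, hD.last]
    have h5 := (abs_le.1 h2).2
    have h6 : ∑ j, testWeight (s i) (A i) j (V i) * schemeRes a H αp s V V' i j
        ≤ ∑ j, |testWeight (s i) (A i) j (V i)| * |schemeRes a H αp s V V' i j| :=
      Finset.sum_le_sum fun j _ => (le_abs_self _).trans (abs_mul _ _).le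
    linarith
  -- the interface terms
  have hface : ∀ i, -(Kβ * h / 2 * (β i * x i ^ 2 + β (nx i) * y (nx i) ^ 2))
      ≤ a i * up i * (β i * x i - β (nx i) * y (nx i))
        - a i * (β i * x i ^ 2 - β (nx i) * y (nx i) ^ 2) / 2 := fun i => by
    have hbi := (hβ.pos i).le
    have hbn := (hβ.pos (nx i)).le
    have hp1 : 0 ≤ Kβ * h * β i * x i ^ 2 := by positivity
    have hp2 : 0 ≤ Kβ * h * β (nx i) * y (nx i) ^ 2 := by positivity
    by_cases hpos : 0 < a i
    · have h1 : up i = x i := if_pos hpos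
      have h2 := hβ.diff_left i
      rw [← abs_mul] at h2
      have h3 := mul_le_mul_of_nonneg_right (abs_le.1 h2).1 (sq_nonneg (x i))
      have h4 : 0 ≤ a i * β (nx i) * (x i - y (nx i)) ^ 2 := by positivity
      rw [h1]
      nlinarith
    · have h1 : up i = y (nx i) := if_neg hpos
      have h2 := hβ.diff_right i
      rw [← abs_mul] at h2
      have h3 := mul_le_mul_of_nonneg_right (abs_le.1 h2).1 (sq_nonneg (y (nx i)))
      have h4 : 0 ≤ (-a i) * β i * (x i - y (nx i)) ^ 2 := by
        have : 0 ≤ -a i := by linarith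
        positivity
      rw [h1]
      nlinarith
  -- summation over the elements
  have hJ : ∑ i, β i * I (nx i) ≤ Kβ * ∑ i, β i * I i := by
    rw [← Equiv.sum_comp nx fun i => β i * I i, Finset.mul_sum]
    refine Finset.sum_le_sum fun i _ => ?_
    rw [← mul_assoc]
    exact mul_le_mul_of_nonneg_right (hβ.le_next i) (hI0 _)
  have hJ' : ∑ i, β i * I (nx.symm i) ≤ Kβ * ∑ i, β i * I i := by
    rw [← Equiv.sum_comp nx fun i => β i * I (nx.symm i), Finset.mul_sum]
    refine Finset.sum_le_sum fun i _ => ?_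
    rw [← mul_assoc, Equiv.symm_apply_apply]
    exact mul_le_mul_of_nonneg_right (hβ.next_le i) (hI0 _)
  set Sβ := ∑ i, β i * I i with hSβ
  have hsq : ∑ i, β i * x i ^ 2 ≤ K * Sβ := by
    rw [hSβ, Finset.mul_sum]
    refine Finset.sum_le_sum fun i _ => ?_
    have := mul_le_mul_of_nonneg_left (hx2 i) (hβ.pos i).le
    linarith
  have hsqy : ∑ i, β i * y i ^ 2 ≤ K * Sβ := by
    rw [hSβ, Finset.mul_sum]
    refine Finset.sum_le_sum fun i _ => ?_
    have := mul_le_mul_of_nonneg_left (hy2 i) (hβ.pos i).le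
    linarith
  have hT : -((L * K / 2 + Kβ * K) * (h * Sβ))
      ≤ ∑ i, β i * (a i * up i * x i - a (nx.symm i) * up (nx.symm i) * y i
            - a i * (x i ^ 2 - y i ^ 2) / 2) := by
    have h1 : ∑ i, β i * (a (nx.symm i) * up (nx.symm i) * y i)
        = ∑ i, β (nx i) * (a i * up i * y (nx i)) := by
      rw [← Equiv.sum_comp nx]; simp
    have h2 : ∑ i, β i * (a (nx.symm i) * y i ^ 2) = ∑ i, β (nx i) * (a i * y (nx i) ^ 2) := by
      rw [← Equiv.sum_comp nx]; simp
    have h3 : ∑ i, β i * (a i * up i * x i - a (nx.symm i) * up (nx.symm i) * y i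
            - a i * (x i ^ 2 - y i ^ 2) / 2)
        = ∑ i, (a i * up i * (β i * x i - β (nx i) * y (nx i))
            - a i * (β i * x i ^ 2 - β (nx i) * y (nx i) ^ 2) / 2)
          + ∑ i, (a i - a (nx.symm i)) / 2 * (β i * y i ^ 2) := by
      have e1 : ∑ i, β i * (a i * up i * x i - a (nx.symm i) * up (nx.symm i) * y i
            - a i * (x i ^ 2 - y i ^ 2) / 2)
          = ∑ i, β i * (a i * up i * x i) - ∑ i, β i * (a (nx.symm i) * up (nx.symm i) * y i)
            - ∑ i, β i * (a i * (x i ^ 2 - y i ^ 2) / 2) := by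
        rw [← Finset.sum_sub_distrib, ← Finset.sum_sub_distrib]
        exact Finset.sum_congr rfl fun i _ => by ring
      have e2 : ∑ i, (a i - a (nx.symm i)) / 2 * (β i * y i ^ 2)
          = ∑ i, β i * (a i * y i ^ 2) / 2 - (∑ i, β i * (a (nx.symm i) * y i ^ 2)) / 2 := by
        rw [Finset.sum_div, ← Finset.sum_sub_distrib]
        exact Finset.sum_congr rfl fun i _ => by ring
      rw [e1, e2, h1, h2, Finset.sum_div, ← Finset.sum_sub_distrib, ← Finset.sum_sub_distrib,
        ← Finset.sum_sub_distrib, ← Finset.sum_add_distrib]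
      exact Finset.sum_congr rfl fun i _ => by ring
    have h4 : -(L * K / 2 * (h * Sβ)) ≤ ∑ i, (a i - a (nx.symm i)) / 2 * (β i * y i ^ 2) := by
      have e1 : -(L * h / 2 * ∑ i, β i * y i ^ 2)
          ≤ ∑ i, (a i - a (nx.symm i)) / 2 * (β i * y i ^ 2) := by
        rw [Finset.mul_sum, ← Finset.sum_neg_distrib]
        refine Finset.sum_le_sum fun i _ => ?_
        have h5 := hD.near i 0
        rw [hD.first] at h5
        have h6 := (abs_le.1 h5).2
        have h7 : 0 ≤ β i * y i ^ 2 := mul_nonneg (hβ.pos i).le (sq_nonneg _)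
        nlinarith
      have e2 : L * h / 2 * ∑ i, β i * y i ^ 2 ≤ L * h / 2 * (K * Sβ) := by gcongr
      linarith
    have h5 : -(Kβ * K * (h * Sβ)) ≤ ∑ i, (a i * up i * (β i * x i - β (nx i) * y (nx i))
            - a i * (β i * x i ^ 2 - β (nx i) * y (nx i) ^ 2) / 2) := by
      have e1 := Finset.sum_le_sum fun i (_ : i ∈ Finset.univ) => hface i
      refine le_trans ?_ e1
      rw [Finset.sum_neg_distrib, ← Finset.mul_sum, Finset.sum_add_distrib,
        Equiv.sum_comp nx fun i => β i * y i ^ 2]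
      have e2 : Kβ * h / 2 * (∑ i, β i * x i ^ 2 + ∑ i, β i * y i ^ 2)
          ≤ Kβ * h / 2 * (K * Sβ + K * Sβ) := by gcongr
      linarith
    rw [h3]
    linarith
  have hall := Finset.sum_le_sum fun i (_ : i ∈ Finset.univ) =>
    mul_le_mul_of_nonneg_left (helem i) (hβ.pos i).le
  refine hall.trans ?_
  have hsplit : ∑ i, β i * (∑ j, |testWeight (s i) (A i) j (V i)| * |schemeRes a H αp s V V' i j|
        - (a i * up i * x i - a (nx.symm i) * up (nx.symm i) * y i
            - a i * (x i ^ 2 - y i ^ 2) / 2)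
        + c₁ * h * (I i + I (nx i) + I (nx.symm i)))
      = ∑ i, β i * ∑ j, |testWeight (s i) (A i) j (V i)| * |schemeRes a H αp s V V' i j|
        - ∑ i, β i * (a i * up i * x i - a (nx.symm i) * up (nx.symm i) * y i
            - a i * (x i ^ 2 - y i ^ 2) / 2)
        + c₁ * h * (∑ i, β i * I i + ∑ i, β i * I (nx i) + ∑ i, β i * I (nx.symm i)) := by
    rw [← Finset.sum_add_distrib, ← Finset.sum_add_distrib, Finset.mul_sum,
      ← Finset.sum_sub_distrib, ← Finset.sum_add_distrib]
    exact Finset.sum_congr rfl fun i _ => by ring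
  rw [hsplit]
  have hfin : c₁ * h * (Sβ + ∑ i, β i * I (nx i) + ∑ i, β i * I (nx.symm i))
      ≤ c₁ * h * (Sβ + Kβ * Sβ + Kβ * Sβ) := by gcongr
  linarith

theorem gronwall_of_hasDerivWithinAt {E E' : ℝ → ℝ} {τ c d : ℝ} (hc : 0 ≤ c) (hd : 0 ≤ d)
    (hE : ∀ t ∈ Icc 0 τ, HasDerivWithinAt E (E' t) (Icc 0 τ) t)
    (hle : ∀ t ∈ Icc 0 τ, E' t ≤ c * E t + d) {t : ℝ} (ht : t ∈ Icc 0 τ) :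
    E t ≤ Real.exp (c * t) * (E 0 + d * t) := by
  have h0 : (0 : ℝ) ∈ Icc 0 τ := ⟨le_rfl, ht.1.trans ht.2⟩
  have hF : ∀ x ∈ Icc 0 τ, HasDerivWithinAt (fun x => Real.exp (-(c * x)) * E x - d * x)
      (Real.exp (-(c * x)) * (E' x - c * E x) - d) (Icc 0 τ) x := fun x hx => by
    have h1 : HasDerivWithinAt (fun x => Real.exp (-(c * x))) (Real.exp (-(c * x)) * (-(c * 1)))
        (Icc 0 τ) x := (((hasDerivAt_id x).const_mul c).neg.exp).hasDerivWithinAt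
    have h2 := (h1.fun_mul (hE x hx)).fun_sub (((hasDerivAt_id x).const_mul d).hasDerivWithinAt)
    refine h2.congr_deriv ?_
    ring
  have hanti : AntitoneOn (fun x => Real.exp (-(c * x)) * E x - d * x) (Icc 0 τ) := by
    refine antitoneOn_of_hasDerivWithinAt_nonpos (convex_Icc 0 τ)
      (fun x hx => (hF x hx).continuousWithinAt)
      (fun x hx => (hF x (interior_subset hx)).mono interior_subset) fun x hx => ?_
    have hx' : x ∈ Icc 0 τ := interior_subset hx
    have h3 := hle x hx'
    have h4 : Real.exp (-(c * x)) ≤ 1 := Real.exp_le_one_iff.2 (by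
      have := mul_nonneg hc hx'.1; linarith)
    have h5 := Real.exp_pos (-(c * x))
    nlinarith
  have h6 := hanti h0 ht ht.1
  simp only [mul_zero, neg_zero, Real.exp_zero, one_mul, sub_zero] at h6
  have h7 : E t = Real.exp (c * t) * (Real.exp (-(c * t)) * E t) := by
    rw [← mul_assoc, ← Real.exp_add]; simp
  rw [h7]
  gcongr
  linarith

/-- The constant of the stability estimate. -/
def stabConst (k : ℕ) (K L ρ Kβ : ℝ) : ℝ :=
  4 * ρ * (5 * L * K ^ 2 * (k + 2) * (1 + 2 * Kβ) + L * K / 2 + Kβ * K)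
    + 2 * (k + 1) * K * ρ + 2 * π * (k + 1) * ρ

theorem IsDiscretization.N_mul_le (hD : IsDiscretization K L ρ h a H αp s A) :
    (N : ℝ) * h ≤ 2 * π * ρ := by
  have h1 : ∑ i : Fin N, h ≤ ∑ i, ρ * H i := Finset.sum_le_sum fun i _ => hD.le_H i
  rw [← Finset.mul_sum, hD.sum_H] at h1
  simp at h1
  linarith

theorem IsDiscretization.H_pos (hD : IsDiscretization K L ρ h a H αp s A) (i : Fin N) :
    0 < H i := by
  have := hD.h_pos.trans_le (hD.le_H i)
  exact (pos_iff_pos_of_mul_pos this).1 hD.rho_pos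

theorem IsDiscretization.one_le (hD : IsDiscretization K L ρ h a H αp s A) : 1 ≤ K := by
  rcases N with _ | N
  · have := hD.sum_H
    simp at this
  · exact (hD.ref 0).one_le

theorem IsDiscretization.stabConst_nonneg (hD : IsDiscretization K L ρ h a H αp s A)
    (hKβ : 0 ≤ Kβ) : 0 ≤ stabConst k K L ρ Kβ := by
  have := hD.one_le
  have := hD.L_nonneg
  have := hD.rho_pos
  unfold stabConst
  positivity

/-- The energy inequality. The parameter `lam` balances the energy against the residual; it is
taken large on short time intervals. -/
theorem IsDiscretization.two_mul_sum_svForm_le (hD : IsDiscretization K L ρ h a H αp s A)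
    (hk : 1 ≤ k) (hβ : IsWeight Kβ h a β) {V V' : Fin N → ℝ[X]} (hV : ∀ i, (V i).natDegree ≤ k)
    {ε lam : ℝ} (hlam : 0 < lam)
    (hR : ∀ i j, β i * schemeRes a H αp s V V' i j ^ 2 ≤ (ε * h) ^ 2) :
    2 * ∑ i, β i * (H i / 2 * svForm (s i) (A i) (V' i) (V i))
      ≤ stabConst k K L ρ Kβ * (1 + lam) * energy H β s A V
        + stabConst k K L ρ Kβ * ε ^ 2 / lam := by
  have h1 := hD.sum_svForm_le hk hβ (V' := V') hV
  have hh := hD.h_pos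
  have hK := hD.one_le
  have hL := hD.L_nonneg
  have hρ := hD.rho_pos
  have hKβ := hβ.nonneg
  set c := 5 * L * K ^ 2 * (k + 2) * (1 + 2 * Kβ) + L * K / 2 + Kβ * K with hc
  have hc0 : 0 ≤ c := by positivity
  set Q := h * ∑ i, β i * polyInt (-1) 1 (V i ^ 2) with hQ
  have hE : Q ≤ 2 * ρ * energy H β s A V := by
    rw [hQ, energy, Finset.mul_sum, Finset.mul_sum]
    refine Finset.sum_le_sum fun i _ => ?_
    obtain ⟨κ, hκ⟩ := (hD.ref i).quad
    have h2 := polyInt_sq_le_svForm (hD.ref i).partition hκ hk (hV i)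
    have h3 := hD.le_H i
    have h4 := (hβ.pos i).le
    have h5 := polyInt_sq_nonneg (V i)
    have h6 : h * polyInt (-1) 1 (V i ^ 2) ≤ ρ * H i * svForm (s i) (A i) (V i) (V i) :=
      mul_le_mul h3 h2 h5 (hh.le.trans h3)
    have := mul_le_mul_of_nonneg_left h6 h4
    linarith
  have hterm : ∀ i j, β i * (|testWeight (s i) (A i) j (V i)| * |schemeRes a H αp s V V' i j|)
      ≤ lam * K / 2 * (h * (β i * polyInt (-1) 1 (V i ^ 2))) + h * ε ^ 2 / (2 * lam) :=
    fun i j => by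
    have h2 := (hD.ref i).testWeight_sq_le _ (hV i) j
    have h3 := hR i j
    have h4 := (hβ.pos i).le
    set w := |testWeight (s i) (A i) j (V i)|
    set r := |schemeRes a H αp s V V' i j|
    rw [← sq_abs] at h2 h3
    have h5 : w * r ≤ lam * h / 2 * w ^ 2 + r ^ 2 / (2 * lam * h) := by
      have : 0 ≤ (lam * h * w - r) ^ 2 / (2 * lam * h) := by positivity
      have e : (lam * h * w - r) ^ 2 / (2 * lam * h)
          = lam * h / 2 * w ^ 2 - w * r + r ^ 2 / (2 * lam * h) := by
        field_simp; ring
      linarith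
    calc β i * (w * r) ≤ β i * (lam * h / 2 * w ^ 2 + r ^ 2 / (2 * lam * h)) := by gcongr
      _ = lam * h / 2 * (β i * w ^ 2) + β i * r ^ 2 / (2 * lam * h) := by ring
      _ ≤ lam * h / 2 * (β i * (K * polyInt (-1) 1 (V i ^ 2))) + (ε * h) ^ 2 / (2 * lam * h) := by
          gcongr
      _ = _ := by field_simp
  have hsum : ∑ i, β i * ∑ j, |testWeight (s i) (A i) j (V i)| * |schemeRes a H αp s V V' i j|
      ≤ (k + 1) * (lam * K / 2) * Q + (k + 1) * (N * h) * ε ^ 2 / (2 * lam) := by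
    calc _ ≤ ∑ i, ∑ j : Fin (k + 1), (lam * K / 2 * (h * (β i * polyInt (-1) 1 (V i ^ 2)))
              + h * ε ^ 2 / (2 * lam)) := by
          refine Finset.sum_le_sum fun i _ => ?_
          rw [Finset.mul_sum]
          exact Finset.sum_le_sum fun j _ => hterm i j
      _ = _ := by
          simp only [Finset.sum_const, Finset.card_univ, Fintype.card_fin, nsmul_eq_mul,
            Finset.sum_add_distrib, mul_add, hQ, Finset.mul_sum]
          congr 1
          · refine Finset.sum_congr rfl fun i _ => ?_
            push_cast; ring
          · push_cast; ring
  have hNh := hD.N_mul_le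
  have hN : (k + 1) * (N * h) * ε ^ 2 / (2 * lam) ≤ (k + 1) * (2 * π * ρ) * ε ^ 2 / (2 * lam) := by
    gcongr
  have hEn : 0 ≤ energy H β s A V := by
    have : 0 ≤ Q := mul_nonneg hh.le
      (Finset.sum_nonneg fun i _ => mul_nonneg (hβ.pos i).le (polyInt_sq_nonneg _))
    by_contra hneg
    have : 2 * ρ * energy H β s A V < 0 := mul_neg_of_pos_of_neg (by positivity) (not_le.1 hneg)
    linarith
  have hQc : (c + (k + 1) * (lam * K / 2)) * Q
      ≤ (c + (k + 1) * (lam * K / 2)) * (2 * ρ * energy H β s A V) := by gcongr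
  set E := energy H β s A V
  have e1 : 2 * ((c + (k + 1) * (lam * K / 2)) * (2 * ρ * E))
      ≤ stabConst k K L ρ Kβ * (1 + lam) * E := by
    have : 2 * ((c + (k + 1) * (lam * K / 2)) * (2 * ρ))
        ≤ stabConst k K L ρ Kβ * (1 + lam) := by
      unfold stabConst
      rw [← hc]
      have p1 : 0 ≤ ρ * c * lam := by positivity
      have p2 : 0 ≤ (k + 1) * K * ρ := by positivity
      have p3 : 0 ≤ 2 * π * (k + 1) * ρ * (1 + lam) := by positivity
      nlinarith
    have := mul_le_mul_of_nonneg_right this hEn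
    linarith
  have e2 : 2 * ((k + 1) * (2 * π * ρ) * ε ^ 2 / (2 * lam))
      ≤ stabConst k K L ρ Kβ * ε ^ 2 / lam := by
    have : 2 * π * (k + 1) * ρ ≤ stabConst k K L ρ Kβ := by
      unfold stabConst
      rw [← hc]
      have p1 : 0 ≤ 4 * ρ * c := by positivity
      have p2 : 0 ≤ 2 * (k + 1) * K * ρ := by positivity
      linarith
    calc _ = 2 * π * (k + 1) * ρ * ε ^ 2 / lam := by field_simp
      _ ≤ _ := by gcongr
  linarith

/-- Stability of the scheme in the weighted energy. -/
theorem IsDiscretization.energy_le (hD : IsDiscretization K L ρ h a H αp s A)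
    (hk : 1 ≤ k) (hβ : IsWeight Kβ h a β) {τ ε lam : ℝ} (hlam : 0 < lam)
    {V V' : ℝ → Fin N → ℝ[X]} (hV : ∀ t ∈ Icc 0 τ, ∀ i, (V t i).natDegree ≤ k)
    (hV' : ∀ t ∈ Icc 0 τ, ∀ i, (V' t i).natDegree ≤ k)
    (hder : ∀ t ∈ Icc 0 τ, ∀ i, HasPolyDerivWithinAt (fun t => V t i) (V' t i) (Icc 0 τ) t)
    (hR : ∀ t ∈ Icc 0 τ, ∀ i j, β i * schemeRes a H αp s (V t) (V' t) i j ^ 2 ≤ (ε * h) ^ 2)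
    {t : ℝ} (ht : t ∈ Icc 0 τ) :
    energy H β s A (V t) ≤ Real.exp (stabConst k K L ρ Kβ * (1 + lam) * t)
      * (energy H β s A (V 0) + stabConst k K L ρ Kβ * ε ^ 2 / lam * t) := by
  have hc := hD.stabConst_nonneg hβ.nonneg
  refine gronwall_of_hasDerivWithinAt (E := fun t => energy H β s A (V t))
    (E' := fun t => 2 * ∑ i, β i * (H i / 2 * svForm (s i) (A i) (V' t i) (V t i)))
    (by positivity) (by positivity) (fun t ht => ?_)
    (fun t ht => hD.two_mul_sum_svForm_le hk hβ (hV t ht) hlam (hR t ht)) ht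
  have h1 := HasDerivWithinAt.fun_sum (u := Finset.univ) fun i (_ : i ∈ Finset.univ) =>
    ((((hder t ht i).svForm_self (s := s i) (A := A i)).const_mul (H i / 2)).const_mul (β i))
  refine h1.congr_deriv ?_
  rw [Finset.mul_sum]
  refine Finset.sum_congr rfl fun i _ => ?_
  obtain ⟨κ, hκ⟩ := (hD.ref i).quad
  rw [svForm_comm (hD.ref i).partition hκ hk (hV t ht i) (hV' t ht i)]
  ring

end Stability

end

section

/-! ### Functions with a Lipschitz continuous derivative of order `m` -/

/-- `f` has `m` derivatives on `[0, 2π]`, the last one Lipschitz continuous, and `K` bounds all of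
them and the Lipschitz constant. This is the unit of `W^{m+1,∞}` with the continuous representative,
in a form suited to induction on `m`. -/
def Reg : ℕ → ℝ → (ℝ → ℝ) → Prop
  | 0, K, f => (∀ x ∈ Icc 0 (2 * π), |f x| ≤ K) ∧
      ∀ x ∈ Icc 0 (2 * π), ∀ y ∈ Icc 0 (2 * π), |f x - f y| ≤ K * |x - y|
  | m + 1, K, f => (∀ x ∈ Icc 0 (2 * π), |f x| ≤ K) ∧
      ∃ f' : ℝ → ℝ, (∀ x ∈ Icc 0 (2 * π), HasDerivWithinAt f (f' x) (Icc 0 (2 * π)) x) ∧ Reg m K f'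

theorem zero_mem_period : (0 : ℝ) ∈ Icc 0 (2 * π) := ⟨le_rfl, by positivity⟩

theorem Reg.abs_le {m : ℕ} {K : ℝ} {f : ℝ → ℝ} (h : Reg m K f) {x : ℝ}
    (hx : x ∈ Icc 0 (2 * π)) : |f x| ≤ K := by
  cases m with
  | zero => exact h.1 x hx
  | succ m => exact h.1 x hx

theorem Reg.nonneg {m : ℕ} {K : ℝ} {f : ℝ → ℝ} (h : Reg m K f) : 0 ≤ K :=
  (abs_nonneg _).trans (h.abs_le zero_mem_period)

theorem Reg.mono {m : ℕ} {K K' : ℝ} {f : ℝ → ℝ} (h : Reg m K f) (hK : K ≤ K') : Reg m K' f := by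
  induction m generalizing f with
  | zero =>
    exact ⟨fun x hx => (h.1 x hx).trans hK, fun x hx y hy => (h.2 x hx y hy).trans (by gcongr)⟩
  | succ m ih =>
    obtain ⟨h0, f', hf', h1⟩ := h
    exact ⟨fun x hx => (h0 x hx).trans hK, f', hf', ih h1⟩

theorem Reg.congr {m : ℕ} {K : ℝ} {f g : ℝ → ℝ} (h : Reg m K f) (hfg : EqOn g f (Icc 0 (2 * π))) :
    Reg m K g := by
  cases m with
  | zero =>
    exact ⟨fun x hx => by rw [hfg hx]; exact h.1 x hx,
      fun x hx y hy => by rw [hfg hx, hfg hy]; exact h.2 x hx y hy⟩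
  | succ m =>
    obtain ⟨h0, f', hf', h1⟩ := h
    exact ⟨fun x hx => by rw [hfg hx]; exact h0 x hx, f',
      fun x hx => (hf' x hx).congr hfg (hfg hx), h1⟩

theorem abs_sub_le_of_hasDerivWithinAt {f f' : ℝ → ℝ} {K : ℝ} {S : Set ℝ} (hS : Convex ℝ S)
    (hf : ∀ x ∈ S, HasDerivWithinAt f (f' x) S x) (hb : ∀ x ∈ S, |f' x| ≤ K) {x y : ℝ}
    (hx : x ∈ S) (hy : y ∈ S) : |f x - f y| ≤ K * |x - y| :=
  hS.norm_image_sub_le_of_norm_hasDerivWithin_le hf hb hy hx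

theorem Reg.pred {m : ℕ} {K : ℝ} {f : ℝ → ℝ} (h : Reg (m + 1) K f) : Reg m K f := by
  induction m generalizing f with
  | zero =>
    obtain ⟨h0, f', hf', h1⟩ := h
    exact ⟨h0, fun x hx y hy =>
      abs_sub_le_of_hasDerivWithinAt (convex_Icc _ _) hf' (fun z hz => h1.1 z hz) hx hy⟩
  | succ m ih =>
    obtain ⟨h0, f', hf', h1⟩ := h
    exact ⟨h0, f', hf', ih h1⟩

theorem Reg.of_le {m n : ℕ} {K : ℝ} {f : ℝ → ℝ} (h : Reg m K f) (hn : n ≤ m) : Reg n K f := by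
  induction m, hn using Nat.le_induction with
  | base => exact h
  | succ m _ ih => exact ih h.pred

theorem Reg.lipschitz {m : ℕ} {K : ℝ} {f : ℝ → ℝ} (h : Reg m K f) {x y : ℝ}
    (hx : x ∈ Icc 0 (2 * π)) (hy : y ∈ Icc 0 (2 * π)) : |f x - f y| ≤ K * |x - y| :=
  (h.of_le (Nat.zero_le m)).2 x hx y hy

theorem Reg.continuousOn {m : ℕ} {K : ℝ} {f : ℝ → ℝ} (h : Reg m K f) :
    ContinuousOn f (Icc 0 (2 * π)) := by
  have : LipschitzOnWith (Real.toNNReal K) f (Icc 0 (2 * π)) :=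
    LipschitzOnWith.of_dist_le_mul fun x hx y hy => by
      rw [Real.coe_toNNReal _ h.nonneg]; exact h.lipschitz hx hy
  exact this.continuousOn

theorem Reg.add {m : ℕ} {K₁ K₂ : ℝ} {f g : ℝ → ℝ} (hf : Reg m K₁ f) (hg : Reg m K₂ g) :
    Reg m (K₁ + K₂) fun x => f x + g x := by
  induction m generalizing f g with
  | zero =>
    refine ⟨fun x hx => (abs_add_le _ _).trans (add_le_add (hf.1 x hx) (hg.1 x hx)),
      fun x hx y hy => ?_⟩
    rw [add_mul, add_sub_add_comm]
    exact (abs_add_le _ _).trans (add_le_add (hf.2 x hx y hy) (hg.2 x hx y hy))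
  | succ m ih =>
    obtain ⟨h0, f', hf', h1⟩ := hf
    obtain ⟨h0', g', hg', h1'⟩ := hg
    exact ⟨fun x hx => (abs_add_le _ _).trans (add_le_add (h0 x hx) (h0' x hx)),
      fun x => f' x + g' x, fun x hx => (hf' x hx).add (hg' x hx), ih h1 h1'⟩

theorem Reg.neg {m : ℕ} {K : ℝ} {f : ℝ → ℝ} (hf : Reg m K f) : Reg m K fun x => -f x := by
  induction m generalizing f with
  | zero =>
    refine ⟨fun x hx => by rw [abs_neg]; exact hf.1 x hx, fun x hx y hy => ?_⟩
    rw [neg_sub_neg, abs_sub_comm]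
    exact hf.2 x hx y hy
  | succ m ih =>
    obtain ⟨h0, f', hf', h1⟩ := hf
    exact ⟨fun x hx => by rw [abs_neg]; exact h0 x hx, fun x => -f' x,
      fun x hx => (hf' x hx).neg, ih h1⟩

theorem Reg.sub {m : ℕ} {K₁ K₂ : ℝ} {f g : ℝ → ℝ} (hf : Reg m K₁ f) (hg : Reg m K₂ g) :
    Reg m (K₁ + K₂) fun x => f x - g x :=
  (hf.add hg.neg).congr fun _ _ => sub_eq_add_neg _ _

theorem Reg.mul {m : ℕ} {K₁ K₂ : ℝ} {f g : ℝ → ℝ} (hf : Reg m K₁ f) (hg : Reg m K₂ g) :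
    Reg m (2 ^ (m + 1) * (K₁ * K₂)) fun x => f x * g x := by
  have hK₁ := hf.nonneg
  have hK₂ := hg.nonneg
  have hp : 0 ≤ K₁ * K₂ := by positivity
  have hb : ∀ x ∈ Icc 0 (2 * π), |f x * g x| ≤ K₁ * K₂ := fun x hx => by
    rw [abs_mul]
    have := hf.abs_le hx
    have := hg.abs_le hx
    gcongr
  induction m generalizing f g with
  | zero =>
    refine ⟨fun x hx => (hb x hx).trans (by norm_num; linarith), fun x hx y hy => ?_⟩
    have h1 : f x * g x - f y * g y = (f x - f y) * g x + f y * (g x - g y) := by ring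
    rw [h1]
    refine (abs_add_le _ _).trans ?_
    rw [abs_mul, abs_mul]
    have e1 := hf.2 x hx y hy
    have e2 := hg.2 x hx y hy
    have e3 := hg.1 x hx
    have e4 := hf.1 y hy
    calc _ ≤ (K₁ * |x - y|) * K₂ + K₁ * (K₂ * |x - y|) := by gcongr
      _ = _ := by ring
  | succ m ih =>
    have hf0 := hf.pred
    have hg0 := hg.pred
    obtain ⟨h0, f', hf', h1⟩ := hf
    obtain ⟨h0', g', hg', h1'⟩ := hg
    have h2 := ih h1 hg0 (fun x hx => by
      rw [abs_mul]
      have := h1.abs_le hx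
      have := hg0.abs_le hx
      gcongr)
    have h3 := ih hf0 h1' (fun x hx => by
      rw [abs_mul]
      have := hf0.abs_le hx
      have := h1'.abs_le hx
      gcongr)
    refine ⟨fun x hx => (hb x hx).trans ?_, fun x => f' x * g x + f x * g' x,
      fun x hx => (hf' x hx).mul (hg' x hx), (h2.add h3).mono (le_of_eq (by ring))⟩
    have : (1 : ℝ) ≤ 2 ^ (m + 1 + 1) := one_le_pow₀ (by norm_num)
    nlinarith

/-- Smooth functions of two variables are regular in the second one, uniformly in the first. -/
theorem exists_reg_of_contDiff (m : ℕ) {G : ℝ × ℝ → ℝ} (hG : ContDiff ℝ ∞ G) (T : ℝ) :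
    ∃ K, ∀ t ∈ Icc 0 T, Reg m K fun x => G (t, x) := by
  induction m generalizing G with
  | zero =>
    have hG1 : ContDiff ℝ ∞ fun p => fderiv ℝ G p (0, 1) :=
      (hG.fderiv_right (m := ∞) (by simp)).clm_apply contDiff_const
    have hc : IsCompact (Icc (0 : ℝ) T ×ˢ Icc (0 : ℝ) (2 * π)) := isCompact_Icc.prod isCompact_Icc
    obtain ⟨K₁, h₁⟩ := hc.exists_bound_of_continuousOn hG.continuous.continuousOn
    obtain ⟨K₂, h₂⟩ := hc.exists_bound_of_continuousOn hG1.continuous.continuousOn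
    refine ⟨max K₁ K₂, fun t ht => ⟨fun x hx => (h₁ (t, x) ⟨ht, hx⟩).trans (le_max_left _ _),
      fun x hx y hy => ?_⟩⟩
    refine abs_sub_le_of_hasDerivWithinAt (f := fun x => G (t, x))
      (f' := fun x => fderiv ℝ G (t, x) (0, 1)) (K := max K₁ K₂) (convex_Icc 0 (2 * π))
      (fun z _ => ?_) (fun z hz => (h₂ (t, z) ⟨ht, hz⟩).trans (le_max_right _ _)) hx hy
    have h3 : HasDerivAt (fun x : ℝ => ((t, x) : ℝ × ℝ)) (0, 1) z :=
      (hasDerivAt_const z t).prodMk (hasDerivAt_id z)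
    exact ((((hG.differentiable (by simp)) (t, z)).hasFDerivAt).comp_hasDerivAt z
      h3).hasDerivWithinAt
  | succ m ih =>
    have hG1 : ContDiff ℝ ∞ fun p => fderiv ℝ G p (0, 1) :=
      (hG.fderiv_right (m := ∞) (by simp)).clm_apply contDiff_const
    have hc : IsCompact (Icc (0 : ℝ) T ×ˢ Icc (0 : ℝ) (2 * π)) := isCompact_Icc.prod isCompact_Icc
    obtain ⟨K₁, h₁⟩ := hc.exists_bound_of_continuousOn hG.continuous.continuousOn
    obtain ⟨K₂, h₂⟩ := ih hG1
    refine ⟨max K₁ K₂, fun t ht => ⟨fun x hx => (h₁ (t, x) ⟨ht, hx⟩).trans (le_max_left _ _),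
      fun x => fderiv ℝ G (t, x) (0, 1), fun z _ => ?_, (h₂ t ht).mono (le_max_right _ _)⟩⟩
    have h3 : HasDerivAt (fun x : ℝ => ((t, x) : ℝ × ℝ)) (0, 1) z :=
      (hasDerivAt_const z t).prodMk (hasDerivAt_id z)
    exact ((((hG.differentiable (by simp)) (t, z)).hasFDerivAt).comp_hasDerivAt z
      h3).hasDerivWithinAt

/-- Integration of a Taylor polynomial of `f'` gives one of `f`. -/
theorem taylor_step {n m : ℕ} {K c : ℝ} (hK : 0 ≤ K) (hc : c ∈ Icc 0 (2 * π)) {f f' : ℝ → ℝ}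
    (hf : ∀ x ∈ Icc 0 (2 * π), HasDerivWithinAt f (f' x) (Icc 0 (2 * π)) x) {τ' : ℝ[X]}
    (hdeg : τ'.natDegree ≤ n) (hτ : ∀ x ∈ Icc 0 (2 * π), |f' x - τ'.eval x| ≤ K * |x - c| ^ m) :
    ∃ τ : ℝ[X], τ.natDegree ≤ n + 1 ∧ derivative τ = τ' ∧
      ∀ x ∈ Icc 0 (2 * π), |f x - τ.eval x| ≤ K * |x - c| ^ (m + 1) := by
  obtain ⟨W, hW, hWd, -⟩ := exists_antiderivative n τ' hdeg
  refine ⟨W + C (f c - W.eval c), (natDegree_add_C).le.trans hWd, by simp [hW], fun x hx => ?_⟩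
  have hsub : uIcc c x ⊆ Icc 0 (2 * π) := uIcc_subset_Icc hc hx
  have h1 := abs_sub_le_of_hasDerivWithinAt (f := fun x => f x - (W + C (f c - W.eval c)).eval x)
    (f' := fun x => f' x - τ'.eval x) (K := K * |x - c| ^ m) (convex_uIcc c x)
    (fun z hz => ((hf z (hsub hz)).mono hsub).sub (by
      have h2 := (W + C (f c - W.eval c)).hasDerivAt z
      rw [derivative_add, derivative_C, add_zero, hW] at h2
      exact h2.hasDerivWithinAt))
    (fun z hz => (hτ z (hsub hz)).trans (by
      exact mul_le_mul_of_nonneg_left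
        (pow_le_pow_left₀ (abs_nonneg _) (abs_sub_left_of_mem_uIcc hz) m) hK))
    right_mem_uIcc left_mem_uIcc
  simp only [eval_add, eval_C, add_sub_cancel, sub_self, sub_zero] at h1 ⊢
  rw [pow_succ, ← mul_assoc]
  exact h1

theorem Reg.exists_taylor {m : ℕ} {K c : ℝ} (hc : c ∈ Icc 0 (2 * π)) {f : ℝ → ℝ}
    (h : Reg m K f) : ∃ τ : ℝ[X], τ.natDegree ≤ m ∧
      ∀ x ∈ Icc 0 (2 * π), |f x - τ.eval x| ≤ K * |x - c| ^ (m + 1) := by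
  induction m generalizing f with
  | zero =>
    refine ⟨C (f c), by simp, fun x hx => ?_⟩
    simpa using h.2 x hx c hc
  | succ m ih =>
    have hK := h.nonneg
    obtain ⟨h0, f', hf', h1⟩ := h
    obtain ⟨τ', hd, hτ'⟩ := ih h1
    obtain ⟨τ, h2, -, h3⟩ := taylor_step hK hc hf' hd hτ'
    exact ⟨τ, h2, h3⟩

theorem Reg.exists_taylor_deriv {m : ℕ} {K c : ℝ} (hc : c ∈ Icc 0 (2 * π)) {f : ℝ → ℝ}
    (h : Reg (m + 1) K f) : ∃ τ : ℝ[X], τ.natDegree ≤ m + 1 ∧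
      (∀ x ∈ Icc 0 (2 * π), |f x - τ.eval x| ≤ K * |x - c| ^ (m + 2)) ∧
      ∃ f' : ℝ → ℝ, (∀ x ∈ Icc 0 (2 * π), HasDerivWithinAt f (f' x) (Icc 0 (2 * π)) x) ∧
        ∀ x ∈ Icc 0 (2 * π), |f' x - (derivative τ).eval x| ≤ K * |x - c| ^ (m + 1) := by
  have hK := h.nonneg
  obtain ⟨h0, f', hf', h1⟩ := h
  obtain ⟨τ', hd, hτ'⟩ := h1.exists_taylor hc
  obtain ⟨τ, h2, h4, h3⟩ := taylor_step hK hc hf' hd hτ'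
  exact ⟨τ, h2, h3, f', hf', by rwa [h4]⟩

end

section

/-! ### Weak derivatives -/

/-- Test functions on `(0, 2π)`. -/
structure IsTest (φ : ℝ → ℝ) : Prop where
  contDiff : ContDiff ℝ ∞ φ
  hasCompactSupport : HasCompactSupport φ
  tsupport_subset : tsupport φ ⊆ Ioo 0 (2 * π)

theorem IsTest.zero_of_notMem {φ : ℝ → ℝ} (h : IsTest φ) {x : ℝ} (hx : x ∉ Ioo 0 (2 * π)) :
    φ x = 0 := image_eq_zero_of_notMem_tsupport fun h' => hx (h.tsupport_subset h')

theorem IsTest.deriv {φ : ℝ → ℝ} (h : IsTest φ) : IsTest (deriv φ) where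
  contDiff := (contDiff_infty_iff_deriv.1 h.contDiff).2
  hasCompactSupport := h.hasCompactSupport.deriv
  tsupport_subset := (closure_mono (support_deriv_subset)).trans
    ((isClosed_tsupport φ).closure_eq.trans_subset h.tsupport_subset)

theorem IsTest.integrableOn_mul {φ D : ℝ → ℝ} (h : IsTest φ)
    (hD : IntegrableOn D (Ioo 0 (2 * π))) : IntegrableOn (fun x => D x * φ x) (Ioo 0 (2 * π)) := by
  obtain ⟨K, hK⟩ := h.hasCompactSupport.exists_bound_of_continuous h.contDiff.continuous
  exact hD.mul_bdd (c := K) h.contDiff.continuous.aestronglyMeasurable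
    (Filter.Eventually.of_forall hK)

theorem IsTest.exists_Icc {φ : ℝ → ℝ} (h : IsTest φ) :
    ∃ a b : ℝ, 0 < a ∧ b < 2 * π ∧ ∀ x, x ∉ Icc a b → φ x = 0 := by
  have hc : IsCompact (insert π (tsupport φ)) := h.hasCompactSupport.isCompact.insert π
  have hsub : insert π (tsupport φ) ⊆ Ioo 0 (2 * π) :=
    insert_subset ⟨pi_pos, by linarith [pi_pos]⟩ h.tsupport_subset
  obtain ⟨a, ha⟩ := hc.exists_isLeast (insert_nonempty _ _)
  obtain ⟨b, hb⟩ := hc.exists_isGreatest (insert_nonempty _ _)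
  refine ⟨a, b, (hsub ha.1).1, (hsub hb.1).2, fun x hx => ?_⟩
  refine image_eq_zero_of_notMem_tsupport fun h' => hx ?_
  exact ⟨ha.2 (mem_insert_of_mem _ h'), hb.2 (mem_insert_of_mem _ h')⟩

/-- A test function with mean zero is the derivative of a test function. -/
theorem IsTest.exists_deriv_eq {χ : ℝ → ℝ} (h : IsTest χ) (h0 : ∫ x in 0..2 * π, χ x = 0) :
    ∃ φ, IsTest φ ∧ _root_.deriv φ = χ := by
  obtain ⟨a, b, ha, hb, hab⟩ := h.exists_Icc
  have hcont := h.contDiff.continuous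
  have hder : ∀ x, HasDerivAt (fun x => ∫ y in 0..x, χ y) (χ x) x := fun x =>
    intervalIntegral.integral_hasDerivAt_right (hcont.intervalIntegrable _ _)
      (hcont.stronglyMeasurableAtFilter _ _) hcont.continuousAt
  have hd : _root_.deriv (fun x => ∫ y in 0..x, χ y) = χ := funext fun x => (hder x).deriv
  have hzero : ∀ x, x ∉ Icc a b → ∫ y in 0..x, χ y = 0 := fun x hx => by
    rcases lt_or_ge x a with hxa | hxa
    · rw [intervalIntegral.integral_congr (g := fun _ => 0)]
      · simp
      · intro y hy
        refine hab y fun hy' => ?_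
        have h1 := hy.2
        have h2 : max 0 x < a := max_lt ha hxa
        exact absurd (hy'.1.trans h1) (not_le.2 h2)
    · have hxb : b < x := lt_of_not_ge fun h' => hx ⟨hxa, h'⟩
      rw [← intervalIntegral.integral_add_adjacent_intervals
        (hcont.intervalIntegrable 0 (2 * π)) (hcont.intervalIntegrable _ x), h0, zero_add,
        intervalIntegral.integral_congr (g := fun _ => 0)]
      · simp
      · intro y hy
        refine hab y fun hy' => ?_
        have h1 := hy.1
        have h2 : b < min (2 * π) x := lt_min hb hxb
        exact absurd (h1.trans hy'.2) (not_le.2 h2)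
  have hts : tsupport (fun x => ∫ y in 0..x, χ y) ⊆ Icc a b :=
    closure_minimal (fun x hx => by_contra fun h' => hx (hzero x h')) isClosed_Icc
  refine ⟨_, ⟨?_, ?_, ?_⟩, hd⟩
  · rw [contDiff_infty_iff_deriv, hd]
    exact ⟨fun x => (hder x).differentiableAt, h.contDiff⟩
  · exact isCompact_Icc.of_isClosed_subset (isClosed_tsupport _) hts
  · exact hts.trans (Icc_subset_Ioo ha hb)

theorem integrableOn_const_Ioo (c : ℝ) : IntegrableOn (fun _ : ℝ => c) (Ioo 0 (2 * π)) :=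
  continuous_const.integrableOn_Icc.mono_set Ioo_subset_Icc_self

/-- The lemma of du Bois-Reymond. -/
theorem exists_ae_eq_const_of_integral_mul_deriv {D : ℝ → ℝ} (hD : IntegrableOn D (Ioo 0 (2 * π)))
    (h : ∀ φ, IsTest φ → ∫ x in Ioo 0 (2 * π), D x * deriv φ x = 0) :
    ∃ c, ∀ᵐ x, x ∈ Ioo 0 (2 * π) → D x = c := by
  have hpi := pi_gt_three
  let bump : ContDiffBump π := ⟨1, 2, one_pos, one_lt_two⟩
  set θ : ℝ → ℝ := bump.normed volume with hθ
  have hθt : IsTest θ := ⟨bump.contDiff_normed, bump.hasCompactSupport_normed, by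
    rw [hθ, bump.tsupport_normed_eq, Real.closedBall_eq_Icc]
    exact Icc_subset_Ioo (by change 0 < π - 2; linarith) (by change π + 2 < 2 * π; linarith)⟩
  have hfull : ∀ ψ, IsTest ψ → ∫ x in 0..2 * π, ψ x = ∫ x, ψ x := fun ψ hψ => by
    rw [intervalIntegral.integral_of_le (by positivity)]
    refine setIntegral_eq_integral_of_forall_compl_eq_zero fun x hx => hψ.zero_of_notMem ?_
    exact fun h' => hx ⟨h'.1, h'.2.le⟩
  have hθ1 : ∫ x in 0..2 * π, θ x = 1 := by rw [hfull θ hθt]; exact bump.integral_normed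
  set c := ∫ x in Ioo 0 (2 * π), D x * θ x with hc
  refine ⟨c, ?_⟩
  have hDc : IntegrableOn (fun x => D x - c) (Ioo 0 (2 * π)) := hD.sub (integrableOn_const_Ioo c)
  have key := isOpen_Ioo.ae_eq_zero_of_integral_contDiff_smul_eq_zero (U := Ioo 0 (2 * π))
    (f := fun x => D x - c) (μ := volume) hDc.locallyIntegrableOn fun ψ h1 h2 h3 => ?_
  · filter_upwards [key] with x hx hx'
    exact sub_eq_zero.1 (hx hx')
  · have hψ : IsTest ψ := ⟨h1, h2, h3⟩
    set I := ∫ x in 0..2 * π, ψ x with hI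
    have hχ : IsTest fun x => ψ x - I * θ x := by
      refine ⟨h1.sub (contDiff_const.mul hθt.contDiff),
        h2.sub hθt.hasCompactSupport.mul_left, ?_⟩
      refine (tsupport_sub _ _).trans (union_subset h3 ?_)
      exact (tsupport_mul_subset_right (f := fun _ => I) (g := θ)).trans hθt.tsupport_subset
    have hχ0 : ∫ x in 0..2 * π, (ψ x - I * θ x) = 0 := by
      rw [intervalIntegral.integral_sub (h1.continuous.intervalIntegrable _ _)
        ((hθt.contDiff.continuous.const_mul I).intervalIntegrable _ _),
        intervalIntegral.integral_const_mul, hθ1, mul_one, sub_self]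
    obtain ⟨φ, hφ, hφd⟩ := hχ.exists_deriv_eq hχ0
    have h4 := h φ hφ
    rw [hφd] at h4
    have h5 : ∫ x in Ioo 0 (2 * π), D x * (ψ x - I * θ x)
        = (∫ x in Ioo 0 (2 * π), D x * ψ x) - I * c := by
      rw [hc, ← integral_const_mul, ← integral_sub (hψ.integrableOn_mul hD)
        ((hθt.integrableOn_mul hD).const_mul I)]
      exact integral_congr_ae (Filter.Eventually.of_forall fun x => by ring)
    rw [h5] at h4
    have h6 : ∫ x, ψ x • (D x - c) = ∫ x in Ioo 0 (2 * π), ψ x • (D x - c) := by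
      refine (setIntegral_eq_integral_of_forall_compl_eq_zero fun x hx => ?_).symm
      rw [hψ.zero_of_notMem hx, zero_smul]
    have h7 : ∫ x in Ioo 0 (2 * π), ψ x • (D x - c)
        = (∫ x in Ioo 0 (2 * π), D x * ψ x) - ∫ x in Ioo 0 (2 * π), c * ψ x := by
      rw [← integral_sub (hψ.integrableOn_mul hD)]
      · exact integral_congr_ae (Filter.Eventually.of_forall fun x => by
          simp only [smul_eq_mul]; ring)
      · exact hψ.integrableOn_mul (integrableOn_const_Ioo c)
    have h8 : ∫ x in Ioo 0 (2 * π), ψ x = I := by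
      rw [hI, intervalIntegral.integral_of_le (by positivity), integral_Ioc_eq_integral_Ioo]
    rw [h6, h7, integral_const_mul, h8]
    linarith

/-- If `v'` is the weak derivative of `v`, then `v` is almost everywhere a primitive of `v'`. -/
theorem exists_ae_eq_primitive {v v' : ℝ → ℝ} (hv : IntegrableOn v (Ioo 0 (2 * π)))
    (hv' : IntegrableOn v' (Ioo 0 (2 * π)))
    (h : ∀ φ, IsTest φ → ∫ x in Ioo 0 (2 * π), v x * deriv φ x
      = -∫ x in Ioo 0 (2 * π), v' x * φ x) :
    ∃ c, ∀ᵐ x, x ∈ Ioo 0 (2 * π) → v x = c + ∫ y in 0..x, v' y := by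
  have hpi := pi_pos
  have hii : IntervalIntegrable v' volume 0 (2 * π) :=
    (intervalIntegrable_iff_integrableOn_Ioo_of_le (by positivity)).2 hv'
  have hac := hii.absolutelyContinuousOnInterval_intervalIntegral (c := 0) left_mem_uIcc
  set V : ℝ → ℝ := fun x => ∫ y in 0..x, v' y with hV
  have hVint : IntegrableOn V (Ioo 0 (2 * π)) := by
    have := hac.continuousOn
    rw [uIcc_of_le (by positivity)] at this
    exact (this.integrableOn_Icc).mono_set Ioo_subset_Icc_self
  obtain ⟨c, hc⟩ := exists_ae_eq_const_of_integral_mul_deriv (D := fun x => v x - V x)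
    (hv.sub hVint) fun φ hφ => by
      have hφac : AbsolutelyContinuousOnInterval φ 0 (2 * π) :=
        (contDiff_infty.1 hφ.contDiff 1).contDiffOn.absolutelyContinuousOnInterval
      have h1 := hac.integral_mul_deriv_eq_deriv_mul hφac
      rw [hφ.zero_of_notMem (x := 2 * π) (by simp), hφ.zero_of_notMem (x := 0) (by simp)] at h1
      have h2 : ∫ x in 0..2 * π, deriv V x * φ x = ∫ x in 0..2 * π, v' x * φ x := by
        refine intervalIntegral.integral_congr_ae ?_
        filter_upwards [hii.ae_hasDerivAt_integral] with x hx hx'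
        rw [(hx (uIoc_subset_uIcc hx') 0 left_mem_uIcc).deriv]
      rw [h2] at h1
      simp only [intervalIntegral.integral_of_le (by positivity : (0 : ℝ) ≤ 2 * π),
        integral_Ioc_eq_integral_Ioo] at h1
      have h3 := h φ hφ
      have h4 : ∫ x in Ioo 0 (2 * π), (v x - V x) * deriv φ x
          = (∫ x in Ioo 0 (2 * π), v x * deriv φ x) - ∫ x in Ioo 0 (2 * π), V x * deriv φ x := by
        rw [← integral_sub (hφ.deriv.integrableOn_mul hv) (hφ.deriv.integrableOn_mul hVint)]
        exact integral_congr_ae (Filter.Eventually.of_forall fun x => by ring)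
      rw [h4, h3, h1]
      ring
  refine ⟨c, ?_⟩
  filter_upwards [hc] with x hx hx'
  linarith [hx hx']

theorem abs_le_of_ae_abs_le {w : ℝ → ℝ} {K : ℝ} (hw : ContinuousOn w (Icc 0 (2 * π)))
    (h : ∀ᵐ x, x ∈ Ioo 0 (2 * π) → |w x| ≤ K) {x : ℝ} (hx : x ∈ Icc 0 (2 * π)) : |w x| ≤ K := by
  have h1 : (fun x => max |w x| K) =ᵐ[volume.restrict (Icc 0 (2 * π))] fun _ => K := by
    rw [restrict_Ioo_eq_restrict_Icc.symm]
    filter_upwards [(ae_restrict_iff' measurableSet_Ioo).2 h] with x hx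
    exact max_eq_right hx
  have h2 := Measure.eqOn_Icc_of_ae_eq volume (by positivity : (0 : ℝ) ≠ 2 * π) h1
    (hw.abs.sup continuousOn_const) continuousOn_const hx
  exact (le_max_left _ _).trans_eq h2

/-- A chain of essentially bounded weak derivatives is represented by a regular function. -/
theorem exists_reg_of_weak_chain (m : ℕ) {K : ℝ} (v : ℕ → ℝ → ℝ)
    (hv : ∀ n ≤ m + 1, IntegrableOn (v n) (Ioo 0 (2 * π)))
    (hb : ∀ n ≤ m + 1, ∀ᵐ x, x ∈ Ioo 0 (2 * π) → |v n x| ≤ K)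
    (h : ∀ n ≤ m, ∀ φ, IsTest φ → ∫ x in Ioo 0 (2 * π), v n x * deriv φ x
      = -∫ x in Ioo 0 (2 * π), v (n + 1) x * φ x) :
    ∃ w, Reg m K w ∧ ∀ᵐ x, x ∈ Ioo 0 (2 * π) → v 0 x = w x := by
  have hpi := pi_pos
  have hle : (0 : ℝ) ≤ 2 * π := by positivity
  induction m generalizing v with
  | zero =>
    obtain ⟨c, hc⟩ := exists_ae_eq_primitive (hv 0 (by simp)) (hv 1 (by simp)) (h 0 le_rfl)
    have hii : IntervalIntegrable (v 1) volume 0 (2 * π) :=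
      (intervalIntegrable_iff_integrableOn_Ioo_of_le hle).2 (hv 1 (by simp))
    have hsub : ∀ x ∈ Icc 0 (2 * π), ∀ y ∈ Icc 0 (2 * π),
        IntervalIntegrable (v 1) volume x y := fun x hx y hy =>
      hii.mono_set (by rw [uIcc_of_le hle]; exact uIcc_subset_Icc hx hy)
    have hbne : ∀ᵐ x : ℝ, x ≠ 2 * π := by simp [ae_iff, measure_singleton]
    have hlip : ∀ x ∈ Icc 0 (2 * π), ∀ y ∈ Icc 0 (2 * π),
        |(c + ∫ z in 0..x, v 1 z) - (c + ∫ z in 0..y, v 1 z)| ≤ K * |x - y| := fun x hx y hy => by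
      rw [add_sub_add_left_eq_sub, intervalIntegral.integral_interval_sub_left
        (hsub 0 zero_mem_period x hx) (hsub 0 zero_mem_period y hy)]
      refine intervalIntegral.norm_integral_le_of_norm_le_const_ae (f := v 1) (a := y) (b := x)
        (C := K) ?_
      filter_upwards [hb 1 (by simp), hbne] with z hz hz2 hz'
      have h1 : z ∈ Icc 0 (2 * π) := uIcc_subset_Icc hy hx (uIoc_subset_uIcc hz')
      refine hz ⟨lt_of_le_of_lt (le_min hy.1 hx.1) hz'.1, lt_of_le_of_ne h1.2 hz2⟩
    have hcont : ContinuousOn (fun x => c + ∫ z in 0..x, v 1 z) (Icc 0 (2 * π)) := by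
      have := (hii.absolutelyContinuousOnInterval_intervalIntegral
        (c := 0) left_mem_uIcc).continuousOn
      rw [uIcc_of_le hle] at this
      exact continuousOn_const.add this
    refine ⟨fun x => c + ∫ z in 0..x, v 1 z,
      ⟨fun x hx => abs_le_of_ae_abs_le hcont ?_ hx, hlip⟩, hc⟩
    filter_upwards [hb 0 (by simp), hc] with x h1 h2 hx
    rw [← h2 hx]
    exact h1 hx
  | succ m ih =>
    obtain ⟨w, hw, hw0⟩ := ih (fun n => v (n + 1)) (fun n hn => hv _ (by omega))
      (fun n hn => hb _ (by omega)) (fun n hn => h _ (by omega))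
    obtain ⟨c, hc⟩ := exists_ae_eq_primitive (hv 0 (by simp)) (hv 1 (by simp)) (h 0 (by simp))
    have hwc := hw.continuousOn
    have hwi : IntervalIntegrable w volume 0 (2 * π) :=
      ContinuousOn.intervalIntegrable (by rwa [uIcc_of_le hle])
    have hder : ∀ x ∈ Icc 0 (2 * π), HasDerivWithinAt (fun x => c + ∫ z in 0..x, w z) (w x)
        (Icc 0 (2 * π)) x := fun x hx => by
      have : Fact (x ∈ Icc 0 (2 * π)) := ⟨hx⟩
      refine (intervalIntegral.integral_hasDerivWithinAt_right (hwi.mono_set ?_)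
        (hwc.stronglyMeasurableAtFilter_nhdsWithin measurableSet_Icc x) (hwc x hx)).const_add c
      rw [uIcc_of_le hle]
      exact uIcc_subset_Icc zero_mem_period hx
    have heq : ∀ᵐ x, x ∈ Ioo 0 (2 * π) → v 0 x = c + ∫ z in 0..x, w z := by
      filter_upwards [hc] with x hx hx'
      rw [hx hx']
      congr 1
      have hbne : ∀ᵐ x : ℝ, x ≠ 2 * π := by simp [ae_iff, measure_singleton]
      refine intervalIntegral.integral_congr_ae ?_
      filter_upwards [hw0] with z hz hz'
      rw [uIoc_of_le hx'.1.le] at hz'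
      exact hz ⟨hz'.1, hz'.2.trans_lt hx'.2⟩
    refine ⟨fun x => c + ∫ z in 0..x, w z, ⟨fun x hx => abs_le_of_ae_abs_le
      (fun y hy => (hder y hy).continuousWithinAt) ?_ hx, w, hder, hw⟩, heq⟩
    filter_upwards [hb 0 (by simp), heq] with x h1 h2 hx
    rw [← h2 hx]
    exact h1 hx

/-- A continuous function in `W^{m+1,∞}(0, 2π)` is regular, with any constant above its norm. -/
theorem reg_of_sobolevNormInf_lt {m : ℕ} {K : ℝ} {f : ℝ → ℝ} (hf : ContinuousOn f (Icc 0 (2 * π)))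
    (hK : sobolevNormInf (m + 1) f < ENNReal.ofReal K) : Reg m K f := by
  have hK0 : 0 < K := ENNReal.ofReal_pos.1 (pos_of_gt hK)
  simp only [sobolevNormInf, iInf_lt_iff] at hK
  obtain ⟨v, hv, hlt⟩ := hK
  have hb : ∀ n ≤ m + 1, ∀ᵐ x, x ∈ Ioo 0 (2 * π) → |v n x| ≤ K := fun n hn => by
    have h1 : eLpNorm (v n) ∞ (volume.restrict (Ioo 0 (2 * π))) < ENNReal.ofReal K :=
      (Finset.le_sup (f := fun n => eLpNorm (v n) ∞ (volume.restrict (Ioo 0 (2 * π))))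
        (Finset.mem_range.2 (by omega))).trans_lt hlt
    rw [eLpNorm_exponent_top] at h1
    have h2 := ae_le_eLpNormEssSup (f := v n) (μ := volume.restrict (Ioo 0 (2 * π)))
    rw [← ae_restrict_iff' measurableSet_Ioo]
    filter_upwards [h2] with x hx
    have h3 := hx.trans h1.le
    rw [← ofReal_norm, ENNReal.ofReal_le_ofReal_iff hK0.le] at h3
    exact h3
  have hint : ∀ n ≤ m + 1, IntegrableOn (v n) (Ioo 0 (2 * π)) := fun n hn => by
    refine IntegrableOn.of_bound measure_Ioo_lt_top (hv n hn).2.1.aestronglyMeasurable K ?_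
    exact (ae_restrict_iff' measurableSet_Ioo).2 (hb n hn)
  obtain ⟨w, hw, hw0⟩ := exists_reg_of_weak_chain m v hint hb fun n hn φ hφ => by
    have h1 := (hv (n + 1) (by omega)).2.2 φ hφ.contDiff hφ.hasCompactSupport hφ.tsupport_subset
    have h2 := (hv n (by omega)).2.2 (deriv φ) hφ.deriv.contDiff hφ.deriv.hasCompactSupport
      hφ.deriv.tsupport_subset
    rw [← iteratedDeriv_succ'] at h2
    rw [h2, pow_succ] at h1
    have h3 : ((-1 : ℝ) ^ n) * (-1) ^ n = 1 := by rw [← mul_pow]; simp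
    have h4 := congrArg (fun z => (-1 : ℝ) ^ n * z) h1
    simp only [← mul_assoc, h3, one_mul] at h4
    linarith
  have hfw : ∀ᵐ x, x ∈ Ioo 0 (2 * π) → f x - v 0 x = 0 := by
    have h0 := hv 0 (by omega)
    refine isOpen_Ioo.ae_eq_zero_of_integral_contDiff_smul_eq_zero
      (h0.1.sub h0.2.1) fun φ h1 h2 h3 => ?_
    have hφ : IsTest φ := ⟨h1, h2, h3⟩
    have h4 := h0.2.2 φ h1 h2 h3
    have hfi : IntegrableOn f (Ioo 0 (2 * π)) :=
      hf.integrableOn_Icc.mono_set Ioo_subset_Icc_self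
    rw [iteratedDeriv_zero, pow_zero, one_mul] at h4
    rw [← setIntegral_eq_integral_of_forall_compl_eq_zero (s := Ioo 0 (2 * π))
      (fun x hx => by rw [hφ.zero_of_notMem hx, zero_smul])]
    have h5 : ∫ x in Ioo 0 (2 * π), φ x • (f x - v 0 x)
        = (∫ x in Ioo 0 (2 * π), f x * φ x) - ∫ x in Ioo 0 (2 * π), v 0 x * φ x := by
      rw [← integral_sub (hφ.integrableOn_mul hfi) (hφ.integrableOn_mul (hint 0 (by omega)))]
      exact integral_congr_ae (Filter.Eventually.of_forall fun x => by
        simp only [smul_eq_mul]; ring)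
    rw [h5, h4, sub_self]
  refine hw.congr (Measure.eqOn_Icc_of_ae_eq volume (by positivity : (0 : ℝ) ≠ 2 * π) ?_ hf
    hw.continuousOn)
  rw [restrict_Ioo_eq_restrict_Icc.symm]
  refine (ae_restrict_iff' measurableSet_Ioo).2 ?_
  filter_upwards [hfw, hw0] with x h1 h2 hx
  linarith [h1 hx, h2 hx]

end

section

/-! ### Regularity in time of the exact solution -/

/-- Interchange of the derivatives in space and time: if the time derivative `G` of `F` is
differentiable in space at `x₀`, uniformly to second order, then so is the space derivative of `F`
in time. No continuity in time of `G₁` is needed. -/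
theorem hasDerivWithinAt_swap {F G F₁ G₁ : ℝ → ℝ → ℝ} {T K x₀ : ℝ} (hx₀ : x₀ ∈ Icc 0 (2 * π))
    (hF₁ : ∀ t ∈ Icc 0 T, HasDerivWithinAt (F t) (F₁ t x₀) (Icc 0 (2 * π)) x₀)
    (hFt : ∀ t ∈ Icc 0 T, ∀ x ∈ Icc 0 (2 * π),
      HasDerivWithinAt (fun τ => F τ x) (G t x) (Icc 0 T) t)
    (hG : ∀ t ∈ Icc 0 T, ∀ x ∈ Icc 0 (2 * π),
      |G t x - G t x₀ - G₁ t x₀ * (x - x₀)| ≤ K * |x - x₀| ^ 2)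
    {t : ℝ} (ht : t ∈ Icc 0 T) :
    HasDerivWithinAt (fun τ => F₁ τ x₀) (G₁ t x₀) (Icc 0 T) t := by
  have hpi := pi_pos
  set D : ℝ → ℝ → ℝ := fun y τ => (F τ y - F τ x₀) / (y - x₀) with hD
  set D' : ℝ → ℝ → ℝ := fun y τ => (G τ y - G τ x₀) / (y - x₀) with hD'
  have hDd : ∀ y ∈ Icc 0 (2 * π), ∀ τ ∈ Icc 0 T,
      HasDerivWithinAt (D y) (D' y τ) (Icc 0 T) τ := fun y hy τ hτ =>
    ((hFt τ hτ y hy).fun_sub (hFt τ hτ x₀ hx₀)).div_const _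
  have hDb : ∀ y ∈ Icc 0 (2 * π), y ≠ x₀ → ∀ τ ∈ Icc 0 T,
      |D' y τ - G₁ τ x₀| ≤ K * |y - x₀| := fun y hy hne τ hτ => by
    have h0 : y - x₀ ≠ 0 := sub_ne_zero.2 hne
    have h1 : D' y τ - G₁ τ x₀ = (G τ y - G τ x₀ - G₁ τ x₀ * (y - x₀)) / (y - x₀) := by
      simp only [hD']; field_simp
    rw [h1, abs_div, div_le_iff₀ (abs_pos.2 h0), mul_assoc, ← sq]
    exact hG τ hτ y hy
  have hlim : ∀ τ ∈ Icc 0 T,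
      Filter.Tendsto (fun y => D y τ) (nhdsWithin x₀ (Icc 0 (2 * π) \ {x₀})) (nhds (F₁ τ x₀)) :=
    fun τ hτ => by
    have := hasDerivWithinAt_iff_tendsto_slope.1 (hF₁ τ hτ)
    refine this.congr fun y => ?_
    rw [slope_def_field]
  have hne : (nhdsWithin x₀ (Icc 0 (2 * π) \ {x₀})).NeBot := by
    have h1 := (uniqueDiffOn_Icc (show (0 : ℝ) < 2 * π by positivity)) x₀ hx₀
    exact accPt_principal_iff_nhdsWithin.1 (uniqueDiffWithinAt_iff_accPt.1 h1)
  have hcmp : ∀ y ∈ Icc 0 (2 * π), y ≠ x₀ → ∀ τ ∈ Icc 0 T,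
      |(D y τ - F₁ τ x₀) - (D y t - F₁ t x₀)| ≤ K * |y - x₀| * |τ - t| := fun y hy hyne τ hτ => by
    have h1 : Filter.Tendsto (fun z => |(D y τ - D z τ) - (D y t - D z t)|)
        (nhdsWithin x₀ (Icc 0 (2 * π) \ {x₀}))
        (nhds |(D y τ - F₁ τ x₀) - (D y t - F₁ t x₀)|) :=
      (((hlim τ hτ).const_sub _).sub ((hlim t ht).const_sub _)).abs
    have h2 : Filter.Tendsto (fun z => (K * |y - x₀| + K * |z - x₀|) * |τ - t|)
        (nhdsWithin x₀ (Icc 0 (2 * π) \ {x₀})) (nhds ((K * |y - x₀| + K * |x₀ - x₀|) * |τ - t|)) :=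
      (Continuous.tendsto (by fun_prop) x₀).mono_left nhdsWithin_le_nhds
    rw [sub_self, abs_zero, mul_zero, add_zero] at h2
    refine le_of_tendsto_of_tendsto h1 h2 ?_
    filter_upwards [self_mem_nhdsWithin] with z hz
    refine abs_sub_le_of_hasDerivWithinAt (f := fun τ => D y τ - D z τ)
      (f' := fun τ => D' y τ - D' z τ) (convex_Icc 0 T)
      (fun σ hσ => (hDd y hy σ hσ).fun_sub (hDd z hz.1 σ hσ)) (fun σ hσ => ?_) hτ ht
    have e1 := hDb y hy hyne σ hσ
    have e2 := hDb z hz.1 hz.2 σ hσ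
    calc |D' y σ - D' z σ| = |(D' y σ - G₁ σ x₀) - (D' z σ - G₁ σ x₀)| := by ring_nf
      _ ≤ _ := (abs_sub _ _).trans (add_le_add e1 e2)
  rw [hasDerivWithinAt_iff_isLittleO, Asymptotics.isLittleO_iff]
  intro ε hε
  have hex : ∃ y ∈ Icc 0 (2 * π), y ≠ x₀ ∧ K * |y - x₀| ≤ ε / 3 := by
    have h2 : Filter.Tendsto (fun z => K * |z - x₀|)
        (nhdsWithin x₀ (Icc 0 (2 * π) \ {x₀})) (nhds (K * |x₀ - x₀|)) :=
      (Continuous.tendsto (by fun_prop) x₀).mono_left nhdsWithin_le_nhds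
    rw [sub_self, abs_zero, mul_zero] at h2
    obtain ⟨y, hy1, hy2⟩ := ((h2.eventually (ge_mem_nhds (by positivity : 0 < ε / 3))).and
      self_mem_nhdsWithin).exists
    exact ⟨y, hy2.1, hy2.2, hy1⟩
  obtain ⟨y, hy, hyne, hyε⟩ := hex
  have h3 := (hasDerivWithinAt_iff_isLittleO.1 (hDd y hy t ht))
  rw [Asymptotics.isLittleO_iff] at h3
  filter_upwards [h3 (by positivity : 0 < ε / 3), self_mem_nhdsWithin] with τ h4 hτ
  have h5 := hcmp y hy hyne τ hτ
  have h6 := hDb y hy hyne t ht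
  simp only [Real.norm_eq_abs, smul_eq_mul] at h4 ⊢
  have h7 : F₁ τ x₀ - F₁ t x₀ - (τ - t) * G₁ t x₀
      = (D y τ - D y t - (τ - t) * D' y t) - ((D y τ - F₁ τ x₀) - (D y t - F₁ t x₀))
        + (τ - t) * (D' y t - G₁ t x₀) := by ring
  rw [h7]
  have h8 : |(τ - t) * (D' y t - G₁ t x₀)| ≤ |τ - t| * (ε / 3) := by
    rw [abs_mul]; gcongr; exact h6.trans hyε
  have h9 : K * |y - x₀| * |τ - t| ≤ ε / 3 * |τ - t| := by gcongr
  refine (abs_add_le _ _).trans ?_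
  have h10 := abs_sub (D y τ - D y t - (τ - t) * D' y t)
    ((D y τ - F₁ τ x₀) - (D y t - F₁ t x₀))
  linarith

/-- The exact solution `u` with its first two time derivatives `p` and `q`, and the orders of
spatial regularity that the equation gives them. -/
structure IsSmoothSol (k : ℕ) (α : ℝ → ℝ) (g : ℝ → ℝ → ℝ) (T K : ℝ) (u p q : ℝ → ℝ → ℝ) :
    Prop where
  reg_u : ∀ t ∈ Icc 0 T, Reg (k + 2) K (u t)
  reg_p : ∀ t ∈ Icc 0 T, Reg (k + 1) K (p t)
  reg_q : ∀ t ∈ Icc 0 T, Reg k K (q t)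
  deriv_u : ∀ t ∈ Icc 0 T, ∀ x ∈ Icc 0 (2 * π),
    HasDerivWithinAt (fun τ => u τ x) (p t x) (Icc 0 T) t
  deriv_p : ∀ t ∈ Icc 0 T, ∀ x ∈ Icc 0 (2 * π),
    HasDerivWithinAt (fun τ => p τ x) (q t x) (Icc 0 T) t
  balance : ∀ t ∈ Icc 0 T, ∀ a ∈ Icc 0 (2 * π), ∀ b ∈ Icc 0 (2 * π), a ≤ b →
    (∫ x in a..b, p t x) + α b * u t b - α a * u t a = ∫ x in a..b, g t x
  periodic : ∀ t ∈ Icc 0 T, u t 0 = u t (2 * π)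

section Exact

variable {k : ℕ} {α : ℝ → ℝ} {g : ℝ → ℝ → ℝ} {T : ℝ}

/-- A right-hand side that does not vanish identically forces the solution to be bounded below. -/
theorem exists_pos_le_of_ne_zero {Kα : ℝ} (hα : Reg (k + 2) Kα α)
    (hg : Continuous fun p : ℝ × ℝ => g p.1 p.2) (hT : 0 < T) {t₀ x₀ : ℝ} (ht₀ : t₀ ∈ Icc 0 T)
    (hx₀ : x₀ ∈ Icc 0 (2 * π)) (hne : g t₀ x₀ ≠ 0) :
    ∃ c : ℝ, 0 < c ∧ ∀ (u₀ : ℝ → ℝ) (u : ℝ → ℝ → ℝ) (K : ℝ), IsExactSolution α g u₀ T u →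
      (∀ t ∈ Icc 0 T, Reg (k + 2) K (u t)) → c ≤ K := by
  set δ := |g t₀ x₀| with hδ
  have hδ0 : 0 < δ := abs_pos.2 hne
  have hgc : Continuous fun t => g t x₀ := hg.comp (Continuous.prodMk_left x₀)
  obtain ⟨r, hr, hr'⟩ := Metric.continuousAt_iff.1 hgc.continuousAt (δ / 2) (by positivity)
  obtain ⟨t₁, t₂, h12, h1, h2⟩ : ∃ t₁ t₂ : ℝ, t₁ < t₂ ∧ Icc t₁ t₂ ⊆ Icc 0 T ∧
      ∀ t ∈ Icc t₁ t₂, |t - t₀| < r := by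
    rcases ht₀.2.lt_or_eq with hlt | heq
    · refine ⟨t₀, min T (t₀ + r / 2), lt_min hlt (by linarith),
        Icc_subset_Icc ht₀.1 (min_le_left _ _), fun t ht => ?_⟩
      rw [abs_of_nonneg (by linarith [ht.1])]
      linarith [ht.2.trans (min_le_right _ _)]
    · refine ⟨max 0 (t₀ - r / 2), t₀, max_lt (by linarith) (by linarith),
        Icc_subset_Icc (le_max_left _ _) ht₀.2, fun t ht => ?_⟩
      rw [abs_of_nonpos (by linarith [ht.2])]
      linarith [(le_max_right _ _).trans ht.1]
  have hKα := hα.nonneg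
  set B := 2 ^ (k + 3) * Kα with hB
  have hB0 : 0 ≤ B := by positivity
  refine ⟨δ / 2 * (t₂ - t₁) / (2 + B * (t₂ - t₁)), ?_, fun u₀ u K hu hreg => ?_⟩
  · have : 0 < t₂ - t₁ := sub_pos.2 h12
    positivity
  have hd : 0 < t₂ - t₁ := sub_pos.2 h12
  rw [div_le_iff₀ (by positivity)]
  have hp : ∀ t ∈ Icc 0 T, ∃ p, HasDerivWithinAt (fun τ => u τ x₀) p (Icc 0 T) t ∧
      |p - g t x₀| ≤ B * K := fun t ht => by
    obtain ⟨p, q, hp, hq, hpq⟩ := hu.equation t ht x₀ hx₀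
    refine ⟨p, hp, ?_⟩
    obtain ⟨-, f', hf', hfr⟩ := hα.mul (hreg t ht)
    have h3 := (uniqueDiffOn_Icc (show (0 : ℝ) < 2 * π by positivity) x₀ hx₀).eq_deriv _ hq
      (hf' x₀ hx₀)
    have h4 := hfr.abs_le hx₀
    rw [← hpq, h3, sub_add_cancel_left, abs_neg]
    refine h4.trans_eq (by rw [hB]; ring)
  choose! p hp hpb using hp
  have hmv := abs_sub_le_of_hasDerivWithinAt (f := fun τ => u τ x₀ - g t₀ x₀ * τ)
    (f' := fun τ => p τ - g t₀ x₀) (K := δ / 2 + B * K) (convex_Icc t₁ t₂)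
    (fun t ht => ((hp t (h1 ht)).mono h1).fun_sub (by
      simpa using ((hasDerivAt_id t).const_mul (g t₀ x₀)).hasDerivWithinAt))
    (fun t ht => by
      have e1 := hpb t (h1 ht)
      have e2 := hr' (x := t) (h2 t ht)
      rw [Real.dist_eq] at e2
      calc |p t - g t₀ x₀| = |(g t x₀ - g t₀ x₀) + (p t - g t x₀)| := by ring_nf
        _ ≤ _ := (abs_add_le _ _).trans (add_le_add e2.le e1))
    (right_mem_Icc.2 h12.le) (left_mem_Icc.2 h12.le)
  have hu2 := (hreg t₂ (h1 (right_mem_Icc.2 h12.le))).abs_le hx₀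
  have hu1 := (hreg t₁ (h1 (left_mem_Icc.2 h12.le))).abs_le hx₀
  rw [abs_of_pos hd] at hmv
  have h5 : δ * (t₂ - t₁) = |(u t₂ x₀ - u t₁ x₀) - ((u t₂ x₀ - g t₀ x₀ * t₂)
      - (u t₁ x₀ - g t₀ x₀ * t₁))| := by
    rw [hδ, ← abs_of_pos hd, ← abs_mul]; congr 1; ring
  have h6 := abs_sub (u t₂ x₀ - u t₁ x₀) ((u t₂ x₀ - g t₀ x₀ * t₂) - (u t₁ x₀ - g t₀ x₀ * t₁))
  have h7 := abs_sub (u t₂ x₀) (u t₁ x₀)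
  have h8 : δ * (t₂ - t₁) ≤ (K + K) + (δ / 2 + B * K) * (t₂ - t₁) := by
    rw [h5]; linarith
  linarith

/-- The norms of the right-hand side are bounded by those of the solution, unless the right-hand
side vanishes and there is nothing to bound. -/
theorem exists_reg_rhs {Kα : ℝ} (hα : Reg (k + 2) Kα α)
    (hg : ContDiff ℝ ∞ fun p : ℝ × ℝ => g p.1 p.2) (hT : 0 < T) :
    ∃ (gt : ℝ → ℝ → ℝ) (B : ℝ), 0 ≤ B ∧ (∀ t ∈ Icc 0 T, ∀ x ∈ Icc 0 (2 * π),
        HasDerivWithinAt (fun τ => g τ x) (gt t x) (Icc 0 T) t) ∧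
      ∀ (u₀ : ℝ → ℝ) (u : ℝ → ℝ → ℝ) (K : ℝ), IsExactSolution α g u₀ T u →
        (∀ t ∈ Icc 0 T, Reg (k + 2) K (u t)) →
        ∀ t ∈ Icc 0 T, Reg (k + 1) (B * K) (g t) ∧ Reg k (B * K) (gt t) := by
  by_cases hzero : ∀ t ∈ Icc 0 T, ∀ x ∈ Icc 0 (2 * π), g t x = 0
  · have hreg0 : ∀ m, Reg m 0 fun _ => 0 := fun m => by
      induction m with
      | zero => exact ⟨by simp, by simp⟩
      | succ m ih => exact ⟨by simp, fun _ => 0, fun x _ => hasDerivWithinAt_const _ _ _, ih⟩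
    refine ⟨fun _ _ => 0, 0, le_rfl, fun t ht x hx => ?_, fun u₀ u K _ _ t ht => ?_⟩
    · exact (hasDerivWithinAt_const t (Icc 0 T) (0 : ℝ)).congr (fun τ hτ => hzero τ hτ x hx)
        (hzero t ht x hx)
    · rw [zero_mul]
      exact ⟨(hreg0 _).congr fun x hx => hzero t ht x hx, hreg0 _⟩
  · push Not at hzero
    obtain ⟨t₀, ht₀, x₀, hx₀, hne⟩ := hzero
    obtain ⟨c, hc, hcK⟩ := exists_pos_le_of_ne_zero hα hg.continuous hT ht₀ hx₀ hne
    obtain ⟨K₁, h₁⟩ := exists_reg_of_contDiff (k + 1) hg T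
    have hgt : ContDiff ℝ ∞ fun p : ℝ × ℝ => fderiv ℝ (fun p : ℝ × ℝ => g p.1 p.2) p (1, 0) :=
      (hg.fderiv_right (m := ∞) (by simp)).clm_apply contDiff_const
    obtain ⟨K₂, h₂⟩ := exists_reg_of_contDiff k hgt T
    have hK₁ := (h₁ t₀ ht₀).nonneg
    have hK₂ := (h₂ t₀ ht₀).nonneg
    refine ⟨fun t x => fderiv ℝ (fun p : ℝ × ℝ => g p.1 p.2) (t, x) (1, 0), (K₁ + K₂) / c,
      by positivity, fun t _ x _ => ?_, fun u₀ u K hu hreg t ht => ?_⟩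
    · have h3 : HasDerivAt (fun τ : ℝ => ((τ, x) : ℝ × ℝ)) (1, 0) t :=
        (hasDerivAt_id t).prodMk (hasDerivAt_const t x)
      exact ((((hg.differentiable (by simp)) (t, x)).hasFDerivAt).comp_hasDerivAt t
        h3).hasDerivWithinAt
    · have h4 : K₁ + K₂ ≤ (K₁ + K₂) / c * K := by
        rw [div_mul_eq_mul_div, le_div_iff₀ hc]
        exact mul_le_mul_of_nonneg_left (hcK u₀ u K hu hreg) (by positivity)
      exact ⟨(h₁ t ht).mono (by linarith), (h₂ t ht).mono (by linarith)⟩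

/-- The equation gives `u_t = g - (α u)_x`, and with the interchange of derivatives also `u_tt = g_t
- (α u_t)_x`; each time derivative costs one derivative in space. -/
theorem exists_isSmoothSol (hα : ContDiff ℝ ∞ α)
    (hg : ContDiff ℝ ∞ fun p : ℝ × ℝ => g p.1 p.2) (hT : 0 < T) :
    ∃ B : ℝ, 0 ≤ B ∧ ∀ (u₀ : ℝ → ℝ) (u : ℝ → ℝ → ℝ) (K : ℝ), IsExactSolution α g u₀ T u →
      (∀ t ∈ Icc 0 T, Reg (k + 2) K (u t)) → ∃ p q, IsSmoothSol k α g T (B * K) u p q := by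
  obtain ⟨Kα, hKα⟩ := exists_reg_of_contDiff (k + 2) (G := fun p : ℝ × ℝ => α p.2)
    (hα.comp contDiff_snd) 0
  have hαr : Reg (k + 2) Kα α := hKα 0 ⟨le_rfl, le_rfl⟩
  have hKα0 := hαr.nonneg
  obtain ⟨gt, Bg, hBg, hgt, hgreg⟩ := exists_reg_rhs hαr hg hT
  set B₁ := 2 ^ (k + 3) * Kα with hB₁
  set B₂ := Bg + B₁ with hB₂
  set B₃ := Bg + 2 ^ (k + 2) * (Kα * B₂) with hB₃
  have h1 : 0 ≤ B₁ := by positivity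
  have h2 : 0 ≤ B₂ := by positivity
  have h3 : 0 ≤ B₃ := by positivity
  refine ⟨1 + B₂ + B₃, by positivity, fun u₀ u K hu hreg => ?_⟩
  have hK : 0 ≤ K := (hreg 0 ⟨le_rfl, hT.le⟩).nonneg
  have hpi : (0 : ℝ) < 2 * π := by positivity
  have hgr := hgreg u₀ u K hu hreg
  have hF : ∀ t ∈ Icc 0 T, ∃ f' : ℝ → ℝ, (∀ x ∈ Icc 0 (2 * π),
      HasDerivWithinAt (fun x => α x * u t x) (f' x) (Icc 0 (2 * π)) x) ∧
      Reg (k + 1) (B₁ * K) f' := fun t ht => by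
    obtain ⟨-, f', hf', hfr⟩ := hαr.mul (hreg t ht)
    exact ⟨f', hf', hfr.mono (by rw [hB₁]; exact le_of_eq (by ring))⟩
  choose! f₁ hf₁ hf₁r using hF
  set p : ℝ → ℝ → ℝ := fun t x => g t x - f₁ t x with hp
  have hpr : ∀ t ∈ Icc 0 T, Reg (k + 1) (B₂ * K) (p t) := fun t ht =>
    ((hgr t ht).1.sub (hf₁r t ht)).mono (by rw [hB₂]; exact le_of_eq (by ring))
  have hup : ∀ t ∈ Icc 0 T, ∀ x ∈ Icc 0 (2 * π),
      HasDerivWithinAt (fun τ => u τ x) (p t x) (Icc 0 T) t := fun t ht x hx => by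
    obtain ⟨p', q', hp', hq', hpq⟩ := hu.equation t ht x hx
    have h3 := (uniqueDiffOn_Icc hpi x hx).eq_deriv _ hq' (hf₁ t ht x hx)
    refine hp'.congr_deriv ?_
    simp only [hp]
    linarith
  have hG : ∀ t ∈ Icc 0 T, ∃ f' : ℝ → ℝ, (∀ x ∈ Icc 0 (2 * π),
      HasDerivWithinAt (fun x => α x * p t x) (f' x) (Icc 0 (2 * π)) x) ∧
      Reg k (2 ^ (k + 2) * (Kα * (B₂ * K))) f' := fun t ht =>
    (hαr.pred.mul (hpr t ht)).2
  choose! f₂ hf₂ hf₂r using hG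
  refine ⟨p, fun t x => gt t x - f₂ t x, fun t ht => (hreg t ht).mono (by nlinarith),
    fun t ht => (hpr t ht).mono (by nlinarith), fun t ht => ?_, hup, fun t ht x hx => ?_,
    fun t ht a ha b hb hab => ?_, hu.periodic⟩
  · refine ((hgr t ht).2.sub (hf₂r t ht)).mono ?_
    have : Bg * K + 2 ^ (k + 2) * (Kα * (B₂ * K)) = B₃ * K := by rw [hB₃]; ring
    rw [this]
    nlinarith
  · refine (hgt t ht x hx).fun_sub ?_
    refine hasDerivWithinAt_swap (F := fun t x => α x * u t x) (G := fun t x => α x * p t x)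
      (K := 2 ^ (k + 2) * (Kα * (B₂ * K))) hx (fun t ht => hf₁ t ht x hx)
      (fun t ht y hy => (hup t ht y hy).const_mul (α y)) (fun t ht y hy => ?_) ht
    have hsub : uIcc x y ⊆ Icc 0 (2 * π) := uIcc_subset_Icc hx hy
    have h4 := abs_sub_le_of_hasDerivWithinAt (f := fun z => α z * p t z - f₂ t x * z)
      (f' := fun z => f₂ t z - f₂ t x) (K := 2 ^ (k + 2) * (Kα * (B₂ * K)) * |y - x|)
      (convex_uIcc x y)
      (fun z hz => ((hf₂ t ht z (hsub hz)).mono hsub).fun_sub (by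
        simpa using ((hasDerivAt_id z).const_mul (f₂ t x)).hasDerivWithinAt))
      (fun z hz => ((hf₂r t ht).lipschitz (hsub hz) hx).trans
        (mul_le_mul_of_nonneg_left (abs_sub_left_of_mem_uIcc hz) (by positivity)))
      right_mem_uIcc left_mem_uIcc
    rw [mul_assoc _ |y - x|, ← sq] at h4
    refine (le_of_eq ?_).trans h4
    congr 1
    ring
  · have hsub : Icc a b ⊆ Icc 0 (2 * π) := Icc_subset_Icc ha.1 hb.2
    have hcf : ContinuousOn (f₁ t) (Icc a b) := (hf₁r t ht).continuousOn.mono hsub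
    have hcg : ContinuousOn (g t) (Icc a b) := (hgr t ht).1.continuousOn.mono hsub
    have hif : IntervalIntegrable (f₁ t) volume a b :=
      ContinuousOn.intervalIntegrable (by rwa [uIcc_of_le hab])
    have hig : IntervalIntegrable (g t) volume a b :=
      ContinuousOn.intervalIntegrable (by rwa [uIcc_of_le hab])
    have h4 := intervalIntegral.integral_eq_sub_of_hasDerivAt_of_le hab
      (f := fun x => α x * u t x) (f' := f₁ t)
      (fun x hx => ((hf₁ t ht x (hsub hx)).mono hsub).continuousWithinAt)
      (fun x hx => (hf₁ t ht x (hsub (Ioo_subset_Icc_self hx))).hasDerivAt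
        (Icc_mem_nhds (ha.1.trans_lt hx.1) (hx.2.trans_le hb.2))) hif
    simp only [hp]
    rw [intervalIntegral.integral_sub hig hif, h4]
    ring

end Exact

end

section

/-! ### Elementary facts on meshes -/

variable {k N : ℕ}

namespace Mesh

theorem pos (M : Mesh N) : 0 < N := by
  rcases N with _ | N
  · have h1 := M.node_last
    rw [show Fin.last 0 = 0 from rfl, M.node_zero] at h1
    linarith [pi_pos]
  · exact N.succ_pos

variable (M : Mesh N)

theorem len_pos (i : Fin N) : 0 < M.len i :=
  sub_pos.2 (M.strictMono (Fin.castSucc_lt_succ))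

theorem node_mem (i : Fin (N + 1)) : M.node i ∈ Icc 0 (2 * π) :=
  ⟨M.node_zero ▸ M.strictMono.monotone (Fin.zero_le i),
    M.node_last ▸ M.strictMono.monotone (Fin.le_last i)⟩

theorem left_mem (i : Fin N) : M.left i ∈ Icc 0 (2 * π) := M.node_mem _

theorem right_mem (i : Fin N) : M.right i ∈ Icc 0 (2 * π) := M.node_mem _

theorem len_le_size (i : Fin N) : M.len i ≤ M.size :=
  le_ciSup (f := M.len) (Set.finite_range _).bddAbove i

theorem size_pos : 0 < M.size :=
  (M.len_pos ⟨0, M.pos⟩).trans_le (M.len_le_size _)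

theorem sum_len : ∑ i, M.len i = 2 * π := by
  have h : ∑ i, M.len i = ∑ i : Fin N, M.node i.succ - ∑ i : Fin N, M.node i.castSucc := by
    rw [← Finset.sum_sub_distrib]; rfl
  have h1 := (Fin.sum_univ_succ M.node).symm.trans (Fin.sum_univ_castSucc M.node)
  rw [M.node_zero, M.node_last] at h1
  linarith

theorem two_pi_le : 2 * π ≤ N * M.size := by
  rw [← M.sum_len]
  refine (Finset.sum_le_sum fun i _ => M.len_le_size i).trans_eq ?_
  simp

/-- A periodic function takes the same value at the right end of an element and at the left end of
the next one. -/
theorem apply_left_next {f : ℝ → ℝ} (hf : f 0 = f (2 * π)) (i : Fin N) :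
    f (M.left (finRotate N i)) = f (M.right i) := by
  obtain ⟨n, rfl⟩ := Nat.exists_eq_succ_of_ne_zero M.pos.ne'
  rcases Fin.eq_castSucc_or_eq_last i with ⟨j, rfl⟩ | rfl
  · have h1 : finRotate (n + 1) j.castSucc = j.succ := finRotate_of_lt j.isLt
    rw [h1]
    rfl
  · have h1 : finRotate (n + 1) (Fin.last n) = 0 := finRotate_last
    have h2 : M.left (finRotate (n + 1) (Fin.last n)) = 0 := by
      rw [h1]; exact M.node_zero
    have h3 : M.right (Fin.last n) = 2 * π := M.node_last
    rw [h2, h3, hf]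

theorem point_neg_one (i : Fin N) : M.point i (-1) = M.left i := by
  unfold point len; ring

theorem point_one (i : Fin N) : M.point i 1 = M.right i := by
  unfold point len; ring

theorem point_sub (i : Fin N) (r r' : ℝ) : M.point i r - M.point i r' = M.len i / 2 * (r - r') := by
  unfold point; ring

theorem point_mono (i : Fin N) : Monotone (M.point i) := fun r r' h => by
  have h1 := M.point_sub i r' r
  have h2 : 0 ≤ M.len i / 2 * (r' - r) :=
    mul_nonneg (half_pos (M.len_pos i)).le (sub_nonneg.2 h)
  linarith

theorem point_injective (i : Fin N) : Function.Injective (M.point i) := fun r r' h => by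
  have h1 := M.point_sub i r r'
  rw [h, sub_self] at h1
  exact sub_eq_zero.1 ((mul_eq_zero.1 h1.symm).resolve_left (half_pos (M.len_pos i)).ne')

theorem point_mem_elem (i : Fin N) {r : ℝ} (hr : r ∈ Icc (-1 : ℝ) 1) :
    M.point i r ∈ Icc (M.left i) (M.right i) :=
  ⟨M.point_neg_one i ▸ M.point_mono i hr.1, M.point_one i ▸ M.point_mono i hr.2⟩

theorem point_mem (i : Fin N) {r : ℝ} (hr : r ∈ Icc (-1 : ℝ) 1) :
    M.point i r ∈ Icc 0 (2 * π) :=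
  ⟨(M.left_mem i).1.trans (M.point_mem_elem i hr).1,
    (M.point_mem_elem i hr).2.trans (M.right_mem i).2⟩

theorem abs_point_sub_le (i : Fin N) {r r' : ℝ} (hr : r ∈ Icc (-1 : ℝ) 1)
    (hr' : r' ∈ Icc (-1 : ℝ) 1) : |M.point i r - M.point i r'| ≤ M.size := by
  have h1 := M.point_mem_elem i hr
  have h2 := M.point_mem_elem i hr'
  have h3 := M.len_le_size i
  unfold len at h3
  rw [abs_le]
  constructor <;> linarith [h1.1, h1.2, h2.1, h2.2]

theorem integral_point (i : Fin N) (f : ℝ → ℝ) (a b : ℝ) :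
    ∫ x in M.point i a..M.point i b, f x = M.len i / 2 * ∫ r in a..b, f (M.point i r) := by
  have := intervalIntegral.smul_integral_comp_mul_add (a := a) (b := b) f (M.len i / 2)
    ((M.left i + M.right i) / 2)
  rw [smul_eq_mul] at this
  exact this.symm

/-- The pull-back of a polynomial on the `i`-th element to the reference element. -/
def refPoly (i : Fin N) : ℝ[X] →ₗ[ℝ] ℝ[X] where
  toFun p := p.comp (C (M.len i / 2) * X + C ((M.left i + M.right i) / 2))
  map_add' _ _ := add_comp
  map_smul' c p := smul_comp c p _

theorem eval_refPoly (i : Fin N) (p : ℝ[X]) (r : ℝ) :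
    (M.refPoly i p).eval r = p.eval (M.point i r) := by
  simp [refPoly, eval_comp, point]

theorem natDegree_refPoly_le (i : Fin N) {p : ℝ[X]} (hp : p.natDegree ≤ k) :
    (M.refPoly i p).natDegree ≤ k := by
  refine natDegree_comp_le.trans ?_
  have h1 : (C (M.len i / 2) * X + C ((M.left i + M.right i) / 2)).natDegree ≤ 1 :=
    natDegree_linear_le
  calc _ ≤ k * 1 := Nat.mul_le_mul hp h1
    _ = k := mul_one k

theorem eval_derivative_refPoly (i : Fin N) (p : ℝ[X]) (r : ℝ) :
    (derivative (M.refPoly i p)).eval r = M.len i / 2 * (derivative p).eval (M.point i r) := by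
  simp [refPoly, derivative_comp, eval_comp, point]

theorem integral_pt_eq_cellInt (s : Fin N → Fin (k + 2) → ℝ) (i : Fin N) (j : Fin (k + 1))
    (p : ℝ[X]) : ∫ x in pt M s i j.castSucc..pt M s i j.succ, p.eval x
      = M.len i / 2 * cellInt (s i) j (M.refPoly i p) := by
  unfold pt
  rw [M.integral_point i (fun x => p.eval x), cellInt, polyInt_apply]
  simp only [eval_refPoly]

end Mesh

/-! ### Interpolation on the reference element -/

/-- Interpolation of `φ` at the nodes `σ`. -/
def ipol (σ : Fin (k + 1) → ℝ) (φ : ℝ → ℝ) : ℝ[X] :=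
  Lagrange.interpolate Finset.univ σ fun j => φ (σ j)

theorem eval_ipol {σ : Fin (k + 1) → ℝ} (hσ : Function.Injective σ) (φ : ℝ → ℝ)
    (j : Fin (k + 1)) : (ipol σ φ).eval (σ j) = φ (σ j) :=
  Lagrange.eval_interpolate_at_node _ hσ.injOn (Finset.mem_univ j)

theorem natDegree_ipol_le {σ : Fin (k + 1) → ℝ} (hσ : Function.Injective σ) (φ : ℝ → ℝ) :
    (ipol σ φ).natDegree ≤ k := by
  have h1 := Lagrange.degree_interpolate_lt (s := Finset.univ) (fun j => φ (σ j)) hσ.injOn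
  rw [Finset.card_univ, Fintype.card_fin] at h1
  exact natDegree_le_iff_coeff_eq_zero.2 fun n hn =>
    coeff_eq_zero_of_degree_lt (h1.trans_le (by exact_mod_cast hn))

end

section

variable {k N : ℕ}

/-! ### Linearity of the discrete operators -/

theorem refUpwind_sub (a : Fin N → ℝ) (V W : Fin N → ℝ[X]) (i : Fin N) :
    refUpwind a (fun i => V i - W i) i = refUpwind a V i - refUpwind a W i := by
  unfold refUpwind
  split_ifs <;> simp

theorem refFlux_sub (a : Fin N → ℝ) (s : Fin N → Fin (k + 2) → ℝ) (V W : Fin N → ℝ[X])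
    (i : Fin N) (j : Fin (k + 2)) :
    refFlux a s (fun i => V i - W i) i j = refFlux a s V i j - refFlux a s W i j := by
  unfold refFlux
  split_ifs
  · exact refUpwind_sub _ _ _ _
  · exact refUpwind_sub _ _ _ _
  · simp

theorem schemeRes_sub (a H : Fin N → ℝ) (αp s : Fin N → Fin (k + 2) → ℝ)
    (V V' W W' : Fin N → ℝ[X]) (i : Fin N) (j : Fin (k + 1)) :
    schemeRes a H αp s (fun i => V i - W i) (fun i => V' i - W' i) i j
      = schemeRes a H αp s V V' i j - schemeRes a H αp s W W' i j := by
  unfold schemeRes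
  rw [refFlux_sub, refFlux_sub, map_sub]
  ring

/-! ### Energies -/

theorem polyInt_sq_add_le (u v : ℝ[X]) :
    polyInt (-1) 1 ((u + v) ^ 2) ≤ 2 * polyInt (-1) 1 (u ^ 2) + 2 * polyInt (-1) 1 (v ^ 2) := by
  have h1 := polyInt_sq_nonneg (u - v)
  have h2 : (u - v) ^ 2 = (2 : ℝ) • u ^ 2 + (2 : ℝ) • v ^ 2 - (u + v) ^ 2 := by
    rw [smul_eq_C_mul, smul_eq_C_mul, show (C (2 : ℝ)) = 2 from rfl]; ring
  rw [h2, map_sub, map_add, map_smul, map_smul] at h1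
  simp only [smul_eq_mul] at h1
  linarith

variable {K L ρ h : ℝ} {a H : Fin N → ℝ} {αp s A : Fin N → Fin (k + 2) → ℝ}

theorem IsDiscretization.mul_sum_le_energy (hD : IsDiscretization K L ρ h a H αp s A) (hk : 1 ≤ k)
    {β : Fin N → ℝ} (hβ : ∀ i, 0 ≤ β i) {V : Fin N → ℝ[X]} (hV : ∀ i, (V i).natDegree ≤ k) :
    h * ∑ i, β i * polyInt (-1) 1 (V i ^ 2) ≤ 2 * ρ * energy H β s A V := by
  unfold energy
  rw [Finset.mul_sum, Finset.mul_sum]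
  refine Finset.sum_le_sum fun i _ => ?_
  obtain ⟨κ, hκ⟩ := (hD.ref i).quad
  have h1 := polyInt_sq_le_svForm (hD.ref i).partition hκ hk (hV i)
  have h2 := polyInt_sq_nonneg (V i)
  have h3 := hD.le_H i
  have h4 := hD.H_pos i
  have h5 := hβ i
  have h6 := hD.rho_pos
  calc h * (β i * polyInt (-1) 1 (V i ^ 2))
      ≤ (ρ * H i) * (β i * svForm (s i) (A i) (V i) (V i)) := by
        gcongr
    _ = _ := by ring

theorem IsDiscretization.abs_sub_next_le (hD : IsDiscretization K L ρ h a H αp s A) (i : Fin N) :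
    |a i - a (finRotate N i)| ≤ L * h := by
  have h1 := hD.near (finRotate N i) 0
  rwa [hD.first, Equiv.symm_apply_apply] at h1

theorem isWeight_one (h : ℝ) (hh : 0 ≤ h) (a : Fin N → ℝ) : IsWeight 1 h a fun _ => 1 where
  nonneg := zero_le_one
  pos _ := one_pos
  diff_left i := by simpa using hh
  diff_right i := by simpa using hh
  le_next i := by simp
  next_le i := by simp

/-- The constant of the weights `α² + h²`. -/
def weightConst (L : ℝ) : ℝ := (L ^ 2 + 2 * L + 1) * (2 * L ^ 2 + 2)

theorem weightConst_nonneg {L : ℝ} (hL : 0 ≤ L) : 0 ≤ weightConst L := by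
  unfold weightConst; positivity

/-- The weights `α² + h²` compensate for the factor `1 / α` in the correction of the solution. -/
theorem IsDiscretization.isWeight (hD : IsDiscretization K L ρ h a H αp s A) :
    IsWeight (weightConst L) h a fun i => a i ^ 2 + h ^ 2 := by
  have hh := hD.h_pos
  have hL := hD.L_nonneg
  have hcomp : ∀ x y : ℝ, |x - y| ≤ L * h → x ^ 2 + h ^ 2 ≤ (2 * L ^ 2 + 2) * (y ^ 2 + h ^ 2) :=
    fun x y hxy => by
      have h1 : (x - y) ^ 2 ≤ (L * h) ^ 2 := sq_le_sq' (by linarith [neg_abs_le (x - y)])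
        ((le_abs_self _).trans hxy)
      have h2 : 0 ≤ L ^ 2 * y ^ 2 := by positivity
      nlinarith [sq_nonneg (x - 2 * y), sq_nonneg h]
  have hdiff : ∀ x y : ℝ, |x - y| ≤ L * h →
      |x| * |x ^ 2 + h ^ 2 - (y ^ 2 + h ^ 2)| ≤ (L ^ 2 + 2 * L) * h * (x ^ 2 + h ^ 2) :=
    fun x y hxy => by
      have h1 : x ^ 2 + h ^ 2 - (y ^ 2 + h ^ 2) = (x - y) * (2 * x - (x - y)) := by ring
      have h2 : |2 * x - (x - y)| ≤ 2 * |x| + L * h := by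
        refine (abs_sub _ _).trans ?_
        rw [abs_mul, abs_two]
        linarith
      rw [h1, abs_mul]
      calc |x| * (|x - y| * |2 * x - (x - y)|) ≤ |x| * ((L * h) * (2 * |x| + L * h)) := by gcongr
        _ = L * h * (2 * |x| ^ 2 + L * (|x| * h)) := by ring
        _ ≤ L * h * (2 * (x ^ 2 + h ^ 2) + L * (x ^ 2 + h ^ 2)) := by
            rw [sq_abs]
            gcongr
            · nlinarith [sq_nonneg h]
            · nlinarith [sq_abs x, sq_nonneg (|x| - h), sq_nonneg x, sq_nonneg h]
        _ = _ := by ring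
  have hW1 : L ^ 2 + 2 * L ≤ weightConst L := by
    unfold weightConst
    nlinarith [mul_nonneg (by positivity : 0 ≤ L ^ 2 + 2 * L + 1) (by positivity : 0 ≤ L ^ 2)]
  have hW2 : (2 * L ^ 2 + 2) ≤ weightConst L := by
    unfold weightConst
    nlinarith [mul_nonneg (by positivity : 0 ≤ L ^ 2 + 2 * L) (by positivity : 0 ≤ 2 * L ^ 2 + 2)]
  have hW3 : (L ^ 2 + 2 * L) * (2 * L ^ 2 + 2) ≤ weightConst L := by
    unfold weightConst
    nlinarith [sq_nonneg L]
  have hβ : ∀ i, 0 < a i ^ 2 + h ^ 2 := fun i => by positivity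
  refine ⟨weightConst_nonneg hL, hβ, fun i => ?_, fun i => ?_, fun i => ?_, fun i => ?_⟩
  · refine (hdiff _ _ (hD.abs_sub_next_le i)).trans ?_
    have := (hβ i).le
    gcongr
  · refine (hdiff _ _ (hD.abs_sub_next_le i)).trans ?_
    have := (hβ (finRotate N i)).le
    calc _ ≤ (L ^ 2 + 2 * L) * h * ((2 * L ^ 2 + 2) * (a (finRotate N i) ^ 2 + h ^ 2)) := by
          gcongr
          exact hcomp _ _ (hD.abs_sub_next_le i)
      _ = (L ^ 2 + 2 * L) * (2 * L ^ 2 + 2) * h * (a (finRotate N i) ^ 2 + h ^ 2) := by ring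
      _ ≤ _ := by gcongr
  · refine (hcomp _ _ (hD.abs_sub_next_le i)).trans ?_
    have := (hβ (finRotate N i)).le
    gcongr
  · refine (hcomp _ _ (by rw [abs_sub_comm]; exact hD.abs_sub_next_le i)).trans ?_
    have := (hβ i).le
    gcongr

/-! ### First order estimates of the discrete error and of its time derivative -/

/-- The discrete error `X` vanishes initially, and the residual of the scheme for it is bounded and
Lipschitz continuous in time. -/
structure IsErrorSystem (T K L ρ h ε : ℝ) (a H : Fin N → ℝ) (αp s A : Fin N → Fin (k + 2) → ℝ)
    (X X' : ℝ → Fin N → ℝ[X]) : Prop where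
  disc : IsDiscretization K L ρ h a H αp s A
  one_le : 1 ≤ L
  abs_le : ∀ i, |a i| ≤ L
  eps_nonneg : 0 ≤ ε
  natDegree_le : ∀ t ∈ Icc 0 T, ∀ i, (X t i).natDegree ≤ k
  natDegree_deriv_le : ∀ t ∈ Icc 0 T, ∀ i, (X' t i).natDegree ≤ k
  hasDeriv : ∀ t ∈ Icc 0 T, ∀ i, HasPolyDerivWithinAt (fun t => X t i) (X' t i) (Icc 0 T) t
  init : ∀ i, X 0 i = 0
  abs_res_le : ∀ t ∈ Icc 0 T, ∀ i j, |schemeRes a H αp s (X t) (X' t) i j| ≤ ε * h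
  res_lipschitz : ∀ t₁ ∈ Icc 0 T, ∀ t₂ ∈ Icc 0 T, ∀ i j,
    |schemeRes a H αp s (X t₂) (X' t₂) i j - schemeRes a H αp s (X t₁) (X' t₁) i j|
      ≤ ε * h * |t₂ - t₁|

variable {T ε : ℝ} {X X' : ℝ → Fin N → ℝ[X]}

theorem energy_zero (H β : Fin N → ℝ) (s A : Fin N → Fin (k + 2) → ℝ) {V : Fin N → ℝ[X]}
    (hV : ∀ i, V i = 0) : energy H β s A V = 0 := by
  simp [energy, svForm, hV]

/-- The choice `lam = 1 / t` in the stability estimate on `[0, t]` gives a bound that is quadratic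
in `t` for small `t`, as the time differences need. -/
theorem IsErrorSystem.energy_le (hS : IsErrorSystem T K L ρ h ε a H αp s A X X') (hk : 1 ≤ k)
    {t : ℝ} (ht : t ∈ Icc 0 T) :
    energy H (fun _ => 1) s A (X t) ≤ Real.exp (stabConst k K L ρ 1 * (T + 1))
      * stabConst k K L ρ 1 * (ε * t) ^ 2 := by
  have hD := hS.disc
  have hh := hD.h_pos
  have hc := hD.stabConst_nonneg (Kβ := 1) zero_le_one
  rcases ht.1.eq_or_lt with rfl | ht0
  · rw [energy_zero _ _ _ _ hS.init]
    simp
  have hsub : Icc 0 t ⊆ Icc 0 T := Icc_subset_Icc le_rfl ht.2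
  have h1 := hD.energy_le hk (isWeight_one h hh.le a) (τ := t) (ε := ε) (lam := 1 / t)
    (by positivity) (fun τ hτ => hS.natDegree_le τ (hsub hτ))
    (fun τ hτ => hS.natDegree_deriv_le τ (hsub hτ))
    (fun τ hτ i => (hS.hasDeriv τ (hsub hτ) i).mono hsub)
    (fun τ hτ i j => by
      rw [one_mul]
      rw [← sq_abs]
      exact pow_le_pow_left₀ (abs_nonneg _) (hS.abs_res_le τ (hsub hτ) i j) 2)
    (t := t) ⟨ht0.le, le_rfl⟩
  rw [energy_zero _ _ _ _ hS.init, zero_add] at h1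
  refine h1.trans ?_
  have h2 : stabConst k K L ρ 1 * (1 + 1 / t) * t = stabConst k K L ρ 1 * (t + 1) := by
    field_simp
  have h3 : stabConst k K L ρ 1 * ε ^ 2 / (1 / t) * t = stabConst k K L ρ 1 * (ε * t) ^ 2 := by
    field_simp
  rw [h2, h3, ← mul_assoc]
  gcongr
  exact ht.2

/-- The constant of the estimate for time differences of the discrete error. -/
def rateConst (k : ℕ) (K L ρ T : ℝ) : ℝ :=
  Real.exp (stabConst k K L ρ 1 * 2 * T) * (Real.exp (stabConst k K L ρ 1 * (T + 1))
      * stabConst k K L ρ 1 + stabConst k K L ρ 1 * T)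

/-- The differences `X (τ + δ) - X τ` solve the scheme with a residual of size `ε h δ`, because the
scheme does not depend on time, and their initial value `X δ` is of size `ε δ`. -/
theorem IsErrorSystem.energy_sub_le (hS : IsErrorSystem T K L ρ h ε a H αp s A X X') (hk : 1 ≤ k)
    {t₁ t₂ : ℝ} (ht₁ : 0 ≤ t₁) (h12 : t₁ ≤ t₂) (ht₂ : t₂ ≤ T) :
    energy H (fun _ => 1) s A (fun i => X t₂ i - X t₁ i)
      ≤ rateConst k K L ρ T * (ε * (t₂ - t₁)) ^ 2 := by
  have hD := hS.disc
  have hh := hD.h_pos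
  have hε := hS.eps_nonneg
  have hc := hD.stabConst_nonneg (Kβ := 1) zero_le_one
  set δ := t₂ - t₁ with hδ
  have hδ0 : 0 ≤ δ := sub_nonneg.2 h12
  have hsub : ∀ τ ∈ Icc 0 (T - δ), τ ∈ Icc 0 T := fun τ hτ => ⟨hτ.1, by linarith [hτ.2]⟩
  have hadd : ∀ τ ∈ Icc 0 (T - δ), τ + δ ∈ Icc 0 T := fun τ hτ =>
    ⟨by linarith [hτ.1], by linarith [hτ.2]⟩
  have h1 := hD.energy_le hk (isWeight_one h hh.le a) (τ := T - δ) (ε := ε * δ) (lam := 1)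
    one_pos (V := fun τ i => X (τ + δ) i - X τ i) (V' := fun τ i => X' (τ + δ) i - X' τ i)
    (fun τ hτ i => (natDegree_sub_le _ _).trans
      (max_le (hS.natDegree_le _ (hadd τ hτ) i) (hS.natDegree_le τ (hsub τ hτ) i)))
    (fun τ hτ i => (natDegree_sub_le _ _).trans
      (max_le (hS.natDegree_deriv_le _ (hadd τ hτ) i) (hS.natDegree_deriv_le τ (hsub τ hτ) i)))
    (fun τ hτ i => by
      refine HasPolyDerivWithinAt.sub (fun F => ?_) ((hS.hasDeriv τ (hsub τ hτ) i).mono hsub)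
      have h2 := (hS.hasDeriv _ (hadd τ hτ) i F).comp τ
        ((hasDerivWithinAt_id τ (Icc 0 (T - δ))).add_const δ) (fun x hx => hadd x hx)
      rw [mul_one] at h2
      exact h2)
    (fun τ hτ i j => by
      rw [one_mul, schemeRes_sub, ← sq_abs]
      have h2 := hS.res_lipschitz τ (hsub τ hτ) (τ + δ) (hadd τ hτ) i j
      rw [add_sub_cancel_left, abs_of_nonneg hδ0] at h2
      refine pow_le_pow_left₀ (abs_nonneg _) (h2.trans_eq (by ring)) 2)
    (t := t₁) ⟨ht₁, by linarith⟩
  have h0 := hS.energy_le hk (t := δ) ⟨hδ0, by linarith⟩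
  have e1 : t₁ + δ = t₂ := by rw [hδ]; ring
  simp only [zero_add, e1, hS.init, sub_zero] at h1
  refine h1.trans ?_
  have hT : t₁ ≤ T := h12.trans ht₂
  calc _ ≤ Real.exp (stabConst k K L ρ 1 * (1 + 1) * t₁) *
      (Real.exp (stabConst k K L ρ 1 * (T + 1))
      * stabConst k K L ρ 1 * (ε * δ) ^ 2 + stabConst k K L ρ 1 * (ε * δ) ^ 2 / 1 * T) := by
        gcongr
    _ ≤ Real.exp (stabConst k K L ρ 1 * (1 + 1) * T) * (Real.exp (stabConst k K L ρ 1 * (T + 1))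
      * stabConst k K L ρ 1 * (ε * δ) ^ 2 + stabConst k K L ρ 1 * (ε * δ) ^ 2 / 1 * T) := by
        have := ht₁.trans hT
        gcongr
    _ = _ := by
        unfold rateConst
        rw [show (1 : ℝ) + 1 = 2 by norm_num]
        ring

/-- The bound for the time derivative is the limit of the bound for the difference quotients. The
second time derivative of the discrete solution, which need not exist, is not used. -/
theorem IsErrorSystem.energy_deriv_le (hS : IsErrorSystem T K L ρ h ε a H αp s A X X')
    (hk : 1 ≤ k) (hT : 0 < T) {t : ℝ} (ht : t ∈ Icc 0 T) :
    energy H (fun _ => 1) s A (X' t) ≤ rateConst k K L ρ T * ε ^ 2 := by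
  have hne : (nhdsWithin t (Icc 0 T \ {t})).NeBot :=
    accPt_principal_iff_nhdsWithin.1
      (uniqueDiffWithinAt_iff_accPt.1 (uniqueDiffOn_Icc hT t ht))
  have hF : ∀ i (F : ℝ[X] →ₗ[ℝ] ℝ), Filter.Tendsto
      (fun τ => F ((τ - t)⁻¹ • (X τ i - X t i))) (nhdsWithin t (Icc 0 T \ {t}))
      (nhds (F (X' t i))) := fun i F => by
    have h1 := hasDerivWithinAt_iff_tendsto_slope.1 (hS.hasDeriv t ht i F)
    refine h1.congr fun τ => ?_
    rw [slope_def_module, map_smul, map_sub]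
  have hE : Filter.Tendsto (fun τ => energy H (fun _ => 1) s A
      (fun i => (τ - t)⁻¹ • (X τ i - X t i))) (nhdsWithin t (Icc 0 T \ {t}))
      (nhds (energy H (fun _ => 1) s A (X' t))) := by
    unfold energy svForm
    exact tendsto_finsetSum _ fun i _ => ((tendsto_finsetSum _ fun j _ =>
      (hF i _).mul (hF i _)).const_mul _).const_mul _
  refine le_of_tendsto hE ?_
  filter_upwards [self_mem_nhdsWithin] with τ hτ
  have hτt : τ - t ≠ 0 := sub_ne_zero.2 hτ.2
  have hsq : energy H (fun _ => 1) s A (fun i => (τ - t)⁻¹ • (X τ i - X t i))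
      = (τ - t)⁻¹ ^ 2 * energy H (fun _ => 1) s A (fun i => X τ i - X t i) := by
    unfold energy svForm
    simp only [map_smul, smul_eq_mul, Finset.mul_sum]
    refine Finset.sum_congr rfl fun i _ => Finset.sum_congr rfl fun j _ => ?_
    ring
  have hneg : energy H (fun _ => 1) s A (fun i => X τ i - X t i)
      ≤ rateConst k K L ρ T * (ε * (τ - t)) ^ 2 := by
    rcases le_total t τ with h | h
    · exact hS.energy_sub_le hk ht.1 h hτ.1.2
    · have h1 := hS.energy_sub_le hk hτ.1.1 h ht.2
      have h2 : energy H (fun _ => 1) s A (fun i => X τ i - X t i)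
          = energy H (fun _ => 1) s A (fun i => X t i - X τ i) := by
        unfold energy svForm
        simp only [map_sub]
        refine Finset.sum_congr rfl fun i _ => ?_
        congr 2
        refine Finset.sum_congr rfl fun j _ => ?_
        ring
      rw [h2]
      refine h1.trans_eq ?_
      ring
  rw [hsq]
  calc _ ≤ (τ - t)⁻¹ ^ 2 * (rateConst k K L ρ T * (ε * (τ - t)) ^ 2) := by gcongr
    _ = _ := by field_simp

end

section

variable {k N : ℕ}

/-! ### The correction of the discrete error -/

theorem IsRefElement.abs_polyInt_basis_le {K : ℝ} {s A : Fin (k + 2) → ℝ}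
    (hR : IsRefElement K s A) (m j : Fin (k + 2)) :
    |polyInt (-1) (s j) (Lagrange.basis Finset.univ s m)| ≤ 2 * K := by
  have hj := hR.partition.mem_Icc j
  have hK := zero_le_one.trans hR.one_le
  refine (abs_polyInt_le (B := K) hj.1 fun x hx =>
    hR.abs_basis_le m x ⟨hx.1, hx.2.trans hj.2⟩).trans ?_
  nlinarith [hj.2]

/-- On an element where the coefficient is bounded away from zero, a polynomial of degree `k` turns
the leading part of the interpolation error into a flux difference. This needs the leading part to
have mean value zero. -/
theorem IsRefElement.exists_corrector {K : ℝ} {s A : Fin (k + 2) → ℝ} (hR : IsRefElement K s A)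
    {m : Fin (k + 2)} {α : Fin (k + 2) → ℝ} {b d : ℝ}
    (hb : 0 < b) (hd : 0 ≤ d) (hα : ∀ j, b ≤ |α j|) :
    ∃ W : ℝ[X], W.natDegree ≤ k ∧ (∀ r ∈ Icc (-1 : ℝ) 1, |W.eval r| ≤ K * (d * K / b)) ∧
      ∀ j, j ≠ m → α j * W.eval (s j)
        = d / 2 * polyInt (-1) (s j) (Lagrange.basis Finset.univ s m) := by
  set F : Fin (k + 2) → ℝ := fun j => d / 2 * polyInt (-1) (s j) (Lagrange.basis Finset.univ s m)
    with hF
  have hinj : Function.Injective (s ∘ m.succAbove) :=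
    hR.partition.1.injective.comp Fin.succAbove_right_injective
  set φ : Fin (k + 1) → ℝ := fun j => F (m.succAbove j) / α (m.succAbove j) with hφ
  set W : ℝ[X] := Lagrange.interpolate Finset.univ (s ∘ m.succAbove) φ with hW
  have hWe : ∀ j, W.eval (s (m.succAbove j)) = φ j := fun j =>
    Lagrange.eval_interpolate_at_node φ hinj.injOn (Finset.mem_univ j)
  have hdeg : W.natDegree ≤ k := by
    have h1 := Lagrange.degree_interpolate_lt (s := Finset.univ) φ hinj.injOn
    rw [Finset.card_univ, Fintype.card_fin] at h1
    exact natDegree_le_iff_coeff_eq_zero.2 fun n hn =>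
      coeff_eq_zero_of_degree_lt (h1.trans_le (by exact_mod_cast hn))
  have hα0 : ∀ j, α j ≠ 0 := fun j => abs_pos.1 (hb.trans_le (hα j))
  refine ⟨W, hdeg, fun r hr => (hR.lebesgue m.succAbove Fin.succAbove_right_injective W hdeg _
    (fun j => ?_) r hr).1, fun j hj => ?_⟩
  · rw [hWe, hφ]
    simp only
    rw [abs_div]
    have h1 := hR.abs_polyInt_basis_le m (m.succAbove j)
    have h2 := hα (m.succAbove j)
    have hK := zero_le_one.trans hR.one_le
    have h3 : |F (m.succAbove j)| ≤ d * K := by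
      rw [hF]
      simp only
      rw [abs_mul, abs_of_nonneg (by positivity : 0 ≤ d / 2)]
      calc _ ≤ d / 2 * (2 * K) := by gcongr
        _ = _ := by ring
    gcongr
  · obtain ⟨l, rfl⟩ := Fin.exists_succAbove_eq hj
    rw [hWe, hφ]
    simp only
    rw [mul_div_cancel₀ _ (hα0 _)]

/-- On the elements where the coefficient is not small, the residual is up to higher order terms a
multiple of the Lagrange basis polynomial of the inflow end point, which has mean value zero. -/
structure HasLeadingResidual (T L h ε : ℝ) (a H : Fin N → ℝ) (αp s : Fin N → Fin (k + 2) → ℝ)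
    (m : Fin N → Fin (k + 2)) (c c' : ℝ → Fin N → ℝ) (X X' : ℝ → Fin N → ℝ[X]) : Prop where
  side : ∀ i, 2 * L * h < |a i| → (0 < a i ∧ m i = 0) ∨ (a i < 0 ∧ m i = Fin.last (k + 1))
  mean : ∀ i, 2 * L * h < |a i| → polyInt (-1) 1 (Lagrange.basis Finset.univ (s i) (m i)) = 0
  hasDeriv : ∀ t ∈ Icc 0 T, ∀ i, HasDerivWithinAt (fun t => c t i) (c' t i) (Icc 0 T) t
  abs_le : ∀ t ∈ Icc 0 T, ∀ i, |c t i| ≤ ε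
  abs_deriv_le : ∀ t ∈ Icc 0 T, ∀ i, |c' t i| ≤ ε
  res : ∀ t ∈ Icc 0 T, ∀ i, 2 * L * h < |a i| → ∀ j, |schemeRes a H αp s (X t) (X' t) i j
    - H i / 2 * (c t i * cellInt (s i) j (Lagrange.basis Finset.univ (s i) (m i)))| ≤ ε * h * h

variable {K L ρ h T ε : ℝ} {a H : Fin N → ℝ} {αp s A : Fin N → Fin (k + 2) → ℝ}
  {X X' : ℝ → Fin N → ℝ[X]} {m : Fin N → Fin (k + 2)} {c c' : ℝ → Fin N → ℝ}

theorem IsDiscretization.half_le_abs (hD : IsDiscretization K L ρ h a H αp s A) {i : Fin N}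
    (hi : 2 * L * h < |a i|) (j : Fin (k + 2)) : |a i| / 2 ≤ |αp i j| := by
  have h1 := hD.near i j
  have h2 := abs_sub_abs_le_abs_sub (a i) (αp i j)
  rw [abs_sub_comm] at h2
  linarith

/-- The correction contributes no flux through the interfaces, since it vanishes at the outflow
ends. Inside an element its flux is the antiderivative of the leading part of the residual. -/
theorem IsDiscretization.flux_corrector (hD : IsDiscretization K L ρ h a H αp s A)
    (hside : ∀ i, 2 * L * h < |a i| → (0 < a i ∧ m i = 0) ∨ (a i < 0 ∧ m i = Fin.last (k + 1)))
    (hmean : ∀ i, 2 * L * h < |a i| →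
      polyInt (-1) 1 (Lagrange.basis Finset.univ (s i) (m i)) = 0)
    {W : Fin N → ℝ[X]} (hW0 : ∀ i, ¬ 2 * L * h < |a i| → W i = 0)
    (hW : ∀ i, 2 * L * h < |a i| → ∀ j, j ≠ m i → αp i j * (W i).eval (s i j)
        = H i / 2 * polyInt (-1) (s i j) (Lagrange.basis Finset.univ (s i) (m i)))
    (d : Fin N → ℝ) (i : Fin N) (j : Fin (k + 2)) :
    αp i j * refFlux a s (fun i => d i • W i) i j = if 2 * L * h < |a i| then
      d i * (H i / 2 * polyInt (-1) (s i j) (Lagrange.basis Finset.univ (s i) (m i))) else 0 := by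
  have hne : Fin.last (k + 1) ≠ 0 := (Fin.last_pos).ne'
  have hs0 : ∀ i, s i 0 = -1 := fun i => (hD.ref i).partition.2.1
  have hs1 : ∀ i, s i (Fin.last (k + 1)) = 1 := fun i => (hD.ref i).partition.2.2
  have hLh : 0 ≤ L * h := mul_nonneg hD.L_nonneg hD.h_pos.le
  have hself : polyInt (-1) (-1) = 0 := by
    ext p; simp [polyInt_apply]
  have hup : ∀ i, a i * refUpwind a (fun i => d i • W i) i = 0 := fun i => by
    unfold refUpwind
    split_ifs with hpos
    · by_cases hi : 2 * L * h < |a i|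
      · have hm : m i = 0 := by
          rcases hside i hi with h1 | h1
          · exact h1.2
          · linarith [h1.1]
        have h2 := hW i hi (Fin.last (k + 1)) (by rw [hm]; exact hne)
        rw [hs1, hmean i hi, hD.last, mul_zero] at h2
        rw [eval_smul, smul_eq_mul, mul_left_comm, h2, mul_zero]
      · simp [hW0 i hi]
    · rcases (not_lt.1 hpos).eq_or_lt with h0 | hneg
      · rw [h0, zero_mul]
      · by_cases hi : 2 * L * h < |a (finRotate N i)|
        · have hm : m (finRotate N i) = Fin.last (k + 1) := by
            rcases hside _ hi with h1 | h1
            · have h2 := hD.abs_sub_next_le i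
              rw [abs_of_pos h1.1] at hi
              rw [abs_le] at h2
              linarith [h2.1]
            · exact h1.2
          have h2 := hW _ hi 0 (by rw [hm]; exact hne.symm)
          rw [hs0, hself, hD.first, Equiv.symm_apply_apply, LinearMap.zero_apply, mul_zero] at h2
          rw [eval_smul, smul_eq_mul, mul_left_comm, h2, mul_zero]
        · simp only [hW0 _ hi, smul_zero, eval_zero, mul_zero]
  by_cases hj0 : j = 0
  · subst hj0
    rw [refFlux, if_pos rfl, hD.first, hup, hs0, hself]
    simp
  by_cases hj1 : j = Fin.last (k + 1)
  · subst hj1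
    rw [refFlux, if_neg hne, if_pos rfl, hD.last, hup, hs1]
    split_ifs with hi
    · rw [hmean i hi]; simp
    · rfl
  rw [refFlux, if_neg hj0, if_neg hj1]
  split_ifs with hi
  · rw [eval_smul, smul_eq_mul, mul_left_comm, hW i hi j]
    rcases hside i hi with h1 | h1
    · rw [h1.2]; exact hj0
    · rw [h1.2]; exact hj1
  · simp [hW0 i hi]

/-- The constant of the superconvergence estimate. -/
def superConst (k : ℕ) (K L ρ T : ℝ) : ℝ :=
  4 * ρ * (Real.exp (stabConst k K L ρ (weightConst L) * (1 + 1) * T) * (8 * π * ρ * K ^ 5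
    + stabConst k K L ρ (weightConst L) * (5 * L + 4 * K ^ 2) ^ 2 * T)) + 64 * π * ρ * K ^ 4

/-- The weighted superconvergence estimate: the corrected error has a residual of higher order, and
the correction itself is of size `O(h / α)`, which the weights `α² + h²` absorb. -/
theorem IsErrorSystem.weighted_le (hS : IsErrorSystem T K L ρ h ε a H αp s A X X') (hk : 1 ≤ k)
    (hX : HasLeadingResidual T L h ε a H αp s m c c' X X') {t : ℝ} (ht : t ∈ Icc 0 T) :
    h * ∑ i, (a i ^ 2 + h ^ 2) * polyInt (-1) 1 (X t i ^ 2)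
      ≤ superConst k K L ρ T * (ε * h) ^ 2 := by
  have hD := hS.disc
  have hh := hD.h_pos
  have hL1 := hS.one_le
  have hε := hS.eps_nonneg
  have hK1 := hD.one_le
  have hρ := hD.rho_pos
  have hst := hD.stabConst_nonneg (weightConst_nonneg hD.L_nonneg)
  have hW : ∀ i, ∃ W : ℝ[X], W.natDegree ≤ k ∧ (¬ 2 * L * h < |a i| → W = 0) ∧
      (2 * L * h < |a i| → (∀ r ∈ Icc (-1 : ℝ) 1, |W.eval r| ≤ K * (h * K / (|a i| / 2))) ∧
      ∀ j, j ≠ m i → αp i j * W.eval (s i j)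
        = H i / 2 * polyInt (-1) (s i j) (Lagrange.basis Finset.univ (s i) (m i))) := fun i => by
    by_cases hi : 2 * L * h < |a i|
    · have ha : 0 < |a i| := lt_of_le_of_lt (by positivity) hi
      obtain ⟨W, h1, h2, h3⟩ := (hD.ref i).exists_corrector (m := m i) (half_pos ha) (hD.H_pos i).le
        (hD.half_le_abs hi)
      refine ⟨W, h1, fun h => absurd hi h, fun _ => ⟨fun r hr => (h2 r hr).trans ?_, h3⟩⟩
      have := hD.H_le i
      gcongr
    · exact ⟨0, by simp, fun _ => rfl, fun h => absurd h hi⟩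
  choose W hWd hW0 hW using hW
  have hWb : ∀ i, ∀ r ∈ Icc (-1 : ℝ) 1, |a i| * |(W i).eval r| ≤ 2 * K ^ 2 * h := fun i r hr => by
    by_cases hi : 2 * L * h < |a i|
    · have ha : 0 < |a i| := lt_of_le_of_lt (by positivity) hi
      calc _ ≤ |a i| * (K * (h * K / (|a i| / 2))) := by gcongr; exact (hW i hi).1 r hr
        _ = _ := by field_simp
    · rw [hW0 i hi]; simp; positivity
  -- the correction, bounded with the weight
  have hwb : ∀ t ∈ Icc 0 T, ∀ i, ∃ B : ℝ, (∀ r ∈ Icc (-1 : ℝ) 1, |(c t i • W i).eval r| ≤ B) ∧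
      (a i ^ 2 + h ^ 2) * B ^ 2 ≤ 8 * K ^ 4 * (ε * h) ^ 2 := fun t ht i => by
    by_cases hi : 2 * L * h < |a i|
    · have ha : 0 < |a i| := lt_of_le_of_lt (by positivity) hi
      refine ⟨ε * (2 * K ^ 2 * h / |a i|), fun r hr => ?_, ?_⟩
      · rw [eval_smul, smul_eq_mul, abs_mul]
        have h1 := hX.abs_le t ht i
        gcongr
        rw [le_div_iff₀ ha, mul_comm]
        exact hWb i r hr
      · have h2 : a i ^ 2 + h ^ 2 ≤ 2 * |a i| ^ 2 := by
          have h3 : h ≤ |a i| := by nlinarith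
          have h4 : h ^ 2 ≤ |a i| ^ 2 := by gcongr
          rw [sq_abs] at *
          linarith
        calc _ ≤ 2 * |a i| ^ 2 * (ε * (2 * K ^ 2 * h / |a i|)) ^ 2 := by gcongr
          _ = _ := by field_simp; ring
    · refine ⟨0, fun r _ => by rw [hW0 i hi]; simp, ?_⟩
      rw [zero_pow two_ne_zero, mul_zero]
      positivity
  have hsum : ∀ E : ℝ, 0 ≤ E → h * ∑ _i : Fin N, E ≤ 2 * π * ρ * E := fun E hE => by
    have h1 := hD.N_mul_le
    simp only [Finset.sum_const, Finset.card_univ, Fintype.card_fin, nsmul_eq_mul]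
    nlinarith
  set V : ℝ → Fin N → ℝ[X] := fun t i => X t i - c t i • W i with hV
  set V' : ℝ → Fin N → ℝ[X] := fun t i => X' t i - c' t i • W i with hV'
  have hVd : ∀ t ∈ Icc 0 T, ∀ i, (V t i).natDegree ≤ k := fun t ht i =>
    (natDegree_sub_le _ _).trans (max_le (hS.natDegree_le t ht i)
      ((natDegree_smul_le _ _).trans (hWd i)))
  have hres : ∀ t ∈ Icc 0 T, ∀ i j, (a i ^ 2 + h ^ 2) * schemeRes a H αp s (V t) (V' t) i j ^ 2
      ≤ (ε * h * (5 * L + 4 * K ^ 2) * h) ^ 2 := fun t ht i j => by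
    have h1 := schemeRes_sub a H αp s (X t) (X' t) (fun i => c t i • W i) (fun i => c' t i • W i)
      i j
    have hfl := hD.flux_corrector hX.side hX.mean (W := W) hW0 (fun i hi => (hW i hi).2)
      (fun i => c t i) i
    have h2 : schemeRes a H αp s (fun i => c t i • W i) (fun i => c' t i • W i) i j
        = H i / 2 * (c' t i * cellInt (s i) j (W i)) + if 2 * L * h < |a i| then
          H i / 2 * (c t i * cellInt (s i) j (Lagrange.basis Finset.univ (s i) (m i))) else 0 := by
      unfold schemeRes
      rw [hfl, hfl, map_smul, smul_eq_mul]
      congr 1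
      split_ifs
      · have h3 : polyInt (-1) (s i j.succ) (Lagrange.basis Finset.univ (s i) (m i))
            - polyInt (-1) (s i j.castSucc) (Lagrange.basis Finset.univ (s i) (m i))
            = cellInt (s i) j (Lagrange.basis Finset.univ (s i) (m i)) := by
          unfold cellInt
          simp only [polyInt_apply]
          exact intervalIntegral.integral_interval_sub_left
            ((Polynomial.continuous _).intervalIntegrable _ _)
            ((Polynomial.continuous _).intervalIntegrable _ _)
        rw [← h3]; ring
      · rw [sub_zero]
    rw [h2] at h1
    change schemeRes a H αp s (V t) (V' t) i j = _ at h1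
    have hsq : ∀ x y B : ℝ, 0 ≤ y → x ≤ y ^ 2 → ∀ R, |R| ≤ B →
        y * B ≤ ε * h * (5 * L + 4 * K ^ 2) * h →
        x * R ^ 2 ≤ (ε * h * (5 * L + 4 * K ^ 2) * h) ^ 2 := fun x y B hy hx R hR hB => by
      calc x * R ^ 2 ≤ y ^ 2 * |R| ^ 2 := by rw [sq_abs]; gcongr
        _ = (y * |R|) ^ 2 := by ring
        _ ≤ _ := by
          refine pow_le_pow_left₀ (by positivity) ?_ 2
          exact (mul_le_mul_of_nonneg_left hR hy).trans hB
    by_cases hi : 2 * L * h < |a i|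
    · have ha : 0 < |a i| := lt_of_le_of_lt (by positivity) hi
      rw [if_pos hi] at h1
      have h3 := hX.res t ht i hi j
      have h4 : |H i / 2 * (c' t i * cellInt (s i) j (W i))|
          ≤ h * (ε * (2 * K ^ 2 * h / |a i|)) := by
        have h5 := (hD.ref i).partition.mem_Icc j.castSucc
        have h6 := (hD.ref i).partition.mem_Icc j.succ
        have h7 : |cellInt (s i) j (W i)| ≤ 2 * K ^ 2 * h / |a i| * 2 := by
          refine (abs_polyInt_le (B := 2 * K ^ 2 * h / |a i|)
            ((hD.ref i).partition.1.monotone (Fin.castSucc_lt_succ).le) fun x hx => ?_).trans ?_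
          · rw [le_div_iff₀ ha, mul_comm]
            exact hWb i x ⟨h5.1.trans hx.1, hx.2.trans h6.2⟩
          · gcongr
            linarith [h5.1, h6.2]
        have h8 := hX.abs_deriv_le t ht i
        have h9 := hD.H_pos i
        have h10 := hD.H_le i
        rw [abs_mul, abs_mul, abs_of_pos (half_pos h9)]
        calc _ ≤ h / 2 * (ε * (2 * K ^ 2 * h / |a i| * 2)) := by gcongr
          _ = _ := by ring
      refine hsq _ (2 * |a i|) (ε * h * h + h * (ε * (2 * K ^ 2 * h / |a i|))) (by positivity) ?_ _
        ?_ ?_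
      · have h5 : h ≤ |a i| := by nlinarith
        have h6 : h ^ 2 ≤ |a i| ^ 2 := by gcongr
        rw [mul_pow, sq_abs] at *
        nlinarith [sq_nonneg (a i)]
      · rw [h1, add_comm, ← sub_sub]
        exact (abs_sub _ _).trans (add_le_add h3 h4)
      · have h5 := hS.abs_le i
        have h6 : 2 * |a i| * (ε * h * h + h * (ε * (2 * K ^ 2 * h / |a i|)))
            = ε * h * (2 * |a i| + 4 * K ^ 2) * h := by field_simp; ring
        rw [h6]
        gcongr
        linarith
    · rw [if_neg hi, hW0 i hi, map_zero, mul_zero, mul_zero, add_zero, sub_zero] at h1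
      rw [h1]
      refine hsq _ (3 * L * h) (ε * h) (by positivity) ?_ _ (hS.abs_res_le t ht i j) ?_
      · have h5 : |a i| ^ 2 ≤ (2 * L * h) ^ 2 := by
          have := not_lt.1 hi
          gcongr
        rw [sq_abs] at h5
        have h6 : 1 * h ^ 2 ≤ L ^ 2 * h ^ 2 := by gcongr; nlinarith
        nlinarith
      · calc 3 * L * h * (ε * h) = ε * h * (3 * L) * h := by ring
          _ ≤ _ := by gcongr; nlinarith [sq_nonneg K]
  have hT : 0 ≤ T := ht.1.trans ht.2
  have h0 : (0 : ℝ) ∈ Icc 0 T := ⟨le_rfl, hT⟩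
  have hE := hD.energy_le hk hD.isWeight (τ := T) (ε := ε * h * (5 * L + 4 * K ^ 2)) (lam := 1)
    one_pos (V := V) (V' := V') hVd
    (fun t ht i => (natDegree_sub_le _ _).trans (max_le (hS.natDegree_deriv_le t ht i)
      ((natDegree_smul_le _ _).trans (hWd i))))
    (fun t ht i => (hS.hasDeriv t ht i).sub
      (HasPolyDerivWithinAt.smul_const (hX.hasDeriv t ht i) (W i)))
    hres ht
  have hE0 : energy H (fun i => a i ^ 2 + h ^ 2) s A (V 0) ≤ 8 * π * ρ * K ^ 5 * (ε * h) ^ 2 := by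
    unfold energy
    have h1 : ∀ i, (a i ^ 2 + h ^ 2) * (H i / 2 * svForm (s i) (A i) (V 0 i) (V 0 i))
        ≤ h * (4 * K ^ 5 * (ε * h) ^ 2) := fun i => by
      obtain ⟨B, hB, hB2⟩ := hwb 0 h0 i
      have h2 : svForm (s i) (A i) (V 0 i) (V 0 i) ≤ K * B ^ 2 :=
        (hD.ref i).svForm_le _ (hVd 0 h0 i) B fun r hr => by
          have := hB r hr
          simpa [hV, hS.init] using this
      have h3 := hD.H_pos i
      have h4 := hD.H_le i
      have h5 : 0 ≤ K * B ^ 2 := by positivity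
      calc _ ≤ (a i ^ 2 + h ^ 2) * (H i / 2 * (K * B ^ 2)) := by gcongr
        _ ≤ (a i ^ 2 + h ^ 2) * (h / 2 * (K * B ^ 2)) := by gcongr
        _ = h / 2 * K * ((a i ^ 2 + h ^ 2) * B ^ 2) := by ring
        _ ≤ h / 2 * K * (8 * K ^ 4 * (ε * h) ^ 2) := by gcongr
        _ = _ := by ring
    refine (Finset.sum_le_sum fun i _ => h1 i).trans ?_
    rw [← Finset.mul_sum]
    refine (hsum _ (by positivity)).trans_eq ?_
    ring
  have hVt := hD.mul_sum_le_energy hk (β := fun i => a i ^ 2 + h ^ 2) (fun i => by positivity)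
    (hVd t ht)
  have hsplit : h * ∑ i, (a i ^ 2 + h ^ 2) * polyInt (-1) 1 (X t i ^ 2)
      ≤ 2 * (h * ∑ i, (a i ^ 2 + h ^ 2) * polyInt (-1) 1 (V t i ^ 2))
        + h * ∑ _i : Fin N, 32 * K ^ 4 * (ε * h) ^ 2 := by
    rw [mul_left_comm, ← mul_add]
    refine mul_le_mul_of_nonneg_left ?_ hh.le
    rw [Finset.mul_sum, ← Finset.sum_add_distrib]
    refine Finset.sum_le_sum fun i _ => ?_
    have h1 := polyInt_sq_add_le (V t i) (c t i • W i)
    rw [show V t i + c t i • W i = X t i by simp [hV]] at h1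
    obtain ⟨B, hB, hB2⟩ := hwb t ht i
    have h2 := polyInt_sq_le hB
    have h3 : 0 ≤ a i ^ 2 + h ^ 2 := by positivity
    calc _ ≤ (a i ^ 2 + h ^ 2) * (2 * polyInt (-1) 1 (V t i ^ 2) + 2 * (2 * B ^ 2)) := by
          gcongr; linarith
      _ = 2 * ((a i ^ 2 + h ^ 2) * polyInt (-1) 1 (V t i ^ 2))
          + 4 * ((a i ^ 2 + h ^ 2) * B ^ 2) := by
          ring
      _ ≤ _ := by linarith
  have hlast := hsum (32 * K ^ 4 * (ε * h) ^ 2) (by positivity)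
  have hE2 : energy H (fun i => a i ^ 2 + h ^ 2) s A (V t)
      ≤ Real.exp (stabConst k K L ρ (weightConst L) * (1 + 1) * T) * (8 * π * ρ * K ^ 5
    + stabConst k K L ρ (weightConst L) * (5 * L + 4 * K ^ 2) ^ 2 * T) * (ε * h) ^ 2 := by
    refine hE.trans ?_
    have ht0 := ht.1
    have ht1 := ht.2
    calc _ ≤ Real.exp (stabConst k K L ρ (weightConst L) * (1 + 1) * t) *
          (8 * π * ρ * K ^ 5 * (ε * h) ^ 2 + stabConst k K L ρ (weightConst L)
            * (ε * h * (5 * L + 4 * K ^ 2)) ^ 2 / 1 * T) := by gcongr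
      _ ≤ Real.exp (stabConst k K L ρ (weightConst L) * (1 + 1) * T) *
          (8 * π * ρ * K ^ 5 * (ε * h) ^ 2 + stabConst k K L ρ (weightConst L)
            * (ε * h * (5 * L + 4 * K ^ 2)) ^ 2 / 1 * T) := by gcongr
      _ = _ := by ring
  have hE3 := mul_le_mul_of_nonneg_left hE2 (by positivity : 0 ≤ 4 * ρ)
  unfold superConst
  nlinarith

end

section

variable {k N : ℕ}

/-! ### The space derivative of the discrete error -/

variable {K L ρ h T ε : ℝ} {a H : Fin N → ℝ} {αp s A : Fin N → Fin (k + 2) → ℝ}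
  {X X' : ℝ → Fin N → ℝ[X]}

/-- On an element with a coefficient that is not small, the scheme itself bounds the differences of
the flux of the discrete error, and thereby its derivative. -/
theorem IsErrorSystem.abs_mul_derivative_le (hS : IsErrorSystem T K L ρ h ε a H αp s A X X')
    {t : ℝ} (ht : t ∈ Icc 0 T) {i : Fin N} (hi : 2 * L * h < |a i|) {x y : ℝ}
    (hx : ∀ r ∈ Icc (-1 : ℝ) 1, |(X t i).eval r| ≤ x)
    (hy : ∀ r ∈ Icc (-1 : ℝ) 1, |(X' t i).eval r| ≤ y) {r : ℝ} (hr : r ∈ Icc (-1 : ℝ) 1) :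
    |a i| * |(derivative (X t i)).eval r| ≤ 2 * K * h * ((k + 1) * (ε + y) + 2 * L * x) := by
  have hD := hS.disc
  have hh := hD.h_pos
  have hL := hD.L_nonneg
  have hε := hS.eps_nonneg
  have hK1 := hD.one_le
  have hR := hD.ref i
  have ha : 0 < |a i| := lt_of_le_of_lt (by positivity) hi
  have hx0 : 0 ≤ x := (abs_nonneg _).trans (hx r hr)
  have hy0 : 0 ≤ y := (abs_nonneg _).trans (hy r hr)
  set G : Fin (k + 2) → ℝ := fun j => αp i j * refFlux a s (X t) i j with hG
  have hstep : ∀ j : Fin (k + 1), |G j.succ - G j.castSucc| ≤ h * (ε + y) := fun j => by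
    have h1 : G j.succ - G j.castSucc = schemeRes a H αp s (X t) (X' t) i j
        - H i / 2 * cellInt (s i) j (X' t i) := by
      unfold schemeRes; ring
    have h5 := hR.partition.mem_Icc j.castSucc
    have h6 := hR.partition.mem_Icc j.succ
    have h2 : |cellInt (s i) j (X' t i)| ≤ y * 2 := by
      refine (abs_polyInt_le (B := y) (hR.partition.1.monotone (Fin.castSucc_lt_succ).le)
        fun z hz => hy z ⟨h5.1.trans hz.1, hz.2.trans h6.2⟩).trans ?_
      gcongr
      linarith [h5.1, h6.2]
    have h3 := hD.H_pos i
    have h4 := hD.H_le i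
    rw [h1]
    refine (abs_sub _ _).trans ?_
    rw [abs_mul, abs_of_pos (half_pos h3)]
    calc _ ≤ ε * h + h / 2 * (y * 2) := by
          gcongr
          exact hS.abs_res_le t ht i j
      _ = _ := by ring
  have hdist : ∀ j l, j ≤ l → |G j - G l| ≤ (k + 1) * (h * (ε + y)) := by
    have key : ∀ (n : ℕ) (j l : Fin (k + 2)), (l : ℕ) = j + n →
        |G l - G j| ≤ n * (h * (ε + y)) := by
      intro n
      induction n with
      | zero =>
        intro j l hl
        rw [show l = j from Fin.ext (by omega)]; simp
      | succ n ih =>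
        intro j l hl
        obtain ⟨l', rfl⟩ := Fin.exists_succ_eq.2 (show l ≠ 0 from fun h => by
          rw [h] at hl; simp at hl)
        have h1 := hstep l'
        have h3 := ih j l'.castSucc (by simp at hl ⊢; omega)
        have h2 : G l'.succ - G j = (G l'.succ - G l'.castSucc) + (G l'.castSucc - G j) := by ring
        rw [h2]
        refine (abs_add_le _ _).trans ((add_le_add h1 h3).trans_eq ?_)
        push_cast
        ring
    intro j l hjl
    rw [abs_sub_comm]
    refine (key (l - j) j l (by have := Fin.le_def.1 hjl; omega)).trans ?_
    have h0 : 0 ≤ h * (ε + y) := by positivity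
    gcongr
    have : ((l : ℕ) - (j : ℕ) : ℕ) ≤ k + 1 := by omega
    exact_mod_cast this
  have hG' : ∀ j, j ≠ 0 → j ≠ Fin.last (k + 1) → G j = αp i j * (X t i).eval (s i j) :=
    fun j h0 h1 => by
      simp only [hG, refFlux, if_neg h0, if_neg h1]
  -- the outflow end `o`, where the flux uses the value from inside the element
  obtain ⟨m, o, hom, hGo, hother, hle⟩ : ∃ m o : Fin (k + 2), o ≠ m ∧
      G o = αp i o * (X t i).eval (s i o) ∧ (∀ j, j ≠ m → j ≠ o → j ≠ 0 ∧ j ≠ Fin.last (k + 1)) ∧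
      ∀ j, |G j - G o| ≤ (k + 1) * (h * (ε + y)) := by
    have hne : Fin.last (k + 1) ≠ 0 := (Fin.last_pos).ne'
    rcases lt_or_gt_of_ne (abs_pos.1 ha) with hneg | hpos
    · refine ⟨Fin.last (k + 1), 0, hne.symm, ?_, fun j h1 h2 => ⟨h2, h1⟩, fun j => by
        rw [abs_sub_comm]; exact hdist 0 j (Fin.zero_le j)⟩
      have h1 := hD.near i 0
      rw [hD.first] at h1
      rw [abs_of_neg hneg] at hi
      have h2 : ¬ 0 < a ((finRotate N).symm i) := by
        rw [_root_.abs_le] at h1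
        have : 0 ≤ L * h := by positivity
        linarith [h1.2]
      simp only [hG, refFlux, if_true, refUpwind, if_neg h2, Equiv.apply_symm_apply]
      rw [hR.partition.2.1]
    · refine ⟨0, Fin.last (k + 1), hne, ?_, fun j h1 h2 => ⟨h1, h2⟩, fun j =>
        hdist j _ (Fin.le_last j)⟩
      simp only [hG, refFlux, if_neg hne, if_true, refUpwind, if_pos hpos]
      rw [hR.partition.2.2]
  have hGj : ∀ j, j ≠ m → G j = αp i j * (X t i).eval (s i j) := fun j hj => by
    by_cases hjo : j = o
    · rw [hjo, hGo]
    · exact hG' j (hother j hj hjo).1 (hother j hj hjo).2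
  set P : ℝ[X] := X t i - C ((X t i).eval (s i o)) with hP
  have hPd : P.natDegree ≤ k := natDegree_sub_C.le.trans (hS.natDegree_le t ht i)
  have hPb : ∀ j, |P.eval (s i (m.succAbove j))|
      ≤ h * ((k + 1) * (ε + y) + 2 * L * x) / (|a i| / 2) := fun j => by
    rw [le_div_iff₀ (half_pos ha)]
    have h1 := hD.half_le_abs hi (m.succAbove j)
    have h2 : αp i (m.succAbove j) * P.eval (s i (m.succAbove j))
        = (G (m.succAbove j) - G o)
          + (αp i o - αp i (m.succAbove j)) * (X t i).eval (s i o) := by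
      rw [hGj _ (Fin.succAbove_ne m j), hGo]
      simp [hP]
      ring
    have h3 : |αp i o - αp i (m.succAbove j)| ≤ 2 * L * h := by
      have h4 := _root_.abs_le.1 (hD.near i o)
      have h5 := _root_.abs_le.1 (hD.near i (m.succAbove j))
      rw [_root_.abs_le]
      constructor <;> linarith [h4.1, h4.2, h5.1, h5.2]
    have h6 := hx _ (hR.partition.mem_Icc o)
    calc |P.eval (s i (m.succAbove j))| * (|a i| / 2)
        ≤ |P.eval (s i (m.succAbove j))| * |αp i (m.succAbove j)| := by gcongr
      _ = |αp i (m.succAbove j) * P.eval (s i (m.succAbove j))| := by rw [abs_mul, mul_comm]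
      _ ≤ (k + 1) * (h * (ε + y)) + (2 * L * h) * x := by
          rw [h2]
          refine (abs_add_le _ _).trans ?_
          rw [abs_mul]
          have := hle (m.succAbove j)
          gcongr
      _ = _ := by ring
  have hfin := (hR.lebesgue m.succAbove Fin.succAbove_right_injective P hPd _ hPb r hr).2
  rw [hP, derivative_sub, derivative_C, sub_zero] at hfin
  calc _ ≤ |a i| * (K * (h * ((k + 1) * (ε + y) + 2 * L * x) / (|a i| / 2))) := by gcongr
    _ = _ := by field_simp

theorem IsRefElement.abs_eval_le {K : ℝ} {s A : Fin (k + 2) → ℝ} (hR : IsRefElement K s A)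
    {v : ℝ[X]} (hv : v.natDegree ≤ k) {r : ℝ} (hr : r ∈ Icc (-1 : ℝ) 1) :
    |v.eval r| ≤ √(K * polyInt (-1) 1 (v ^ 2)) ∧
      |(derivative v).eval r| ≤ √(K * polyInt (-1) 1 (v ^ 2)) :=
  ⟨Real.abs_le_sqrt (hR.eval_sq_le v hv r hr).1, Real.abs_le_sqrt (hR.eval_sq_le v hv r hr).2⟩

/-- The constant in the estimate for the space derivative of the discrete error. -/
def derivConst (k : ℕ) (K L ρ : ℝ) : ℝ := 192 * ρ ^ 2 * K ^ 3 * ((k + 1) ^ 2 + 4 * L ^ 2)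

/-- The scaled space derivative, multiplied by a value `b` of the coefficient. Where the coefficient
is `O(h)`, the inverse inequality suffices. -/
theorem IsErrorSystem.sq_derivative_le (hS : IsErrorSystem T K L ρ h ε a H αp s A X X')
    {t : ℝ} (ht : t ∈ Icc 0 T) (i : Fin N) {b : ℝ} (hb : |b - a i| ≤ L * h) {r : ℝ}
    (hr : r ∈ Icc (-1 : ℝ) 1) :
    (b * (2 / H i * (derivative (X t i)).eval r)) ^ 2 ≤ derivConst k K L ρ
      * (ε ^ 2 + polyInt (-1) 1 (X t i ^ 2) + polyInt (-1) 1 (X' t i ^ 2)) := by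
  have hD := hS.disc
  have hh := hD.h_pos
  have hL := hD.L_nonneg
  have hε := hS.eps_nonneg
  have hK1 := hD.one_le
  have hρ := hD.rho_pos
  have hR := hD.ref i
  have hB := polyInt_sq_nonneg (X t i)
  have hB' := polyInt_sq_nonneg (X' t i)
  set B := polyInt (-1) 1 (X t i ^ 2)
  set B' := polyInt (-1) 1 (X' t i ^ 2)
  set x := √(K * B) with hx
  set y := √(K * B') with hy
  have hx2 : x ^ 2 = K * B := Real.sq_sqrt (by positivity)
  have hy2 : y ^ 2 = K * B' := Real.sq_sqrt (by positivity)
  have hx0 : 0 ≤ x := Real.sqrt_nonneg _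
  have hy0 : 0 ≤ y := Real.sqrt_nonneg _
  have hH : 2 / H i ≤ 2 * ρ / h := by
    rw [div_le_div_iff₀ (hD.H_pos i) hh]
    linarith [hD.le_H i]
  have hH0 : 0 ≤ 2 / H i := (div_pos two_pos (hD.H_pos i)).le
  have hba : |b| ≤ |a i| + L * h := by
    have := abs_sub_abs_le_abs_sub b (a i)
    linarith
  have key : |b * (2 / H i * (derivative (X t i)).eval r)|
      ≤ 8 * ρ * K * ((k + 1) * (ε + y) + 2 * L * x) := by
    rw [abs_mul, abs_mul, abs_of_nonneg hH0]
    by_cases hi : 2 * L * h < |a i|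
    · have h1 := hS.abs_mul_derivative_le ht hi (x := x) (y := y)
        (fun r hr => (hR.abs_eval_le (hS.natDegree_le t ht i) hr).1)
        (fun r hr => (hR.abs_eval_le (hS.natDegree_deriv_le t ht i) hr).1) hr
      have h2 : |b| ≤ 2 * |a i| := by nlinarith [mul_nonneg hL hh.le]
      calc _ ≤ (2 * |a i|) * (2 * ρ / h * |(derivative (X t i)).eval r|) := by gcongr
        _ = 4 * ρ / h * (|a i| * |(derivative (X t i)).eval r|) := by ring
        _ ≤ 4 * ρ / h * (2 * K * h * ((k + 1) * (ε + y) + 2 * L * x)) := by gcongr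
        _ = _ := by field_simp; ring
    · have h1 := (hR.abs_eval_le (hS.natDegree_le t ht i) hr).2
      calc _ ≤ (3 * L * h) * (2 * ρ / h * x) := by
            gcongr
            linarith [not_lt.1 hi]
        _ = 6 * ρ * 1 * (L * x) := by field_simp; ring
        _ ≤ 8 * ρ * K * (2 * (L * x)) := by
            have : 0 ≤ L * x := by positivity
            calc _ ≤ 8 * ρ * K * (L * x) := by gcongr; norm_num
              _ ≤ _ := mul_le_mul_of_nonneg_left (by linarith) (by positivity)
        _ ≤ _ := by
            have : 0 ≤ (k + 1) * (ε + y) := by positivity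
            gcongr
            linarith
  rw [← sq_abs]
  calc _ ≤ (8 * ρ * K * ((k + 1) * (ε + y) + 2 * L * x)) ^ 2 := by gcongr
    _ = 64 * ρ ^ 2 * K ^ 2 * ((k + 1) * ε + (k + 1) * y + 2 * L * x) ^ 2 := by ring
    _ ≤ 64 * ρ ^ 2 * K ^ 2 * (3 * (((k + 1) * ε) ^ 2 + ((k + 1) * y) ^ 2 + (2 * L * x) ^ 2)) := by
        gcongr
        nlinarith [sq_nonneg ((k + 1) * ε - (k + 1) * y), sq_nonneg ((k + 1) * y - 2 * L * x),
          sq_nonneg ((k + 1) * ε - 2 * L * x)]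
    _ = 192 * ρ ^ 2 * K ^ 2 * ((k + 1) ^ 2 * ε ^ 2 + (k + 1) ^ 2 * (K * B')
        + 4 * L ^ 2 * (K * B)) := by rw [mul_pow, mul_pow, mul_pow, hx2, hy2]; ring
    _ ≤ 192 * ρ ^ 2 * K ^ 2 * (((k + 1) ^ 2 + 4 * L ^ 2) * (K * ε ^ 2)
        + ((k + 1) ^ 2 + 4 * L ^ 2) * (K * B') + ((k + 1) ^ 2 + 4 * L ^ 2) * (K * B)) := by
        have h1 : ε ^ 2 ≤ K * ε ^ 2 := le_mul_of_one_le_left (sq_nonneg _) hK1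
        have h2 : (0 : ℝ) ≤ 4 * L ^ 2 := by positivity
        have h3 : (0 : ℝ) ≤ (k + 1) ^ 2 := by positivity
        gcongr <;> linarith
    _ = _ := by unfold derivConst; ring

end

section

variable {k : ℕ}

/-! ### Interpolation errors on the reference element -/

theorem ipol_sub (σ : Fin (k + 1) → ℝ) (φ ψ : ℝ → ℝ) :
    ipol σ (fun r => φ r - ψ r) = ipol σ φ - ipol σ ψ := by
  unfold ipol
  rw [← map_sub]
  rfl

theorem ipol_eq_of_natDegree_le {σ : Fin (k + 1) → ℝ} (hσ : Function.Injective σ) {P : ℝ[X]}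
    (hP : P.natDegree ≤ k) {φ : ℝ → ℝ} (h : ∀ j, P.eval (σ j) = φ (σ j)) : ipol σ φ = P := by
  refine (Lagrange.eq_interpolate_of_eval_eq _ hσ.injOn ?_ fun j _ => h j).symm
  rw [Finset.card_univ, Fintype.card_fin]
  refine degree_le_natDegree.trans_lt ?_
  exact_mod_cast Nat.lt_succ_of_le hP

section RefElement

variable {K B : ℝ} {s A : Fin (k + 2) → ℝ} {e : Fin (k + 1) → Fin (k + 2)}

theorem IsRefElement.injective (hR : IsRefElement K s A) (he : Function.Injective e) :
    Function.Injective fun j => s (e j) := hR.partition.1.injective.comp he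

theorem IsRefElement.abs_ipol_le (hR : IsRefElement K s A) (he : Function.Injective e)
    {φ : ℝ → ℝ} (hφ : ∀ r ∈ Icc (-1 : ℝ) 1, |φ r| ≤ B) {r : ℝ} (hr : r ∈ Icc (-1 : ℝ) 1) :
    |(ipol (fun j => s (e j)) φ).eval r| ≤ K * B ∧
      |(derivative (ipol (fun j => s (e j)) φ)).eval r| ≤ K * B :=
  hR.lebesgue e he _ (natDegree_ipol_le (hR.injective he) φ) B (fun j => by
    rw [eval_ipol (hR.injective he)]
    exact hφ _ (hR.partition.mem_Icc _)) r hr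

theorem IsRefElement.abs_sub_ipol_le_add (hR : IsRefElement K s A) (he : Function.Injective e)
    {φ : ℝ → ℝ} (hφ : ∀ r ∈ Icc (-1 : ℝ) 1, |φ r| ≤ B) {r : ℝ} (hr : r ∈ Icc (-1 : ℝ) 1) :
    |φ r - (ipol (fun j => s (e j)) φ).eval r| ≤ (1 + K) * B := by
  refine (abs_sub _ _).trans ?_
  linarith [hφ r hr, (hR.abs_ipol_le he hφ hr).1]

theorem IsRefElement.abs_sub_ipol_le (hR : IsRefElement K s A) (he : Function.Injective e)
    {φ : ℝ → ℝ} {τ : ℝ[X]} (hτ : τ.natDegree ≤ k)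
    (hφ : ∀ r ∈ Icc (-1 : ℝ) 1, |φ r - τ.eval r| ≤ B) {r : ℝ} (hr : r ∈ Icc (-1 : ℝ) 1) :
    |φ r - (ipol (fun j => s (e j)) φ).eval r| ≤ (1 + K) * B := by
  have h1 := hR.abs_sub_ipol_le_add he hφ hr
  rw [ipol_sub, ipol_eq_of_natDegree_le (hR.injective he) hτ (φ := fun r => τ.eval r)
    fun j => rfl, eval_sub] at h1
  convert h1 using 2
  ring

/-- Up to higher order terms, the interpolation error is a multiple of the Lagrange basis polynomial
of the one partition point that is not an interpolation node. -/
theorem IsRefElement.abs_sub_ipol_sub_le (hR : IsRefElement K s A) (he : Function.Injective e)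
    {m : Fin (k + 2)} (hm : ∀ l, l ≠ m → ∃ j, e j = l) {φ : ℝ → ℝ} {τ : ℝ[X]}
    (hτ : τ.natDegree ≤ k + 1) (hφ : ∀ r ∈ Icc (-1 : ℝ) 1, |φ r - τ.eval r| ≤ B) {r : ℝ}
    (hr : r ∈ Icc (-1 : ℝ) 1) :
    |φ r - (ipol (fun j => s (e j)) φ).eval r
      - (φ (s m) - (ipol (fun j => s (e j)) φ).eval (s m))
        * (Lagrange.basis Finset.univ s m).eval r| ≤ (1 + K) ^ 2 * B := by
  have hinj := hR.injective he
  have hs := hR.partition.1.injective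
  set σ : Fin (k + 1) → ℝ := fun j => s (e j) with hσ
  set Q := τ - ipol σ fun r => τ.eval r with hQ
  have hQd : Q.natDegree ≤ k + 1 := (natDegree_sub_le _ _).trans
    (max_le hτ ((natDegree_ipol_le hinj _).trans (Nat.le_succ k)))
  have hQ0 : ∀ l, l ≠ m → Q.eval (s l) = 0 := fun l hl => by
    obtain ⟨j, rfl⟩ := hm l hl
    have h1 := eval_ipol hinj (fun r => τ.eval r) j
    simp only [hσ] at h1
    rw [hQ, eval_sub, h1, sub_self]
  have hQe := eq_C_mul_basis hs m hQd hQ0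
  set d := Q.eval (s m) with hd
  have h1 : ∀ r ∈ Icc (-1 : ℝ) 1, |φ r - (ipol σ φ).eval r
      - d * (Lagrange.basis Finset.univ s m).eval r| ≤ (1 + K) * B := fun r hr => by
    have h2 := hR.abs_sub_ipol_le_add he hφ hr
    have h3 : d * (Lagrange.basis Finset.univ s m).eval r
        = τ.eval r - (ipol σ fun r => τ.eval r).eval r := by
      rw [← eval_sub, ← hQ, hQe, eval_mul, eval_C]
    rw [ipol_sub, eval_sub] at h2
    rw [h3]
    convert h2 using 2
    ring
  have h2 := h1 _ (hR.partition.mem_Icc m)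
  rw [Lagrange.eval_basis_self hs.injOn (Finset.mem_univ m), mul_one] at h2
  have h3 := h1 r hr
  have h4 := hR.abs_basis_le m r hr
  have hB : 0 ≤ (1 + K) * B := (abs_nonneg _).trans h2
  set c := φ (s m) - (ipol σ φ).eval (s m) with hc
  have h5 : φ r - (ipol σ φ).eval r - c * (Lagrange.basis Finset.univ s m).eval r
      = (φ r - (ipol σ φ).eval r - d * (Lagrange.basis Finset.univ s m).eval r)
        - (c - d) * (Lagrange.basis Finset.univ s m).eval r := by ring
  rw [h5]
  refine (abs_sub _ _).trans ?_
  rw [abs_mul]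
  calc _ ≤ (1 + K) * B + ((1 + K) * B) * K := by gcongr
    _ = _ := by ring

/-- At the roots of the derivative of the nodal polynomial, the derivative of the interpolation
polynomial is of one order better than elsewhere. -/
theorem IsRefElement.abs_sub_derivative_ipol_le (hR : IsRefElement K s A)
    (he : Function.Injective e) {φ : ℝ → ℝ} {τ : ℝ[X]} (hτ : τ.natDegree ≤ k + 1)
    (hφ : ∀ r ∈ Icc (-1 : ℝ) 1, |φ r - τ.eval r| ≤ B) {r d : ℝ} (hr : r ∈ Icc (-1 : ℝ) 1)
    (hd : |d - (derivative τ).eval r| ≤ B)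
    (hr0 : (derivative (Lagrange.nodal Finset.univ fun j => s (e j))).eval r = 0) :
    |d - (derivative (ipol (fun j => s (e j)) φ)).eval r| ≤ (1 + K) * B := by
  have hinj := hR.injective he
  set σ : Fin (k + 1) → ℝ := fun j => s (e j) with hσ
  set Q := τ - ipol σ fun r => τ.eval r with hQ
  have hQd : Q.natDegree ≤ k + 1 := (natDegree_sub_le _ _).trans
    (max_le hτ ((natDegree_ipol_le hinj _).trans (Nat.le_succ k)))
  have hQe := eq_C_mul_nodal (J := Finset.univ) hinj.injOn (P := Q) (by simpa using hQd)
    (fun j _ => by rw [hQ, eval_sub, eval_ipol hinj, sub_self])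
  have h1 := (hR.abs_ipol_le he hφ hr).2
  have h2 : (derivative Q).eval r = 0 := by
    rw [hQe, derivative_C_mul, eval_C_mul, hr0, mul_zero]
  rw [ipol_sub, derivative_sub, eval_sub] at h1
  rw [hQ, derivative_sub, eval_sub] at h2
  have h3 : d - (derivative (ipol σ φ)).eval r = (d - (derivative τ).eval r)
      - ((derivative (ipol σ φ)).eval r - (derivative (ipol σ fun r => τ.eval r)).eval r) := by
    linarith
  rw [h3]
  refine (abs_sub _ _).trans ?_
  linarith

end RefElement

/-- The roots of the derivative of a nodal polynomial lie strictly between the outer nodes: outside,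
all the terms of the derivative have the same sign. -/
theorem mem_Ioo_of_derivative_nodal {a b : ℝ} {σ : Fin (k + 1) → ℝ} (hσ : Function.Injective σ)
    (hI : ∀ j, σ j ∈ Icc a b) {r : ℝ}
    (hr : (derivative (Lagrange.nodal Finset.univ σ)).eval r = 0) : r ∈ Ioo a b := by
  have key : ∀ ε : ℝ, (∀ j, 0 ≤ ε * (r - σ j)) → ε ≠ 0 → False := fun ε hε hε0 => by
    rw [Lagrange.derivative_nodal, eval_finsetSum] at hr
    simp only [Lagrange.eval_nodal] at hr
    have h1 : ∑ i, ∏ j ∈ Finset.univ.erase i, ε * (r - σ j) = 0 := by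
      simp only [Finset.prod_mul_distrib, Finset.prod_const, Finset.card_erase_of_mem,
        Finset.mem_univ]
      rw [← Finset.mul_sum, hr, mul_zero]
    rw [Finset.sum_eq_zero_iff_of_nonneg fun i _ => Finset.prod_nonneg fun j _ => hε j] at h1
    -- at most one node equals `r`; the term that omits it does not vanish
    obtain ⟨i, hi⟩ : ∃ i, ∀ j, j ≠ i → r ≠ σ j := by
      by_cases h : ∃ i, r = σ i
      · obtain ⟨i, hi⟩ := h
        exact ⟨i, fun j hj hrj => hj (hσ (hrj.symm.trans hi))⟩
      · push Not at h
        exact ⟨0, fun j _ => h j⟩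
    obtain ⟨j, hj, hj0⟩ := Finset.prod_eq_zero_iff.1 (h1 i (Finset.mem_univ i))
    exact (mul_ne_zero hε0 (sub_ne_zero.2 (hi j (Finset.ne_of_mem_erase hj)))) hj0
  constructor
  · by_contra h
    exact key (-1) (fun j => by nlinarith [(hI j).1]) (by norm_num)
  · by_contra h
    exact key 1 (fun j => by nlinarith [(hI j).2]) one_ne_zero

end

section

variable {k N : ℕ}

/-! ### Meshes with spectral volume points as discretizations -/

theorem Mesh.abs_sub_right_le {α : ℝ → ℝ} {L : ℝ} (hα : Reg 0 L α) (M : Mesh N) (i : Fin N) {r : ℝ}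
    (hr : r ∈ Icc (-1 : ℝ) 1) : |α (M.point i r) - α (M.right i)| ≤ L * M.size := by
  have h1 : (1 : ℝ) ∈ Icc (-1 : ℝ) 1 := by norm_num
  have h2 := hα.lipschitz (M.point_mem i hr) (M.point_mem i h1)
  rw [M.point_one] at h2
  refine h2.trans ?_
  have h3 := M.abs_point_sub_le i hr h1
  rw [M.point_one] at h3
  have := hα.nonneg
  gcongr

theorem Mesh.abs_left_sub_right_le {α : ℝ → ℝ} {L : ℝ} (hα : Reg 0 L α) (M : Mesh N) (i : Fin N) :
    |α (M.left i) - α (M.right i)| ≤ L * M.size := by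
  have h := M.abs_sub_right_le hα i (r := -1) (by norm_num)
  rwa [M.point_neg_one] at h

theorem Mesh.ShapeRegular.pos {M : Mesh N} {ρ : ℝ} (h : M.ShapeRegular ρ) : 0 < ρ := by
  have h1 := h ⟨0, M.pos⟩
  have h2 := M.len_pos ⟨0, M.pos⟩
  exact (pos_iff_pos_of_mul_pos (M.size_pos.trans_le h1)).2 h2

section Discretization

variable {α : ℝ → ℝ} {M : Mesh N} {s A : Fin N → Fin (k + 2) → ℝ} {K L ρ : ℝ}

theorem pt_zero (hs : ∀ i, IsRefPartition (s i)) (i : Fin N) : pt M s i 0 = M.left i := by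
  rw [pt, (hs i).2.1, M.point_neg_one]

theorem pt_last (hs : ∀ i, IsRefPartition (s i)) (i : Fin N) :
    pt M s i (Fin.last (k + 1)) = M.right i := by
  rw [pt, (hs i).2.2, M.point_one]

theorem apply_left {f : ℝ → ℝ} (hf : f 0 = f (2 * π)) (i : Fin N) :
    f (M.left i) = f (M.right ((finRotate N).symm i)) := by
  have h := M.apply_left_next hf ((finRotate N).symm i)
  rwa [Equiv.apply_symm_apply] at h

/-- The upwind direction matters only at the end points that carry a quadrature weight. -/
theorem isDiscretization_of_ref (hα : Reg 0 L α) (hper : α 0 = α (2 * π)) (hρ : M.ShapeRegular ρ)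
    (href : ∀ i, IsRefElement K (s i) (A i))
    (hright : ∀ i, A i (Fin.last (k + 1)) ≠ 0 → α (M.right i) ≤ 0 →
      |α (M.right i)| ≤ L * M.size)
    (hleft : ∀ i, A i 0 ≠ 0 → 0 < α (M.left i) → |α (M.left i)| ≤ L * M.size) :
    IsDiscretization K L ρ M.size (fun i => α (M.right i)) M.len (fun i j => α (pt M s i j))
      s A where
  ref := href
  h_pos := M.size_pos
  L_nonneg := hα.nonneg
  rho_pos := hρ.pos
  H_le := M.len_le_size
  le_H := hρ
  sum_H := M.sum_len
  first i := by rw [pt_zero fun i => (href i).partition, apply_left hper]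
  last i := by rw [pt_last fun i => (href i).partition]
  near i j := M.abs_sub_right_le hα i ((href i).partition.mem_Icc j)
  right := hright
  left i := by rw [← apply_left hper]; exact hleft i

/-- Both methods use quadrature rules whose weights at the end points vanish, unless the flux at
that end point is taken from inside the element or the coefficient is small there. -/
theorem exists_isDiscretization (hK : ∀ s : Fin (k + 2) → ℝ,
      (IsGaussPartition s → ∃ A, IsRefElement K s A ∧ A 0 = 0 ∧ A (Fin.last (k + 1)) = 0) ∧
      (IsRightRadauPartition s → ∃ A, IsRefElement K s A ∧ A 0 = 0) ∧
      (IsLeftRadauPartition s → ∃ A, IsRefElement K s A ∧ A (Fin.last (k + 1)) = 0))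
    (hα : Reg 0 L α) (hper : α 0 = α (2 * π)) (hρ : M.ShapeRegular ρ)
    (hs : IsRSV α M s ∨ IsLSV s) : ∃ A, IsDiscretization K L ρ M.size (fun i => α (M.right i)) M.len
      (fun i j => α (pt M s i j)) s A := by
  suffices h : ∀ i, ∃ A, IsRefElement K (s i) A ∧
      (A (Fin.last (k + 1)) ≠ 0 → α (M.right i) ≤ 0 → |α (M.right i)| ≤ L * M.size) ∧
      (A 0 ≠ 0 → 0 < α (M.left i) → |α (M.left i)| ≤ L * M.size) by
    choose A h1 h2 h3 using h
    exact ⟨A, isDiscretization_of_ref hα hper hρ h1 h2 h3⟩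
  intro i
  have hLip := abs_le.1 (M.abs_left_sub_right_le hα i)
  have hLh : 0 ≤ L * M.size := mul_nonneg hα.nonneg M.size_pos.le
  rcases hs with hs | hs
  · obtain ⟨h1, h2, h3⟩ := hs i
    by_cases hneg : α (M.left i) < 0 ∧ α (M.right i) < 0
    · obtain ⟨A, hA, hA0⟩ := (hK (s i)).2.2 (h2 hneg.1 hneg.2)
      exact ⟨A, hA, fun h => absurd hA0 h, fun _ h => absurd hneg.1 h.not_gt⟩
    by_cases hpos : 0 < α (M.left i) ∧ 0 < α (M.right i)
    · obtain ⟨A, hA, hA0⟩ := (hK (s i)).2.1 (h1 hpos.1 hpos.2)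
      exact ⟨A, hA, fun _ h => absurd hpos.2 h.not_gt, fun h => absurd hA0 h⟩
    rcases h3 with h3 | h3
    · obtain ⟨A, hA, hA0⟩ := (hK (s i)).2.1 h3
      refine ⟨A, hA, fun _ h => ?_, fun h => absurd hA0 h⟩
      rw [abs_of_nonpos h]
      rcases h.eq_or_lt with h0 | h0
      · rw [h0, neg_zero]; exact hLh
      · have : 0 ≤ α (M.left i) := not_lt.1 fun h4 => hneg ⟨h4, h0⟩
        linarith [hLip.2]
    · obtain ⟨A, hA, hA0⟩ := (hK (s i)).2.2 h3
      refine ⟨A, hA, fun h => absurd hA0 h, fun _ h => ?_⟩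
      rw [abs_of_pos h]
      have : α (M.right i) ≤ 0 := not_lt.1 fun h4 => hpos ⟨h, h4⟩
      linarith [hLip.2]
  · obtain ⟨A, hA, hA0, hA1⟩ := (hK (s i)).1 (hs i)
    exact ⟨A, hA, fun h => absurd hA1 h, fun h => absurd hA0 h⟩

end Discretization

/-! ### The interpolation operator in reference coordinates -/

/-- The indices of the partition points that serve as interpolation nodes. -/
def nodeIdx (α : ℝ → ℝ) (M : Mesh N) (i : Fin N) (j : Fin (k + 1)) : Fin (k + 2) :=
  if 0 ≤ α (M.left i) ∧ 0 < α (M.right i) then j.succ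
  else if α (M.left i) ≤ 0 ∧ α (M.right i) < 0 then j.castSucc
  else if j = Fin.last k then Fin.last (k + 1) else j.castSucc

theorem interpNode_eq (α : ℝ → ℝ) (M : Mesh N) (s : Fin N → Fin (k + 2) → ℝ) (i : Fin N)
    (j : Fin (k + 1)) : interpNode α M s i j = pt M s i (nodeIdx α M i j) := by
  unfold interpNode nodeIdx
  split_ifs <;> rfl

theorem nodeIdx_injective (α : ℝ → ℝ) (M : Mesh N) (i : Fin N) :
    Function.Injective (nodeIdx (k := k) α M i) := by
  intro j l hjl
  unfold nodeIdx at hjl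
  split_ifs at hjl with h1 h2 h3 h4 h4
  · exact Fin.succ_injective _ hjl
  · exact Fin.castSucc_injective _ hjl
  · rw [h3, h4]
  · exact absurd hjl.symm (Fin.castSucc_lt_last l).ne
  · exact absurd hjl (Fin.castSucc_lt_last j).ne
  · exact Fin.castSucc_injective _ hjl

/-- The interpolation `I_h φ` on the `i`-th element, in reference coordinates. -/
def refInterp (α : ℝ → ℝ) (M : Mesh N) (s : Fin N → Fin (k + 2) → ℝ) (φ : ℝ → ℝ) (i : Fin N) :
    ℝ[X] :=
  ipol (fun j => s i (nodeIdx α M i j)) fun r => φ (M.point i r)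

/-- The interpolation error on the `i`-th element, in reference coordinates. -/
def interpErr (α : ℝ → ℝ) (M : Mesh N) (s : Fin N → Fin (k + 2) → ℝ) (φ : ℝ → ℝ) (i : Fin N)
    (r : ℝ) : ℝ :=
  φ (M.point i r) - (refInterp α M s φ i).eval r

/-- The error of the numerical flux of the interpolation at the point `x_{i,j}`. -/
def fluxErr (α : ℝ → ℝ) (M : Mesh N) (s : Fin N → Fin (k + 2) → ℝ) (φ : ℝ → ℝ) (i : Fin N)
    (j : Fin (k + 2)) : ℝ :=
  α (pt M s i j) * (φ (pt M s i j)
    - refFlux (fun i => α (M.right i)) s (refInterp α M s φ) i j)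

/-- The integral of the interpolation error over a control volume. -/
def cellErr (α : ℝ → ℝ) (M : Mesh N) (s : Fin N → Fin (k + 2) → ℝ) (φ : ℝ → ℝ) (i : Fin N)
    (j : Fin (k + 1)) : ℝ :=
  (∫ x in pt M s i j.castSucc..pt M s i j.succ, φ x)
    - M.len i / 2 * cellInt (s i) j (refInterp α M s φ i)

section Interpolation

variable {α : ℝ → ℝ} {M : Mesh N} {s : Fin N → Fin (k + 2) → ℝ}

theorem injective_node (hs : ∀ i, IsRefPartition (s i)) (i : Fin N) :
    Function.Injective fun j : Fin (k + 1) => s i (nodeIdx α M i j) :=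
  (hs i).1.injective.comp (nodeIdx_injective α M i)

theorem natDegree_refInterp_le (hs : ∀ i, IsRefPartition (s i)) (φ : ℝ → ℝ) (i : Fin N) :
    (refInterp α M s φ i).natDegree ≤ k :=
  natDegree_ipol_le (injective_node hs i) _

theorem eval_refInterp (hs : ∀ i, IsRefPartition (s i)) (φ : ℝ → ℝ) (i : Fin N)
    (j : Fin (k + 1)) :
    (refInterp α M s φ i).eval (s i (nodeIdx α M i j)) = φ (pt M s i (nodeIdx α M i j)) :=
  eval_ipol (injective_node hs i) _ j

theorem refPoly_interp (hs : ∀ i, IsRefPartition (s i)) (φ : ℝ → ℝ) (i : Fin N) :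
    M.refPoly i (interp α M s φ i) = refInterp α M s φ i := by
  have hinj : Function.Injective (interpNode α M s i) := fun j l h => by
    rw [interpNode_eq, interpNode_eq] at h
    exact injective_node hs i (M.point_injective i h)
  have hdeg : (interp α M s φ i).natDegree ≤ k := natDegree_ipol_le hinj φ
  refine (ipol_eq_of_natDegree_le (injective_node hs i) (M.natDegree_refPoly_le i hdeg)
    fun j => ?_).symm
  have h1 := eval_ipol hinj φ j
  rw [Mesh.eval_refPoly]
  rw [interpNode_eq] at h1
  exact h1

theorem refInterp_sub (φ ψ : ℝ → ℝ) (i : Fin N) :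
    refInterp α M s (fun x => φ x - ψ x) i = refInterp α M s φ i - refInterp α M s ψ i :=
  ipol_sub _ _ _

theorem fluxErr_sub (φ ψ : ℝ → ℝ) (i : Fin N) (j : Fin (k + 2)) :
    fluxErr α M s (fun x => φ x - ψ x) i j = fluxErr α M s φ i j - fluxErr α M s ψ i j := by
  unfold fluxErr
  rw [show refInterp α M s (fun x => φ x - ψ x)
    = fun i => refInterp α M s φ i - refInterp α M s ψ i from funext (refInterp_sub φ ψ),
    refFlux_sub]
  ring

theorem intervalIntegrable_pt (hs : ∀ i, IsRefPartition (s i)) {φ : ℝ → ℝ}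
    (hφ : ContinuousOn φ (Icc 0 (2 * π))) (i : Fin N) (j l : Fin (k + 2)) :
    IntervalIntegrable φ volume (pt M s i j) (pt M s i l) :=
  (hφ.mono (uIcc_subset_Icc (M.point_mem i ((hs i).mem_Icc j))
    (M.point_mem i ((hs i).mem_Icc l)))).intervalIntegrable

theorem cellErr_sub (hs : ∀ i, IsRefPartition (s i)) {φ ψ : ℝ → ℝ}
    (hφ : ContinuousOn φ (Icc 0 (2 * π))) (hψ : ContinuousOn ψ (Icc 0 (2 * π))) (i : Fin N)
    (j : Fin (k + 1)) :
    cellErr α M s (fun x => φ x - ψ x) i j = cellErr α M s φ i j - cellErr α M s ψ i j := by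
  unfold cellErr
  rw [refInterp_sub, map_sub, intervalIntegral.integral_sub (intervalIntegrable_pt hs hφ _ _ _)
    (intervalIntegrable_pt hs hψ _ _ _)]
  ring

theorem continuousOn_interpErr {φ : ℝ → ℝ} (hφ : ContinuousOn φ (Icc 0 (2 * π))) (i : Fin N) :
    ContinuousOn (interpErr α M s φ i) (Icc (-1) 1) := by
  have h1 : Continuous (M.point i) := by unfold Mesh.point; fun_prop
  exact (hφ.comp h1.continuousOn fun r hr => M.point_mem i hr).sub
    (Polynomial.continuous _).continuousOn

theorem cellErr_eq (hs : ∀ i, IsRefPartition (s i)) {φ : ℝ → ℝ}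
    (hφ : ContinuousOn φ (Icc 0 (2 * π))) (i : Fin N) (j : Fin (k + 1)) :
    cellErr α M s φ i j
      = M.len i / 2 * ∫ r in s i j.castSucc..s i j.succ, interpErr α M s φ i r := by
  have h1 : Continuous (M.point i) := by unfold Mesh.point; fun_prop
  have h2 : IntervalIntegrable (fun r => φ (M.point i r)) volume (s i j.castSucc) (s i j.succ) :=
    (hφ.comp h1.continuousOn fun r hr => M.point_mem i
      (uIcc_subset_Icc ((hs i).mem_Icc _) ((hs i).mem_Icc _) hr)).intervalIntegrable
  unfold cellErr interpErr pt
  rw [intervalIntegral.integral_sub h2 ((Polynomial.continuous _).intervalIntegrable _ _),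
    M.integral_point, cellInt, polyInt_apply]
  ring

theorem abs_cell_integral_le (hs : ∀ i, IsRefPartition (s i)) {f : ℝ → ℝ} {E : ℝ} (hE : 0 ≤ E)
    (i : Fin N) (j : Fin (k + 1)) (hf : ∀ r ∈ Icc (-1 : ℝ) 1, |f r| ≤ E) :
    |M.len i / 2 * ∫ r in s i j.castSucc..s i j.succ, f r| ≤ E * M.size := by
  have h1 := (hs i).mem_Icc j.castSucc
  have h2 := (hs i).mem_Icc j.succ
  have h3 : s i j.castSucc ≤ s i j.succ := (hs i).1.monotone Fin.castSucc_lt_succ.le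
  have h4 : |∫ r in s i j.castSucc..s i j.succ, f r| ≤ E * 2 := by
    refine (intervalIntegral.norm_integral_le_of_norm_le_const (C := E) (f := f)
      (a := s i j.castSucc) (b := s i j.succ) fun r hr => ?_).trans ?_
    · rw [uIoc_of_le h3] at hr
      exact hf r ⟨h1.1.trans hr.1.le, hr.2.trans h2.2⟩
    · rw [abs_of_nonneg (sub_nonneg.2 h3)]
      gcongr
      linarith [h1.1, h2.2]
  have h5 := M.len_pos i
  have h6 := M.len_le_size i
  have h7 := M.size_pos
  rw [abs_mul, abs_of_pos (half_pos h5)]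
  calc _ ≤ M.size / 2 * (E * 2) := by gcongr
    _ = _ := by ring

theorem abs_cellErr_le (hs : ∀ i, IsRefPartition (s i)) {φ : ℝ → ℝ}
    (hφ : ContinuousOn φ (Icc 0 (2 * π))) {E : ℝ} (hE : 0 ≤ E) (i : Fin N) (j : Fin (k + 1))
    (hb : ∀ r ∈ Icc (-1 : ℝ) 1, |interpErr α M s φ i r| ≤ E) :
    |cellErr α M s φ i j| ≤ E * M.size := by
  rw [cellErr_eq hs hφ]
  exact abs_cell_integral_le hs hE i j hb

/-- The interpolation is exact at every interface on the side from which the flux is taken. -/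
theorem mul_refUpwind_refInterp (hk : 1 ≤ k) (hper : α 0 = α (2 * π))
    (hs : ∀ i, IsRefPartition (s i)) {φ : ℝ → ℝ} (hφ : φ 0 = φ (2 * π)) (i : Fin N) :
    α (M.right i) * refUpwind (fun i => α (M.right i)) (refInterp α M s φ) i
      = α (M.right i) * φ (M.right i) := by
  unfold refUpwind
  simp only
  split_ifs with hpos
  · obtain ⟨j, hj⟩ : ∃ j, nodeIdx (k := k) α M i j = Fin.last (k + 1) := by
      refine ⟨Fin.last k, ?_⟩
      unfold nodeIdx
      split_ifs with h1 h2
      · exact Fin.succ_last k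
      · exact absurd hpos h2.2.not_gt
      · rfl
      · exact absurd rfl ‹_›
    have h1 := eval_refInterp (α := α) (M := M) hs φ i j
    rw [hj, pt_last hs, (hs i).2.2] at h1
    rw [h1]
  · rcases (not_lt.1 hpos).eq_or_lt with h0 | hneg
    · rw [h0, zero_mul, zero_mul]
    · have hl : α (M.left (finRotate N i)) < 0 := by rwa [M.apply_left_next hper]
      have hj : nodeIdx (k := k) α M (finRotate N i) 0 = 0 := by
        unfold nodeIdx
        split_ifs with h1 h2 h3
        · exact absurd hl h1.1.not_gt
        · rfl
        · exact absurd h3 (by simp [Fin.ext_iff]; omega)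
        · rfl
      have h1 := eval_refInterp (α := α) (M := M) hs φ (finRotate N i) 0
      rw [hj, pt_zero hs, (hs _).2.1, M.apply_left_next hφ] at h1
      rw [h1]

theorem fluxErr_of_node (hs : ∀ i, IsRefPartition (s i)) (φ : ℝ → ℝ) (i : Fin N)
    {j : Fin (k + 2)} (h0 : j ≠ 0) (h1 : j ≠ Fin.last (k + 1))
    (hj : ∃ l, nodeIdx α M i l = j) : fluxErr α M s φ i j = 0 := by
  obtain ⟨l, hl⟩ := hj
  have h2 := eval_refInterp (α := α) (M := M) hs φ i l
  rw [hl] at h2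
  rw [fluxErr, refFlux, if_neg h0, if_neg h1, h2, sub_self, mul_zero]

/-- The flux of the interpolant is exact at the ends of the elements. -/
theorem fluxErr_ends (hk : 1 ≤ k) (hper : α 0 = α (2 * π)) (hs : ∀ i, IsRefPartition (s i))
    {φ : ℝ → ℝ} (hφ : φ 0 = φ (2 * π)) (i : Fin N) {j : Fin (k + 2)}
    (hj : j = 0 ∨ j = Fin.last (k + 1)) : fluxErr α M s φ i j = 0 := by
  have hne : Fin.last (k + 1) ≠ 0 := (Fin.last_pos).ne'
  rcases hj with rfl | rfl
  · have h1 := mul_refUpwind_refInterp (M := M) hk hper hs hφ ((finRotate N).symm i)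
    rw [fluxErr, refFlux, if_pos rfl, pt_zero hs, apply_left hper, apply_left hφ, mul_sub, h1,
      sub_self]
  · have h1 := mul_refUpwind_refInterp (M := M) hk hper hs hφ i
    rw [fluxErr, refFlux, if_neg hne, if_pos rfl, pt_last hs, mul_sub, h1, sub_self]

/-- A partition point in the interior of an element is an interpolation node, or the coefficient
changes sign or vanishes in the element and is therefore of size `O(h)`. -/
theorem exists_nodeIdx_or {L : ℝ} (hα : Reg 0 L α) (hs : ∀ i, IsRefPartition (s i)) (i : Fin N)
    {j : Fin (k + 2)} (h0 : j ≠ 0) (h1 : j ≠ Fin.last (k + 1)) :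
    (∃ l, nodeIdx α M i l = j) ∨ |α (pt M s i j)| ≤ L * M.size := by
  by_cases hc1 : 0 ≤ α (M.left i) ∧ 0 < α (M.right i)
  · obtain ⟨l, rfl⟩ := Fin.exists_succ_eq.2 h0
    exact Or.inl ⟨l, if_pos hc1⟩
  by_cases hc2 : α (M.left i) ≤ 0 ∧ α (M.right i) < 0
  · obtain ⟨l, rfl⟩ := Fin.exists_castSucc_eq.2 h1
    exact Or.inl ⟨l, by rw [nodeIdx, if_neg hc1, if_pos hc2]⟩
  · right
    have hm := (hs i).mem_Icc j
    have h2 := abs_le.1 (M.abs_sub_right_le hα i hm)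
    have h_1 : (-1 : ℝ) ∈ Icc (-1 : ℝ) 1 := by norm_num
    have h3 := hα.lipschitz (M.point_mem i hm) (M.point_mem i h_1)
    have h4 := M.abs_point_sub_le i hm h_1
    rw [M.point_neg_one] at h3 h4
    have h5 := abs_le.1 (h3.trans (mul_le_mul_of_nonneg_left h4 hα.nonneg))
    unfold pt
    rw [abs_le]
    rcases lt_trichotomy (α (M.right i)) 0 with h | h | h
    · have : 0 < α (M.left i) := not_le.1 fun h' => hc2 ⟨h', h⟩
      constructor <;> linarith [h2.1, h2.2, h5.1, h5.2]
    · constructor <;> linarith [h2.1, h2.2, h5.1, h5.2]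
    · have : α (M.left i) < 0 := not_le.1 fun h' => hc1 ⟨h', h⟩
      constructor <;> linarith [h2.1, h2.2, h5.1, h5.2]

/-- Where the interpolation error does not vanish in the flux, the factor `α` contributes a power of
the mesh size. -/
theorem abs_fluxErr_le (hk : 1 ≤ k) {L : ℝ} (hα : Reg 0 L α) (hper : α 0 = α (2 * π))
    (hs : ∀ i, IsRefPartition (s i)) {φ : ℝ → ℝ} (hφ : φ 0 = φ (2 * π)) {E : ℝ} (hE : 0 ≤ E)
    (i : Fin N) (hb : ∀ r ∈ Icc (-1 : ℝ) 1, |interpErr α M s φ i r| ≤ E) (j : Fin (k + 2)) :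
    |fluxErr α M s φ i j| ≤ L * E * M.size := by
  have hL := hα.nonneg
  have hh := M.size_pos
  by_cases hj : j = 0 ∨ j = Fin.last (k + 1)
  · rw [fluxErr_ends hk hper hs hφ i hj, abs_zero]; positivity
  · push Not at hj
    rcases exists_nodeIdx_or hα hs i hj.1 hj.2 with h1 | h1
    · rw [fluxErr_of_node hs φ i hj.1 hj.2 h1, abs_zero]; positivity
    · rw [fluxErr, refFlux, if_neg hj.1, if_neg hj.2, abs_mul]
      have h2 := hb _ ((hs i).mem_Icc j)
      calc _ ≤ (L * M.size) * E := by
            gcongr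
            exact h2
        _ = _ := by ring

/-- The inflow end point of an element. It is the one partition point that is not an interpolation
node, if the coefficient is not small on the element. -/
def inflowIdx (k : ℕ) (α : ℝ → ℝ) (M : Mesh N) (i : Fin N) : Fin (k + 2) :=
  if 0 < α (M.right i) then 0 else Fin.last (k + 1)

theorem exists_nodeIdx {L : ℝ} (hα : Reg 0 L α) {i : Fin N}
    (hi : 2 * L * M.size < |α (M.right i)|) {j : Fin (k + 2)} (hj : j ≠ inflowIdx k α M i) :
    ∃ l, nodeIdx α M i l = j := by
  have h1 := abs_le.1 (M.abs_left_sub_right_le hα i)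
  have hLh : 0 ≤ L * M.size := mul_nonneg hα.nonneg M.size_pos.le
  unfold inflowIdx at hj
  split_ifs at hj with hpos
  · rw [abs_of_pos hpos] at hi
    obtain ⟨l, rfl⟩ := Fin.exists_succ_eq.2 hj
    exact ⟨l, if_pos ⟨by linarith [h1.1], hpos⟩⟩
  · rw [abs_of_nonpos (not_lt.1 hpos)] at hi
    obtain ⟨l, rfl⟩ := Fin.exists_castSucc_eq.2 hj
    exact ⟨l, by rw [nodeIdx, if_neg fun h => hpos h.2,
      if_pos ⟨by linarith [h1.2], by linarith⟩]⟩

theorem inflowIdx_side {L : ℝ} (hL : 0 ≤ L) {i : Fin N} (hi : 2 * L * M.size < |α (M.right i)|) :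
    (0 < α (M.right i) ∧ inflowIdx k α M i = 0) ∨
      (α (M.right i) < 0 ∧ inflowIdx k α M i = Fin.last (k + 1)) := by
  have hLh : 0 ≤ 2 * L * M.size := mul_nonneg (by positivity) M.size_pos.le
  unfold inflowIdx
  split_ifs with hpos
  · exact Or.inl ⟨hpos, rfl⟩
  · rw [abs_of_nonpos (not_lt.1 hpos)] at hi
    exact Or.inr ⟨by linarith, rfl⟩

/-- Where `α` is not small, all the partition points but the inflow end are interpolation nodes, so
that the interpolant has the exact flux. -/
theorem fluxErr_eq_zero (hk : 1 ≤ k) {L : ℝ} (hα : Reg 0 L α) (hper : α 0 = α (2 * π))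
    (hs : ∀ i, IsRefPartition (s i)) {φ : ℝ → ℝ} (hφ : φ 0 = φ (2 * π)) {i : Fin N}
    (hi : 2 * L * M.size < |α (M.right i)|) (j : Fin (k + 2)) : fluxErr α M s φ i j = 0 := by
  by_cases hj : j = 0 ∨ j = Fin.last (k + 1)
  · exact fluxErr_ends hk hper hs hφ i hj
  · push Not at hj
    refine fluxErr_of_node hs φ i hj.1 hj.2 (exists_nodeIdx hα hi ?_)
    rcases inflowIdx_side (k := k) hα.nonneg hi with h | h
    · rw [h.2]; exact hj.1
    · rw [h.2]; exact hj.2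

/-! ### Interpolation estimates -/

variable {K : ℝ} {A : Fin N → Fin (k + 2) → ℝ}

theorem Reg.abs_interpErr_le {Ks : ℝ} {φ : ℝ → ℝ} (hφ : Reg k Ks φ)
    {i : Fin N} (hR : IsRefElement K (s i) (A i)) {r : ℝ} (hr : r ∈ Icc (-1 : ℝ) 1) :
    |interpErr α M s φ i r| ≤ (1 + K) * (Ks * M.size ^ (k + 1)) := by
  have h0 : (0 : ℝ) ∈ Icc (-1 : ℝ) 1 := by norm_num
  obtain ⟨τ, hτ, hb⟩ := hφ.exists_taylor (M.point_mem i h0)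
  refine hR.abs_sub_ipol_le (φ := fun r => φ (M.point i r)) (nodeIdx_injective α M i)
    (M.natDegree_refPoly_le i hτ) (fun r hr => ?_) hr
  rw [Mesh.eval_refPoly]
  refine (hb _ (M.point_mem i hr)).trans ?_
  have := hφ.nonneg
  have := M.abs_point_sub_le i hr h0
  gcongr

theorem Reg.abs_interpErr_sub_le {L Ks : ℝ} {φ : ℝ → ℝ} (hφ : Reg (k + 1) Ks φ) (hα : Reg 0 L α)
    {i : Fin N} (hi : 2 * L * M.size < |α (M.right i)|) (hR : IsRefElement K (s i) (A i)) {r : ℝ}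
    (hr : r ∈ Icc (-1 : ℝ) 1) :
    |interpErr α M s φ i r - interpErr α M s φ i (s i (inflowIdx k α M i))
      * (Lagrange.basis Finset.univ (s i) (inflowIdx k α M i)).eval r|
      ≤ (1 + K) ^ 2 * (Ks * M.size ^ (k + 2)) := by
  have h0 : (0 : ℝ) ∈ Icc (-1 : ℝ) 1 := by norm_num
  obtain ⟨τ, hτ, hb⟩ := hφ.exists_taylor (M.point_mem i h0)
  refine hR.abs_sub_ipol_sub_le (φ := fun r => φ (M.point i r)) (nodeIdx_injective α M i)
    (fun l hl => exists_nodeIdx hα hi hl) (M.natDegree_refPoly_le i hτ) (fun r hr => ?_) hr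
  rw [Mesh.eval_refPoly]
  refine (hb _ (M.point_mem i hr)).trans ?_
  have := hφ.nonneg
  have := M.abs_point_sub_le i hr h0
  gcongr

end Interpolation

end

section

variable {k N : ℕ}

/-! ### The error system of the spectral volume method -/

section Time

variable {α : ℝ → ℝ} {M : Mesh N} {s : Fin N → Fin (k + 2) → ℝ}

theorem hasPolyDerivWithinAt_refInterp (hs : ∀ i, IsRefPartition (s i)) {φ : ℝ → ℝ → ℝ}
    {φ' : ℝ → ℝ} {S : Set ℝ} {t : ℝ}
    (h : ∀ x ∈ Icc 0 (2 * π), HasDerivWithinAt (fun τ => φ τ x) (φ' x) S t) (i : Fin N) :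
    HasPolyDerivWithinAt (fun τ => refInterp α M s (φ τ) i) (refInterp α M s φ' i) S t := by
  unfold refInterp ipol
  simp only [Lagrange.interpolate_apply, ← smul_eq_C_mul]
  exact HasPolyDerivWithinAt.sum _ fun j _ =>
    HasPolyDerivWithinAt.smul_const (h _ (M.point_mem i ((hs i).mem_Icc _))) _

theorem hasDerivWithinAt_interpErr (hs : ∀ i, IsRefPartition (s i)) {φ : ℝ → ℝ → ℝ}
    {φ' : ℝ → ℝ} {S : Set ℝ} {t : ℝ}
    (h : ∀ x ∈ Icc 0 (2 * π), HasDerivWithinAt (fun τ => φ τ x) (φ' x) S t) (i : Fin N) {r : ℝ}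
    (hr : r ∈ Icc (-1 : ℝ) 1) :
    HasDerivWithinAt (fun τ => interpErr α M s (φ τ) i r) (interpErr α M s φ' i r) S t :=
  (h _ (M.point_mem i hr)).sub (hasPolyDerivWithinAt_refInterp hs h i (leval r))

theorem interpErr_sub (φ ψ : ℝ → ℝ) (i : Fin N) (r : ℝ) :
    interpErr α M s (fun x => φ x - ψ x) i r = interpErr α M s φ i r - interpErr α M s ψ i r := by
  unfold interpErr
  rw [refInterp_sub, eval_sub]
  ring

end Time

theorem refFlux_refPoly (α : ℝ → ℝ) (M : Mesh N) (s : Fin N → Fin (k + 2) → ℝ) (v : Fin N → ℝ[X])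
    (i : Fin N) (j : Fin (k + 2)) :
    refFlux (fun i => α (M.right i)) s (fun i => M.refPoly i (v i)) i j = numFlux α M s v i j := by
  simp only [refFlux, numFlux, refUpwind, upwind, Mesh.eval_refPoly, Mesh.point_one,
    Mesh.point_neg_one, pt]

/-- A derivative in time of a spectral volume solution has the degree of the solution. -/
theorem natDegree_le_of_hasDerivWithinAt {V : ℝ → ℝ[X]} {V' : ℝ[X]} {T t : ℝ} (hT : 0 < T)
    (ht : t ∈ Icc 0 T) (hV : ∀ t ∈ Icc 0 T, (V t).natDegree ≤ k)
    (h : ∀ m, HasDerivWithinAt (fun τ => (V τ).coeff m) (V'.coeff m) (Icc 0 T) t) :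
    V'.natDegree ≤ k := by
  refine natDegree_le_iff_coeff_eq_zero.2 fun m hm => ?_
  have h0 : ∀ τ ∈ Icc 0 T, (V τ).coeff m = 0 := fun τ hτ =>
    coeff_eq_zero_of_natDegree_lt ((hV τ hτ).trans_lt hm)
  have h1 : HasDerivWithinAt (fun τ => (V τ).coeff m) 0 (Icc 0 T) t :=
    (hasDerivWithinAt_const t (Icc 0 T) (0 : ℝ)).congr h0 (h0 t ht)
  exact (uniqueDiffOn_Icc hT t ht).eq_deriv _ (h m) h1

section ErrorSystem

variable {α : ℝ → ℝ} {g u p q : ℝ → ℝ → ℝ} {T K L ρ Ks : ℝ} {M : Mesh N}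
  {s A : Fin N → Fin (k + 2) → ℝ} {U Ut : ℝ → Fin N → ℝ[X]}

/-- The discrete error in reference coordinates. -/
def refErr (α : ℝ → ℝ) (M : Mesh N) (s : Fin N → Fin (k + 2) → ℝ) (φ : ℝ → ℝ) (v : Fin N → ℝ[X])
    (i : Fin N) : ℝ[X] :=
  M.refPoly i (v i) - refInterp α M s φ i

/-- The residual of the discrete error is the consistency error of the interpolation. -/
theorem schemeRes_refErr (hs : ∀ i, IsRefPartition (s i)) (hu : IsSmoothSol k α g T Ks u p q)
    {t : ℝ} (ht : t ∈ Icc 0 T) (i : Fin N) (j : Fin (k + 1)) {v v' : Fin N → ℝ[X]}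
    (hv : (∫ x in (pt M s i j.castSucc)..(pt M s i j.succ), (v' i).eval x)
        + α (pt M s i j.succ) * numFlux α M s v i j.succ
        - α (pt M s i j.castSucc) * numFlux α M s v i j.castSucc
      = ∫ x in (pt M s i j.castSucc)..(pt M s i j.succ), g t x) :
    schemeRes (fun i => α (M.right i)) M.len (fun i j => α (pt M s i j)) s
        (refErr α M s (u t) v) (refErr α M s (p t) v') i j
      = cellErr α M s (p t) i j
        + (fluxErr α M s (u t) i j.succ - fluxErr α M s (u t) i j.castSucc) := by
  have h1 := hu.balance t ht (pt M s i j.castSucc) (M.point_mem i ((hs i).mem_Icc _))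
    (pt M s i j.succ) (M.point_mem i ((hs i).mem_Icc _))
    (M.point_mono i ((hs i).1.monotone Fin.castSucc_lt_succ.le))
  have h2 := schemeRes_sub (fun i => α (M.right i)) M.len (fun i j => α (pt M s i j)) s
    (fun i => M.refPoly i (v i)) (fun i => M.refPoly i (v' i)) (refInterp α M s (u t))
    (refInterp α M s (p t)) i j
  refine h2.trans ?_
  rw [M.integral_pt_eq_cellInt] at hv
  unfold schemeRes cellErr fluxErr
  rw [refFlux_refPoly, refFlux_refPoly]
  linarith

/-- The size of the interpolation errors of functions with derivatives bounded by `Ks`, with the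
constants of all the estimates in which it enters. -/
def interpSize (k : ℕ) (K L Ks h : ℝ) : ℝ := (1 + 2 * L) * (1 + K) ^ 2 * (Ks * h ^ (k + 1))

/-- The residual of the discrete error consists of interpolation errors of `u_t` and of the flux. It
is Lipschitz continuous in time because `u_tt` has the regularity for the same estimate. -/
theorem isErrorSystem (hk : 1 ≤ k) (hT : 0 < T) (hα : Reg 0 L α) (hL : 1 ≤ L)
    (hper : α 0 = α (2 * π)) (hD : IsDiscretization K L ρ M.size (fun i => α (M.right i)) M.len
      (fun i j => α (pt M s i j)) s A) (hu : IsSmoothSol k α g T Ks u p q)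
    (hU : ∀ t ∈ Icc 0 T, ∀ i, (U t i).natDegree ≤ k)
    (hU0 : ∀ i, U 0 i = interp α M s (u 0) i)
    (hUt : ∀ t ∈ Icc 0 T, ∀ i m, HasDerivWithinAt (fun τ => (U τ i).coeff m) ((Ut t i).coeff m)
      (Icc 0 T) t)
    (hcons : ∀ t ∈ Icc 0 T, ∀ (i : Fin N) (j : Fin (k + 1)),
      (∫ x in (pt M s i j.castSucc)..(pt M s i j.succ), (Ut t i).eval x)
        + α (pt M s i j.succ) * numFlux α M s (U t) i j.succ
        - α (pt M s i j.castSucc) * numFlux α M s (U t) i j.castSucc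
      = ∫ x in (pt M s i j.castSucc)..(pt M s i j.succ), g t x) :
    IsErrorSystem T K L ρ M.size (interpSize k K L Ks M.size) (fun i => α (M.right i)) M.len
      (fun i j => α (pt M s i j)) s A (fun t => refErr α M s (u t) (U t))
      (fun t => refErr α M s (p t) (Ut t)) := by
  have hs : ∀ i, IsRefPartition (s i) := fun i => (hD.ref i).partition
  have hK := hD.one_le
  have hh := M.size_pos
  have hKs : 0 ≤ Ks := (hu.reg_u 0 ⟨le_rfl, hT.le⟩).nonneg
  set E := (1 + K) * (Ks * M.size ^ (k + 1)) with hE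
  have hE0 : 0 ≤ E := by positivity
  have hEε : (1 + 2 * L) * E ≤ interpSize k K L Ks M.size := by
    unfold interpSize
    rw [hE, mul_assoc]
    have : 1 + K ≤ (1 + K) ^ 2 := by nlinarith
    gcongr
  have hdeg : ∀ t ∈ Icc 0 T, ∀ i, (Ut t i).natDegree ≤ k := fun t ht i =>
    natDegree_le_of_hasDerivWithinAt hT ht (fun t ht => hU t ht i) (hUt t ht i)
  have hpu : ∀ t ∈ Icc 0 T, ∀ i, ∀ r ∈ Icc (-1 : ℝ) 1, |interpErr α M s (u t) i r| ≤ E :=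
    fun t ht i r hr => ((hu.reg_u t ht).of_le (by omega)).abs_interpErr_le (hD.ref i) hr
  have hpp : ∀ t ∈ Icc 0 T, ∀ i, ∀ r ∈ Icc (-1 : ℝ) 1, |interpErr α M s (p t) i r| ≤ E :=
    fun t ht i r hr => ((hu.reg_p t ht).of_le (by omega)).abs_interpErr_le (hD.ref i) hr
  have hpq : ∀ t ∈ Icc 0 T, ∀ i, ∀ r ∈ Icc (-1 : ℝ) 1, |interpErr α M s (q t) i r| ≤ E :=
    fun t ht i r hr => (hu.reg_q t ht).abs_interpErr_le (hD.ref i) hr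
  -- the residual of an exact pair of functions of size `B`
  have hres : ∀ (φ ψ : ℝ → ℝ) (B : ℝ), 0 ≤ B → φ 0 = φ (2 * π) → ContinuousOn ψ (Icc 0 (2 * π)) →
      (∀ i, ∀ r ∈ Icc (-1 : ℝ) 1, |interpErr α M s φ i r| ≤ B) →
      (∀ i, ∀ r ∈ Icc (-1 : ℝ) 1, |interpErr α M s ψ i r| ≤ B) → ∀ i (j : Fin (k + 1)),
      |cellErr α M s ψ i j + (fluxErr α M s φ i j.succ - fluxErr α M s φ i j.castSucc)|
        ≤ (1 + 2 * L) * B * M.size := fun φ ψ B hB hφ hψ hbφ hbψ i j => by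
    have h1 := abs_cellErr_le (α := α) hs hψ hB i j (hbψ i)
    have h2 := abs_fluxErr_le hk hα hper hs hφ hB i (hbφ i) j.succ
    have h3 := abs_fluxErr_le hk hα hper hs hφ hB i (hbφ i) j.castSucc
    refine (abs_add_le _ _).trans ?_
    have h4 := abs_sub (fluxErr α M s φ i j.succ) (fluxErr α M s φ i j.castSucc)
    linarith
  have hlip : ∀ (f f' : ℝ → ℝ → ℝ), (∀ t ∈ Icc 0 T, ∀ x ∈ Icc 0 (2 * π),
      HasDerivWithinAt (fun τ => f τ x) (f' t x) (Icc 0 T) t) →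
      (∀ t ∈ Icc 0 T, ∀ i, ∀ r ∈ Icc (-1 : ℝ) 1, |interpErr α M s (f' t) i r| ≤ E) →
      ∀ t₁ ∈ Icc 0 T, ∀ t₂ ∈ Icc 0 T, ∀ i, ∀ r ∈ Icc (-1 : ℝ) 1,
      |interpErr α M s (fun x => f t₂ x - f t₁ x) i r| ≤ E * |t₂ - t₁| :=
    fun f f' hf hb t₁ ht₁ t₂ ht₂ i r hr => by
      rw [interpErr_sub]
      exact abs_sub_le_of_hasDerivWithinAt (f := fun t => interpErr α M s (f t) i r)
        (f' := fun t => interpErr α M s (f' t) i r) (convex_Icc 0 T)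
        (fun t ht => hasDerivWithinAt_interpErr hs (hf t ht) i hr) (fun t ht => hb t ht i r hr)
        ht₂ ht₁
  refine ⟨hD, hL, fun i => hα.abs_le (M.right_mem i), ?_, fun t ht i => ?_, fun t ht i => ?_,
    fun t ht i => ?_, fun i => ?_, fun t ht i j => ?_, fun t₁ ht₁ t₂ ht₂ i j => ?_⟩
  · exact (by positivity : 0 ≤ (1 + 2 * L) * E).trans hEε
  · exact (natDegree_sub_le _ _).trans (max_le (M.natDegree_refPoly_le i (hU t ht i))
      (natDegree_refInterp_le hs _ i))
  · exact (natDegree_sub_le _ _).trans (max_le (M.natDegree_refPoly_le i (hdeg t ht i))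
      (natDegree_refInterp_le hs _ i))
  · exact ((HasPolyDerivWithinAt.of_coeff (fun t ht => hU t ht i) (hdeg t ht i) ht
      (hUt t ht i)).map (M.refPoly i)).sub
      (hasPolyDerivWithinAt_refInterp hs (hu.deriv_u t ht) i)
  · simp only [refErr]
    rw [hU0, refPoly_interp hs, sub_self]
  · rw [schemeRes_refErr hs hu ht i j (hcons t ht i j)]
    refine (hres (u t) (p t) E hE0 (hu.periodic t ht) (hu.reg_p t ht).continuousOn (hpu t ht)
      (hpp t ht) i j).trans ?_
    gcongr
  · rw [schemeRes_refErr hs hu ht₁ i j (hcons t₁ ht₁ i j),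
      schemeRes_refErr hs hu ht₂ i j (hcons t₂ ht₂ i j)]
    have h1 := hres (fun x => u t₂ x - u t₁ x) (fun x => p t₂ x - p t₁ x) (E * |t₂ - t₁|)
      (by positivity) (by simp only [hu.periodic t₁ ht₁, hu.periodic t₂ ht₂])
      ((hu.reg_p t₂ ht₂).continuousOn.sub (hu.reg_p t₁ ht₁).continuousOn)
      (hlip u p hu.deriv_u hpp t₁ ht₁ t₂ ht₂) (hlip p q hu.deriv_p hpq t₁ ht₁ t₂ ht₂) i j
    rw [cellErr_sub hs (hu.reg_p t₂ ht₂).continuousOn (hu.reg_p t₁ ht₁).continuousOn,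
      fluxErr_sub, fluxErr_sub] at h1
    refine le_trans (le_of_eq ?_) (h1.trans ?_)
    · congr 1; ring
    · calc _ = (1 + 2 * L) * E * M.size * |t₂ - t₁| := by ring
        _ ≤ _ := by gcongr

/-- Where `α` is not small, the method determines the family of points, and the Lagrange basis
polynomial of the inflow end has mean value zero. -/
theorem polyInt_basis_inflow (hk : 1 ≤ k) (hα : Reg 0 L α)
    (hsv : IsRSV α M s ∨ (IsLSV s ∧ 2 ≤ k)) {i : Fin N}
    (hi : 2 * L * M.size < |α (M.right i)|) :
    polyInt (-1) 1 (Lagrange.basis Finset.univ (s i) (inflowIdx k α M i)) = 0 := by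
  have h1 := abs_le.1 (M.abs_left_sub_right_le hα i)
  have hLh : 0 ≤ L * M.size := mul_nonneg hα.nonneg M.size_pos.le
  rcases hsv with hsv | ⟨hsv, hk2⟩
  · rcases inflowIdx_side (k := k) hα.nonneg hi with ⟨hpos, hm⟩ | ⟨hneg, hm⟩
    · rw [abs_of_pos hpos] at hi
      rw [hm]
      exact IsRightRadauPartition.polyInt_basis hk ((hsv i).1 (by linarith [h1.1]) hpos)
    · rw [abs_of_neg hneg] at hi
      rw [hm]
      exact IsLeftRadauPartition.polyInt_basis hk ((hsv i).2.1 (by linarith [h1.2]) hneg)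
  · exact IsGaussPartition.polyInt_basis hk2 (hsv i) _
      ((inflowIdx_side (k := k) hα.nonneg hi).imp And.right And.right)

/-- Where `α` is not small, the residual is the interpolation error of `u_t` alone, whose leading
part is a multiple of the Lagrange basis polynomial of the inflow end. -/
theorem hasLeadingResidual (hk : 1 ≤ k) (hT : 0 < T) (hα : Reg 0 L α)
    (hper : α 0 = α (2 * π)) (hD : IsDiscretization K L ρ M.size (fun i => α (M.right i)) M.len
      (fun i j => α (pt M s i j)) s A) (hu : IsSmoothSol k α g T Ks u p q)
    (hsv : IsRSV α M s ∨ (IsLSV s ∧ 2 ≤ k))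
    (hcons : ∀ t ∈ Icc 0 T, ∀ (i : Fin N) (j : Fin (k + 1)),
      (∫ x in (pt M s i j.castSucc)..(pt M s i j.succ), (Ut t i).eval x)
        + α (pt M s i j.succ) * numFlux α M s (U t) i j.succ
        - α (pt M s i j.castSucc) * numFlux α M s (U t) i j.castSucc
      = ∫ x in (pt M s i j.castSucc)..(pt M s i j.succ), g t x) :
    HasLeadingResidual T L M.size (interpSize k K L Ks M.size) (fun i => α (M.right i)) M.len
      (fun i j => α (pt M s i j)) s (inflowIdx k α M)
      (fun t i => interpErr α M s (p t) i (s i (inflowIdx k α M i)))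
      (fun t i => interpErr α M s (q t) i (s i (inflowIdx k α M i)))
      (fun t => refErr α M s (u t) (U t)) (fun t => refErr α M s (p t) (Ut t)) := by
  have hs : ∀ i, IsRefPartition (s i) := fun i => (hD.ref i).partition
  have hK := hD.one_le
  have hL := hα.nonneg
  have hh := M.size_pos
  have hKs : 0 ≤ Ks := (hu.reg_u 0 ⟨le_rfl, hT.le⟩).nonneg
  have hE1 : (1 + K) ^ 2 * (Ks * M.size ^ (k + 1)) ≤ interpSize k K L Ks M.size := by
    unfold interpSize
    rw [mul_assoc]
    exact le_mul_of_one_le_left (by positivity) (by linarith)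
  have hE : (1 + K) * (Ks * M.size ^ (k + 1)) ≤ interpSize k K L Ks M.size := by
    refine le_trans ?_ hE1
    have : 1 + K ≤ (1 + K) ^ 2 := by nlinarith
    gcongr
  refine ⟨fun i hi => inflowIdx_side hL hi, fun i hi => polyInt_basis_inflow hk hα hsv hi,
    fun t ht i => hasDerivWithinAt_interpErr hs (hu.deriv_p t ht) i ((hs i).mem_Icc _),
    fun t ht i => (((hu.reg_p t ht).of_le (by omega)).abs_interpErr_le (hD.ref i)
      ((hs i).mem_Icc _)).trans hE,
    fun t ht i => ((hu.reg_q t ht).abs_interpErr_le (hD.ref i) ((hs i).mem_Icc _)).trans hE,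
    fun t ht i hi j => ?_⟩
  have hcont := (hu.reg_p t ht).continuousOn
  have hint : IntervalIntegrable (interpErr α M s (p t) i) volume (s i j.castSucc) (s i j.succ) :=
    ((continuousOn_interpErr hcont i).mono (uIcc_subset_Icc ((hs i).mem_Icc _)
      ((hs i).mem_Icc _))).intervalIntegrable
  rw [schemeRes_refErr hs hu ht i j (hcons t ht i j),
    fluxErr_eq_zero hk hα hper hs (hu.periodic t ht) hi,
    fluxErr_eq_zero hk hα hper hs (hu.periodic t ht) hi, sub_zero, add_zero, cellErr_eq hs hcont,
    cellInt, polyInt_apply, ← mul_sub, ← intervalIntegral.integral_const_mul,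
    ← intervalIntegral.integral_sub hint
      (((Polynomial.continuous _).const_mul _).intervalIntegrable _ _)]
  have hb := abs_cell_integral_le (M := M) hs
    (E := (1 + K) ^ 2 * (Ks * M.size ^ (k + 2))) (by positivity) i j
    fun r hr => (hu.reg_p t ht).abs_interpErr_sub_le hα hi (hD.ref i) hr
  refine hb.trans (mul_le_mul_of_nonneg_right ?_ hh.le)
  calc _ = (1 + K) ^ 2 * (Ks * M.size ^ (k + 1)) * M.size := by ring
    _ ≤ _ := by gcongr

end ErrorSystem

end

section

variable {k N : ℕ}

/-! ### The error norms -/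

section Norms

variable {α : ℝ → ℝ} {K L ρ : ℝ} {M : Mesh N} {s A : Fin N → Fin (k + 2) → ℝ}

/-- The square of the norm with the weights `α² + h²` on the elements. -/
def weightedSq (α : ℝ → ℝ) (M : Mesh N) (X : Fin N → ℝ[X]) : ℝ :=
  M.size * ∑ i, (α (M.right i) ^ 2 + M.size ^ 2) * polyInt (-1) 1 (X i ^ 2)

theorem Mesh.mean_le (M : Mesh N) {f : Fin N → ℝ} (hf : ∀ i, 0 ≤ f i) :
    1 / N * ∑ i, f i ≤ M.size * ∑ i, f i := by
  have h1 := M.two_pi_le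
  have hN : (0 : ℝ) < N := Nat.cast_pos.2 M.pos
  refine mul_le_mul_of_nonneg_right ?_ (Finset.sum_nonneg fun i _ => hf i)
  rw [div_le_iff₀ hN, mul_comm]
  linarith [pi_gt_three]

theorem Mesh.mean_const (M : Mesh N) (c : ℝ) : 1 / N * ∑ _i : Fin N, c = c := by
  have hN : (N : ℝ) ≠ 0 := Nat.cast_ne_zero.2 M.pos.ne'
  simp only [Finset.sum_const, Finset.card_univ, Fintype.card_fin, nsmul_eq_mul]
  field_simp

theorem sq_coef_le (hα : Reg 0 L α) (hL : 1 ≤ L) (i : Fin N) {r : ℝ} (hr : r ∈ Icc (-1 : ℝ) 1) :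
    α (M.point i r) ^ 2 ≤ 2 * L ^ 2 * (α (M.right i) ^ 2 + M.size ^ 2) := by
  have h1 := M.abs_sub_right_le hα i hr
  have h2 : (α (M.point i r) - α (M.right i)) ^ 2 ≤ (L * M.size) ^ 2 := by
    rw [← sq_abs]; gcongr
  have h3 : 1 * α (M.right i) ^ 2 ≤ L ^ 2 * α (M.right i) ^ 2 := by gcongr; nlinarith
  nlinarith [sq_nonneg (α (M.point i r) - 2 * α (M.right i))]

theorem sq_coef_mul_eval_le (hα : Reg 0 L α) (hL : 1 ≤ L) {i : Fin N}
    (hR : IsRefElement K (s i) (A i)) {P : ℝ[X]} (hP : P.natDegree ≤ k) {r : ℝ}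
    (hr : r ∈ Icc (-1 : ℝ) 1) : (α (M.point i r) * P.eval r) ^ 2
      ≤ 2 * L ^ 2 * K * ((α (M.right i) ^ 2 + M.size ^ 2) * polyInt (-1) 1 (P ^ 2)) := by
  have h1 := sq_coef_le (M := M) hα hL i hr
  have h2 := (hR.eval_sq_le P hP r hr).1
  rw [mul_pow]
  calc _ ≤ (2 * L ^ 2 * (α (M.right i) ^ 2 + M.size ^ 2)) * (K * polyInt (-1) 1 (P ^ 2)) := by
        gcongr
    _ = _ := by ring

theorem eval_refErr (hs : ∀ i, IsRefPartition (s i)) (w : ℝ → ℝ) (v : Fin N → ℝ[X]) (i : Fin N)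
    (r : ℝ) : (refErr α M s w v i).eval r
      = (v i).eval (M.point i r) - (interp α M s w i).eval (M.point i r) := by
  rw [refErr, ← refPoly_interp hs, eval_sub, Mesh.eval_refPoly, Mesh.eval_refPoly]

theorem natDegree_refErr_le (hs : ∀ i, IsRefPartition (s i)) (w : ℝ → ℝ) {v : Fin N → ℝ[X]}
    (hv : ∀ i, (v i).natDegree ≤ k) (i : Fin N) : (refErr α M s w v i).natDegree ≤ k :=
  (natDegree_sub_le _ _).trans (max_le (M.natDegree_refPoly_le i (hv i))
    (natDegree_refInterp_le hs _ i))

theorem weighted_term_nonneg (α : ℝ → ℝ) (M : Mesh N) (X : Fin N → ℝ[X]) (i : Fin N) :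
    0 ≤ (α (M.right i) ^ 2 + M.size ^ 2) * polyInt (-1) 1 (X i ^ 2) :=
  mul_nonneg (by positivity) (polyInt_sq_nonneg _)

theorem abs_integral_ref_le {f : ℝ → ℝ} {B : ℝ} (h : ∀ r ∈ Icc (-1 : ℝ) 1, |f r| ≤ B) :
    |∫ r in (-1 : ℝ)..1, f r| ≤ 2 * B := by
  have h1 := intervalIntegral.norm_integral_le_of_norm_le_const (a := (-1 : ℝ)) (b := 1) (f := f)
    (C := B) fun r hr => by
      rw [uIoc_of_le (by norm_num)] at hr
      exact h r ⟨hr.1.le, hr.2⟩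
  rw [Real.norm_eq_abs] at h1
  refine h1.trans_eq ?_
  norm_num
  ring

/-- On each element `α²` is at most a multiple of the weight `α² + h²`. -/
theorem errFlux_le (hα : Reg 0 L α) (hL : 1 ≤ L) (href : ∀ i, IsRefElement K (s i) (A i))
    (w : ℝ → ℝ) {v : Fin N → ℝ[X]} (hv : ∀ i, (v i).natDegree ≤ k) :
    errFlux α M s w v ≤ √(2 * L ^ 2 * K * weightedSq α M (refErr α M s w v)) := by
  have hs : ∀ i, IsRefPartition (s i) := fun i => (href i).partition
  have hX := natDegree_refErr_le (α := α) (M := M) hs w hv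
  refine Real.sqrt_le_sqrt ?_
  have h1 : ∀ i, ∫ x in (M.left i)..(M.right i),
      (α x * (v i).eval x - α x * (interp α M s w i).eval x) ^ 2
      ≤ M.size * (2 * L ^ 2 * K * ((α (M.right i) ^ 2 + M.size ^ 2)
        * polyInt (-1) 1 (refErr α M s w v i ^ 2))) := fun i => by
    have h2 := M.integral_point i
      (fun x => (α x * (v i).eval x - α x * (interp α M s w i).eval x) ^ 2) (-1) 1
    rw [M.point_neg_one, M.point_one] at h2
    rw [h2]
    set E := 2 * L ^ 2 * K * ((α (M.right i) ^ 2 + M.size ^ 2)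
        * polyInt (-1) 1 (refErr α M s w v i ^ 2)) with hE
    have h3 := abs_integral_ref_le (B := E) (f := fun r => (α (M.point i r)
        * (v i).eval (M.point i r) - α (M.point i r) * (interp α M s w i).eval (M.point i r)) ^ 2)
      fun r hr => by
        rw [abs_of_nonneg (sq_nonneg _), ← mul_sub, ← eval_refErr hs]
        exact sq_coef_mul_eval_le (M := M) hα hL (href i) (hX i) hr
    have h5 := (le_abs_self _).trans h3
    have h6 := M.len_pos i
    have h7 := M.len_le_size i
    have hE0 : 0 ≤ E := by
      have := (href i).one_le
      have := weighted_term_nonneg α M (refErr α M s w v) i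
      positivity
    calc _ ≤ M.len i / 2 * (2 * E) := by gcongr
      _ = M.len i * E := by ring
      _ ≤ _ := by gcongr
  refine (Finset.sum_le_sum fun i _ => h1 i).trans_eq ?_
  rw [weightedSq, ← Finset.mul_sum, ← Finset.mul_sum]
  ring

/-- At the interpolation nodes `u` coincides with its interpolant. -/
theorem errNode_le (hα : Reg 0 L α) (hL : 1 ≤ L) (href : ∀ i, IsRefElement K (s i) (A i))
    (w : ℝ → ℝ) {v : Fin N → ℝ[X]} (hv : ∀ i, (v i).natDegree ≤ k) :
    errNode α M s w v ≤ √((k + 1) * (2 * L ^ 2 * K) * weightedSq α M (refErr α M s w v)) := by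
  have hs : ∀ i, IsRefPartition (s i) := fun i => (href i).partition
  have hX := natDegree_refErr_le (α := α) (M := M) hs w hv
  refine Real.sqrt_le_sqrt ?_
  refine (M.mean_le fun i => Finset.sum_nonneg fun j _ => sq_nonneg _).trans ?_
  rw [weightedSq, mul_left_comm]
  refine mul_le_mul_of_nonneg_left ?_ M.size_pos.le
  rw [Finset.mul_sum]
  refine Finset.sum_le_sum fun i _ => ?_
  have h1 : ∀ j : Fin (k + 1), (α (interpNode α M s i j) * w (interpNode α M s i j)
      - α (interpNode α M s i j) * (v i).eval (interpNode α M s i j)) ^ 2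
      ≤ 2 * L ^ 2 * K * ((α (M.right i) ^ 2 + M.size ^ 2)
        * polyInt (-1) 1 (refErr α M s w v i ^ 2)) := fun j => by
    have h2 := sq_coef_mul_eval_le (M := M) hα hL (href i) (hX i)
      ((hs i).mem_Icc (nodeIdx α M i j))
    have h3 := eval_refInterp (α := α) (M := M) hs w i j
    rw [refErr, eval_sub, h3, Mesh.eval_refPoly] at h2
    rw [interpNode_eq]
    refine le_of_eq_of_le ?_ h2
    unfold pt
    ring
  refine (Finset.sum_le_sum fun j _ => h1 j).trans_eq ?_
  simp only [Finset.sum_const, Finset.card_univ, Fintype.card_fin, nsmul_eq_mul]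
  push_cast
  ring

/-- The interpolant has the exact upwind flux at the interfaces, so that only the discrete error
contributes. -/
theorem errDownwind_le (hk : 1 ≤ k) (hper : α 0 = α (2 * π))
    (hD : IsDiscretization K L ρ M.size (fun i => α (M.right i)) M.len (fun i j => α (pt M s i j))
      s A) {w : ℝ → ℝ} (hw : w 0 = w (2 * π)) {v : Fin N → ℝ[X]}
    (hv : ∀ i, (v i).natDegree ≤ k) :
    errDownwind α M w v
      ≤ √(K * (1 + weightConst L) * weightedSq α M (refErr α M s w v)) := by
  have hs : ∀ i, IsRefPartition (s i) := fun i => (hD.ref i).partition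
  have hX := natDegree_refErr_le (α := α) (M := M) hs w hv
  have hK := hD.one_le
  refine Real.sqrt_le_sqrt ?_
  refine (M.mean_le fun i => sq_nonneg _).trans ?_
  rw [weightedSq, mul_left_comm]
  refine mul_le_mul_of_nonneg_left ?_ M.size_pos.le
  set D : Fin N → ℝ := fun i => (α (M.right i) ^ 2 + M.size ^ 2)
    * polyInt (-1) 1 (refErr α M s w v i ^ 2) with hDdef
  have hD0 : ∀ i, 0 ≤ D i := weighted_term_nonneg α M _
  have hW := weightConst_nonneg hD.L_nonneg
  have h1 : ∀ i, (α (M.right i) * w (M.right i) - α (M.right i) * upwind α M v i) ^ 2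
      ≤ K * (D i + weightConst L * D (finRotate N i)) := fun i => by
    have h2 := mul_refUpwind_refInterp (M := M) hk hper hs hw i
    have h3 : upwind α M v i
        = refUpwind (fun i => α (M.right i)) (fun i => M.refPoly i (v i)) i := by
      simp only [refUpwind, upwind, Mesh.eval_refPoly, Mesh.point_one, Mesh.point_neg_one]
    have h4 := refUpwind_sub (fun i => α (M.right i)) (fun i => M.refPoly i (v i))
      (refInterp α M s w) i
    change refUpwind _ (refErr α M s w v) i = _ at h4
    have h5 : (α (M.right i) * w (M.right i) - α (M.right i) * upwind α M v i) ^ 2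
        = α (M.right i) ^ 2 * refUpwind (fun i => α (M.right i)) (refErr α M s w v) i ^ 2 := by
      rw [h4, ← h2, h3]; ring
    rw [h5]
    have h6 : α (M.right i) ^ 2 ≤ α (M.right i) ^ 2 + M.size ^ 2 := by
      linarith [sq_nonneg M.size]
    unfold refUpwind
    split_ifs
    · have h7 := ((hD.ref i).eval_sq_le _ (hX i) 1 (by norm_num)).1
      calc _ ≤ (α (M.right i) ^ 2 + M.size ^ 2)
            * (K * polyInt (-1) 1 (refErr α M s w v i ^ 2)) := by
            gcongr
        _ = K * (D i + 0) := by simp only [hDdef]; ring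
        _ ≤ _ := by
            have := mul_nonneg hW (hD0 (finRotate N i))
            gcongr
    · have h7 := ((hD.ref (finRotate N i)).eval_sq_le _ (hX (finRotate N i)) (-1) (by norm_num)).1
      have h8 := hD.isWeight.le_next i
      have h9 := polyInt_sq_nonneg (refErr α M s w v (finRotate N i))
      calc _ ≤ (weightConst L * (α (M.right (finRotate N i)) ^ 2 + M.size ^ 2))
            * (K * polyInt (-1) 1 (refErr α M s w v (finRotate N i) ^ 2)) := by
            gcongr
            exact h6.trans h8
        _ = K * (0 + weightConst L * D (finRotate N i)) := by simp only [hDdef]; ring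
        _ ≤ _ := by
            have := hD0 i
            gcongr
  refine (Finset.sum_le_sum fun i _ => h1 i).trans_eq ?_
  rw [← Finset.mul_sum, Finset.sum_add_distrib, ← Finset.mul_sum,
    Equiv.sum_comp (finRotate N) D]
  ring

end Norms

end

section

variable {k N : ℕ}

/-! ### Cell averages and derivatives -/

section Norms

variable {α : ℝ → ℝ} {K L ρ : ℝ} {M : Mesh N} {s A : Fin N → Fin (k + 2) → ℝ}

/-- The contribution of the interpolation error to the cell averages of the flux: on elements with a
coefficient that is not small its leading part has mean value zero. -/
theorem abs_integral_coef_mul_interpErr_le (hα : Reg 0 L α) (href : ∀ i, IsRefElement K (s i) (A i))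
    (hmean : ∀ i, 2 * L * M.size < |α (M.right i)| →
      polyInt (-1) 1 (Lagrange.basis Finset.univ (s i) (inflowIdx k α M i)) = 0)
    {φ : ℝ → ℝ} (hφ : ContinuousOn φ (Icc 0 (2 * π))) {ε : ℝ} (i : Fin N)
    (hb : ∀ r ∈ Icc (-1 : ℝ) 1, |interpErr α M s φ i r| ≤ ε)
    (hb' : 2 * L * M.size < |α (M.right i)| → ∀ r ∈ Icc (-1 : ℝ) 1,
      |interpErr α M s φ i r - interpErr α M s φ i (s i (inflowIdx k α M i))
      * (Lagrange.basis Finset.univ (s i) (inflowIdx k α M i)).eval r| ≤ ε * M.size) :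
    |∫ r in (-1 : ℝ)..1, α (M.point i r) * interpErr α M s φ i r|
      ≤ 2 * ((3 * L * (1 + K)) * (ε * M.size)) := by
  have hL := hα.nonneg
  have hh := M.size_pos
  have hK := (href i).one_le
  have hε : 0 ≤ ε := (abs_nonneg _).trans (hb 0 (by norm_num))
  by_cases hi : 2 * L * M.size < |α (M.right i)|
  · set ℓ := Lagrange.basis Finset.univ (s i) (inflowIdx k α M i) with hℓ
    set c := interpErr α M s φ i (s i (inflowIdx k α M i)) with hc
    have hcε : |c| ≤ ε := hb _ ((href i).partition.mem_Icc _)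
    have hpt : Continuous (M.point i) := by unfold Mesh.point; fun_prop
    have h1 : IntervalIntegrable (fun r => α (M.point i r) * interpErr α M s φ i r)
        volume (-1) 1 := by
      refine ContinuousOn.intervalIntegrable ?_
      rw [uIcc_of_le (by norm_num)]
      exact (hα.continuousOn.comp hpt.continuousOn fun r hr => M.point_mem i hr).mul
        (continuousOn_interpErr hφ i)
    have h2 : ∫ r in (-1 : ℝ)..1, α (M.point i r) * interpErr α M s φ i r
        = ∫ r in (-1 : ℝ)..1, (α (M.point i r) * interpErr α M s φ i r
          - α (M.right i) * c * ℓ.eval r) := by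
      rw [intervalIntegral.integral_sub h1
        (((Polynomial.continuous _).const_mul _).intervalIntegrable _ _),
        intervalIntegral.integral_const_mul, ← polyInt_apply, hmean i hi, mul_zero, sub_zero]
    rw [h2]
    refine abs_integral_ref_le fun r hr => ?_
    have h3 : α (M.point i r) * interpErr α M s φ i r - α (M.right i) * c * ℓ.eval r
        = α (M.point i r) * (interpErr α M s φ i r - c * ℓ.eval r)
          + (α (M.point i r) - α (M.right i)) * (c * ℓ.eval r) := by ring
    rw [h3]
    refine (abs_add_le _ _).trans ?_
    rw [abs_mul, abs_mul, abs_mul]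
    have h4 := hα.abs_le (M.point_mem i hr)
    have h5 := hb' hi r hr
    have h6 := M.abs_sub_right_le hα i hr
    have h7 := (href i).abs_basis_le (inflowIdx k α M i) r hr
    calc _ ≤ L * (ε * M.size) + (L * M.size) * (ε * K) := by gcongr
      _ = L * (1 + K) * (ε * M.size) := by ring
      _ ≤ _ := by gcongr; linarith
  · refine abs_integral_ref_le fun r hr => ?_
    rw [abs_mul]
    have h6 := M.abs_sub_right_le hα i hr
    have h7 := abs_sub_abs_le_abs_sub (α (M.point i r)) (α (M.right i))
    have h8 : |α (M.point i r)| ≤ 3 * L * M.size := by linarith [not_lt.1 hi]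
    have h9 := hb r hr
    calc _ ≤ (3 * L * M.size) * ε := by gcongr
      _ = 3 * L * 1 * (ε * M.size) := by ring
      _ ≤ _ := by gcongr; linarith

/-- The cell average of `α` times the interpolation error is of higher order than the error itself:
its leading part has mean value zero where `α` is not small. -/
theorem errCell_le (hα : Reg 0 L α) (hL : 1 ≤ L) (href : ∀ i, IsRefElement K (s i) (A i))
    (hmean : ∀ i, 2 * L * M.size < |α (M.right i)| →
      polyInt (-1) 1 (Lagrange.basis Finset.univ (s i) (inflowIdx k α M i)) = 0)
    {w : ℝ → ℝ} (hw : ContinuousOn w (Icc 0 (2 * π))) {ε : ℝ}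
    (hb : ∀ i, ∀ r ∈ Icc (-1 : ℝ) 1, |interpErr α M s w i r| ≤ ε)
    (hb' : ∀ i, 2 * L * M.size < |α (M.right i)| → ∀ r ∈ Icc (-1 : ℝ) 1,
      |interpErr α M s w i r - interpErr α M s w i (s i (inflowIdx k α M i))
      * (Lagrange.basis Finset.univ (s i) (inflowIdx k α M i)).eval r| ≤ ε * M.size)
    {v : Fin N → ℝ[X]} (hv : ∀ i, (v i).natDegree ≤ k) :
    errCell α M w v ≤ √(18 * L ^ 2 * (1 + K) ^ 2 * (ε * M.size) ^ 2
      + 4 * L ^ 2 * K * weightedSq α M (refErr α M s w v)) := by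
  have hs : ∀ i, IsRefPartition (s i) := fun i => (href i).partition
  have hX := natDegree_refErr_le (α := α) (M := M) hs w hv
  refine Real.sqrt_le_sqrt ?_
  set D : Fin N → ℝ := fun i => (α (M.right i) ^ 2 + M.size ^ 2)
    * polyInt (-1) 1 (refErr α M s w v i ^ 2) with hDdef
  have hD0 : ∀ i, 0 ≤ D i := weighted_term_nonneg α M _
  have hK0 : 0 ≤ K := zero_le_one.trans (href ⟨0, M.pos⟩).one_le
  have h1 : ∀ i, (1 / M.len i *
      ∫ x in (M.left i)..(M.right i), (α x * w x - α x * (v i).eval x)) ^ 2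
      ≤ 18 * L ^ 2 * (1 + K) ^ 2 * (ε * M.size) ^ 2 + 4 * L ^ 2 * K * D i := fun i => by
    have hint := M.integral_point i (fun x => α x * w x - α x * (v i).eval x) (-1) 1
    rw [M.point_neg_one, M.point_one] at hint
    have hpt : Continuous (M.point i) := by unfold Mesh.point; fun_prop
    have hαc : ContinuousOn (fun r => α (M.point i r)) (Icc (-1) 1) :=
      hα.continuousOn.comp hpt.continuousOn fun r hr => M.point_mem i hr
    have i1 : IntervalIntegrable (fun r => α (M.point i r) * interpErr α M s w i r)
        volume (-1) 1 := by
      refine ContinuousOn.intervalIntegrable ?_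
      rw [uIcc_of_le (by norm_num)]
      exact hαc.mul (continuousOn_interpErr hw i)
    have i2 : IntervalIntegrable (fun r => α (M.point i r) * (refErr α M s w v i).eval r)
        volume (-1) 1 := by
      refine ContinuousOn.intervalIntegrable ?_
      rw [uIcc_of_le (by norm_num)]
      exact hαc.mul (Polynomial.continuous _).continuousOn
    have h2 : ∫ r in (-1 : ℝ)..1, (α (M.point i r) * w (M.point i r)
          - α (M.point i r) * (v i).eval (M.point i r))
        = (∫ r in (-1 : ℝ)..1, α (M.point i r) * interpErr α M s w i r)
          - ∫ r in (-1 : ℝ)..1, α (M.point i r) * (refErr α M s w v i).eval r := by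
      rw [← intervalIntegral.integral_sub i1 i2]
      congr 1
      funext r
      simp only [interpErr, refErr, eval_sub, Mesh.eval_refPoly]
      ring
    have h3 := abs_integral_coef_mul_interpErr_le hα href hmean hw i (hb i) (hb' i)
    have h4 := abs_integral_ref_le (f := fun r => α (M.point i r) * (refErr α M s w v i).eval r)
      (B := √(2 * L ^ 2 * K * D i))
      fun r hr => Real.abs_le_sqrt (sq_coef_mul_eval_le (M := M) hα hL (href i) (hX i) hr)
    have h5 : (√(2 * L ^ 2 * K * D i)) ^ 2 = 2 * L ^ 2 * K * D i :=
      Real.sq_sqrt (mul_nonneg (by positivity) (hD0 i))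
    have hlen := (M.len_pos i).ne'
    set I₁ := ∫ r in (-1 : ℝ)..1, α (M.point i r) * interpErr α M s w i r
    set I₂ := ∫ r in (-1 : ℝ)..1, α (M.point i r) * (refErr α M s w v i).eval r
    have h6 : 1 / M.len i * ∫ x in (M.left i)..(M.right i), (α x * w x - α x * (v i).eval x)
        = I₁ / 2 - I₂ / 2 := by
      rw [hint, h2]
      field_simp
    have h7 : I₁ ^ 2 ≤ (2 * ((3 * L * (1 + K)) * (ε * M.size))) ^ 2 := by
      rw [← sq_abs]; gcongr
    have h8 : I₂ ^ 2 ≤ (2 * √(2 * L ^ 2 * K * D i)) ^ 2 := by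
      rw [← sq_abs]; gcongr
    rw [mul_pow, h5] at h8
    rw [h6]
    nlinarith [sq_nonneg (I₁ + I₂)]
  have hN : (0 : ℝ) ≤ 1 / N := by positivity
  refine (mul_le_mul_of_nonneg_left (Finset.sum_le_sum fun i _ => h1 i) hN).trans ?_
  rw [Finset.sum_add_distrib, mul_add, M.mean_const, ← Finset.mul_sum, mul_left_comm]
  have := M.mean_le hD0
  unfold weightedSq
  gcongr

/-- The derivative of the interpolation error at the roots of the derivative of the nodal
polynomial, which lie in the interior of the element. -/
theorem derivRoots_bound {Ks : ℝ} {w : ℝ → ℝ} (hw : Reg (k + 1) Ks w) {i : Fin N}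
    (hR : IsRefElement K (s i) (A i)) (hs : ∀ i, IsRefPartition (s i)) {z : ℝ}
    (hz : z ∈ derivRoots α M s i) : ∃ r ∈ Icc (-1 : ℝ) 1, z = M.point i r ∧
      |deriv w z - (derivative (interp α M s w i)).eval z|
        ≤ 2 / M.len i * ((1 + K) * (Ks * M.size ^ (k + 2))) := by
  have hlen := M.len_pos i
  set r := (z - (M.left i + M.right i) / 2) / (M.len i / 2) with hr
  have hzr : z = M.point i r := by
    rw [Mesh.point, hr]; field_simp; ring
  set σ : Fin (k + 1) → ℝ := fun j => s i (nodeIdx α M i j) with hσ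
  have hnod : M.refPoly i (∏ j, (X - C (interpNode α M s i j)))
      = C ((M.len i / 2) ^ (k + 1)) * Lagrange.nodal Finset.univ σ := by
    refine Polynomial.funext fun x => ?_
    rw [Mesh.eval_refPoly, eval_mul, eval_C, Lagrange.eval_nodal, eval_prod]
    have h1 : ∀ j, (X - C (interpNode α M s i j)).eval (M.point i x)
        = M.len i / 2 * (x - σ j) := fun j => by
      rw [eval_sub, eval_X, eval_C, interpNode_eq, pt, M.point_sub]
    simp only [h1, Finset.prod_mul_distrib, Finset.prod_const, Finset.card_univ, Fintype.card_fin]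
  have hroot : (derivative (Lagrange.nodal Finset.univ σ)).eval r = 0 := by
    have h1 := isRoot_of_mem_roots hz
    rw [IsRoot.def, hzr] at h1
    have h2 := M.eval_derivative_refPoly i (∏ j, (X - C (interpNode α M s i j))) r
    rw [h1, mul_zero, hnod, derivative_C_mul, eval_C_mul] at h2
    exact (mul_eq_zero.1 h2).resolve_left (pow_ne_zero _ (half_pos hlen).ne')
  have hrI := mem_Ioo_of_derivative_nodal (injective_node hs i)
    (fun j => (hs i).mem_Icc _) hroot
  have hrI' : r ∈ Icc (-1 : ℝ) 1 := Ioo_subset_Icc_self hrI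
  refine ⟨r, hrI', hzr, ?_⟩
  have h0 : (0 : ℝ) ∈ Icc (-1 : ℝ) 1 := by norm_num
  obtain ⟨τ, hτ, hb, w', hw', hb'⟩ := hw.exists_taylor_deriv (M.point_mem i h0)
  have hzI : z ∈ Ioo 0 (2 * π) := by
    have h1 := M.point_sub i r (-1)
    have h2 := M.point_sub i 1 r
    rw [M.point_neg_one, ← hzr] at h1
    rw [M.point_one, ← hzr] at h2
    have h3 : 0 < M.len i / 2 * (r - -1) := mul_pos (half_pos hlen) (by linarith [hrI.1])
    have h4 : 0 < M.len i / 2 * (1 - r) := mul_pos (half_pos hlen) (by linarith [hrI.2])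
    exact ⟨by linarith [(M.left_mem i).1], by linarith [(M.right_mem i).2]⟩
  have hder : deriv w z = w' z :=
    ((hw' z (Ioo_subset_Icc_self hzI)).hasDerivAt (Icc_mem_nhds hzI.1 hzI.2)).deriv
  have hKs := hw.nonneg
  have hh := M.size_pos
  have key := hR.abs_sub_derivative_ipol_le (φ := fun r => w (M.point i r))
    (τ := M.refPoly i τ) (B := Ks * M.size ^ (k + 2)) (d := M.len i / 2 * w' z)
    (nodeIdx_injective α M i) (M.natDegree_refPoly_le i hτ) (fun r hr => by
      rw [Mesh.eval_refPoly]
      refine (hb _ (M.point_mem i hr)).trans ?_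
      have := M.abs_point_sub_le i hr h0
      gcongr) hrI' (by
      rw [M.eval_derivative_refPoly, ← hzr, ← mul_sub, abs_mul, abs_of_pos (half_pos hlen)]
      have h1 := hb' z (Ioo_subset_Icc_self hzI)
      have h2 : |z - M.point i 0| ≤ M.size := hzr ▸ M.abs_point_sub_le i hrI' h0
      have h3 := M.len_le_size i
      calc _ ≤ M.size * (Ks * M.size ^ (k + 1)) := by
            gcongr
            · linarith
            · exact h1.trans (by gcongr)
        _ = _ := by ring) hroot
  have h1 := refPoly_interp (α := α) (M := M) hs w i
  have h2 := M.eval_derivative_refPoly i (interp α M s w i) r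
  rw [h1, refInterp] at h2
  rw [h2, ← hzr, ← mul_sub, abs_mul, abs_of_pos (half_pos hlen)] at key
  rw [hder]
  calc _ = 2 / M.len i * (M.len i / 2 * |w' z - (derivative (interp α M s w i)).eval z|) := by
        field_simp
    _ ≤ _ := by gcongr

theorem card_derivRoots_le (α : ℝ → ℝ) (M : Mesh N) (s : Fin N → Fin (k + 2) → ℝ) (i : Fin N) :
    (derivRoots α M s i).card ≤ k := by
  refine (card_roots' _).trans ((natDegree_derivative_le _).trans ?_)
  rw [← Lagrange.nodal_eq, Lagrange.natDegree_nodal]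
  simp

/-- The interpolation error is superclose at the roots, and the derivative of the discrete error is
bounded through the discrete error and its time derivative. -/
theorem errDeriv_le {T ε Ks : ℝ} {X X' : ℝ → Fin N → ℝ[X]} (hk : 1 ≤ k) (hT : 0 < T)
    (hα : Reg 0 L α)
    (hS : IsErrorSystem T K L ρ M.size ε (fun i => α (M.right i)) M.len
      (fun i j => α (pt M s i j)) s A X X') {t : ℝ} (ht : t ∈ Icc 0 T) {w : ℝ → ℝ}
    (hw : Reg (k + 1) Ks w) (hwε : (1 + K) * (Ks * M.size ^ (k + 1)) ≤ ε) {v : Fin N → ℝ[X]}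
    (hX : X t = refErr α M s w v) :
    errDeriv α M s w v ≤ √(2 * k * (4 * ρ ^ 2 * L ^ 2 + derivConst k K L ρ * (1 + 2 * ρ
      * (Real.exp (stabConst k K L ρ 1 * (T + 1)) * stabConst k K L ρ 1 * T ^ 2
        + rateConst k K L ρ T))) * ε ^ 2) := by
  have hD := hS.disc
  have hs : ∀ i, IsRefPartition (s i) := fun i => (hD.ref i).partition
  have hK := hD.one_le
  have hL := hD.L_nonneg
  have hρ := hD.rho_pos
  have hh := M.size_pos
  have hε := hS.eps_nonneg
  have hdc : 0 ≤ derivConst k K L ρ := by unfold derivConst; positivity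
  set B : Fin N → ℝ := fun i => polyInt (-1) 1 (X t i ^ 2) with hB
  set B' : Fin N → ℝ := fun i => polyInt (-1) 1 (X' t i ^ 2) with hB'
  have hB0 : ∀ i, 0 ≤ B i := fun i => polyInt_sq_nonneg _
  have hB0' : ∀ i, 0 ≤ B' i := fun i => polyInt_sq_nonneg _
  have hterm : ∀ i, ∀ z ∈ derivRoots α M s i,
      (α z * deriv w z - α z * (derivative (v i)).eval z) ^ 2
      ≤ 2 * (4 * ρ ^ 2 * L ^ 2 * ε ^ 2 + derivConst k K L ρ * (ε ^ 2 + B i + B' i)) :=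
    fun i z hz => by
      obtain ⟨r, hr, hzr, hb⟩ := derivRoots_bound hw (hD.ref i) hs hz
      have hlen := M.len_pos i
      have h1 := hS.sq_derivative_le ht i (b := α z) (by rw [hzr]; exact M.abs_sub_right_le hα i hr)
        hr
      have h2 : 2 / M.len i * (derivative (X t i)).eval r
          = (derivative (v i)).eval z - (derivative (interp α M s w i)).eval z := by
        have h3 := M.eval_derivative_refPoly i (v i - interp α M s w i) r
        rw [map_sub, refPoly_interp hs] at h3
        rw [hX, refErr, h3, ← hzr, derivative_sub, eval_sub]
        field_simp
      rw [h2] at h1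
      have h3 : |α z * (deriv w z - (derivative (interp α M s w i)).eval z)| ≤ L * (2 * ρ * ε) := by
        rw [abs_mul]
        have h4 := hα.abs_le (M.point_mem i hr)
        rw [← hzr] at h4
        have h5 : 2 / M.len i * ((1 + K) * (Ks * M.size ^ (k + 2))) ≤ 2 * ρ * ε := by
          have h6 : M.size / M.len i ≤ ρ := by
            rw [div_le_iff₀ hlen]; exact hD.le_H i
          have h7 : 0 ≤ Ks := hw.nonneg
          calc _ = 2 * (M.size / M.len i) * ((1 + K) * (Ks * M.size ^ (k + 1))) := by
                field_simp; ring
            _ ≤ _ := by gcongr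
        have h8 := hb.trans h5
        gcongr
      have h4 : (α z * (deriv w z - (derivative (interp α M s w i)).eval z)) ^ 2
          ≤ (L * (2 * ρ * ε)) ^ 2 := by
        rw [← sq_abs]; gcongr
      set x := α z * (deriv w z - (derivative (interp α M s w i)).eval z) with hx
      set y := α z * ((derivative (v i)).eval z - (derivative (interp α M s w i)).eval z) with hy
      have h5 : α z * deriv w z - α z * (derivative (v i)).eval z = x - y := by
        rw [hx, hy]; ring
      rw [h5]
      nlinarith [sq_nonneg (x + y)]
  have hsum : ∀ i, ((derivRoots α M s i).map fun z =>
      (α z * deriv w z - α z * (derivative (v i)).eval z) ^ 2).sum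
      ≤ k * (2 * (4 * ρ ^ 2 * L ^ 2 * ε ^ 2 + derivConst k K L ρ * (ε ^ 2 + B i + B' i))) :=
    fun i => by
      have h1 := Multiset.sum_map_le_sum_map (s := derivRoots α M s i) _ _ (hterm i)
      refine h1.trans ?_
      rw [Multiset.map_const', Multiset.sum_replicate, nsmul_eq_mul]
      have h2 : ((derivRoots α M s i).card : ℝ) ≤ k := by
        exact_mod_cast card_derivRoots_le α M s i
      have := hB0 i
      have := hB0' i
      gcongr
  have hE := hS.energy_le hk ht
  have hE' := hS.energy_deriv_le hk hT ht
  have hm := hD.mul_sum_le_energy hk (β := fun _ => 1) (fun _ => zero_le_one)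
    (hS.natDegree_le t ht)
  have hm' := hD.mul_sum_le_energy hk (β := fun _ => 1) (fun _ => zero_le_one)
    (hS.natDegree_deriv_le t ht)
  simp only [one_mul] at hm hm'
  have hst := hD.stabConst_nonneg (Kβ := 1) zero_le_one
  have hBs : M.size * ∑ i, B i ≤ 2 * ρ * (Real.exp (stabConst k K L ρ 1 * (T + 1))
      * stabConst k K L ρ 1 * T ^ 2 * ε ^ 2) := by
    refine hm.trans (mul_le_mul_of_nonneg_left (hE.trans ?_) (by positivity))
    have := ht.1
    have := ht.2
    rw [mul_assoc _ (T ^ 2), ← mul_pow, mul_comm ε t]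
    gcongr
  have hBs' : M.size * ∑ i, B' i ≤ 2 * ρ * (rateConst k K L ρ T * ε ^ 2) :=
    hm'.trans (mul_le_mul_of_nonneg_left hE' (by positivity))
  refine Real.sqrt_le_sqrt ?_
  have hN : (0 : ℝ) ≤ 1 / N := by positivity
  refine (mul_le_mul_of_nonneg_left (Finset.sum_le_sum fun i _ => hsum i) hN).trans ?_
  have e1 := M.mean_const (ε ^ 2)
  have e2 := M.mean_const (4 * ρ ^ 2 * L ^ 2 * ε ^ 2)
  have h1 := (M.mean_le hB0).trans hBs
  have h2 := (M.mean_le hB0').trans hBs'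
  have h3 : 1 / (N : ℝ) * ∑ i, k * (2 * (4 * ρ ^ 2 * L ^ 2 * ε ^ 2
      + derivConst k K L ρ * (ε ^ 2 + B i + B' i)))
      = 2 * k * (1 / N * ∑ _i : Fin N, 4 * ρ ^ 2 * L ^ 2 * ε ^ 2
        + derivConst k K L ρ * (1 / N * ∑ _i : Fin N, ε ^ 2 + 1 / N * ∑ i, B i
          + 1 / N * ∑ i, B' i)) := by
    simp only [← Finset.mul_sum, Finset.sum_add_distrib]
    ring
  rw [h3, e1, e2]
  calc _ ≤ 2 * k * (4 * ρ ^ 2 * L ^ 2 * ε ^ 2 + derivConst k K L ρ * (ε ^ 2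
        + 2 * ρ * (Real.exp (stabConst k K L ρ 1 * (T + 1))
      * stabConst k K L ρ 1 * T ^ 2 * ε ^ 2) + 2 * ρ * (rateConst k K L ρ T * ε ^ 2))) := by
        gcongr
    _ = _ := by ring

end Norms

end

section

variable {k N : ℕ}

/-! ### The error bounds for one smooth solution -/

theorem interp_congr {α : ℝ → ℝ} {M : Mesh N} {s : Fin N → Fin (k + 2) → ℝ}
    (hs : ∀ i, IsRefPartition (s i)) {φ ψ : ℝ → ℝ} (h : ∀ x ∈ Icc 0 (2 * π), φ x = ψ x)
    (i : Fin N) : interp α M s φ i = interp α M s ψ i := by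
  unfold interp
  congr 1
  funext j
  rw [interpNode_eq]
  exact h _ (M.point_mem i ((hs i).mem_Icc _))

theorem le_sqrt_mul {x a Q b e : ℝ} (ha : 0 ≤ a) (he : 0 ≤ e) (hx : x ≤ √(a * Q))
    (hQ : Q ≤ b * e ^ 2) : x ≤ √(a * b) * e := by
  refine hx.trans ((Real.sqrt_le_sqrt (mul_le_mul_of_nonneg_left hQ ha)).trans_eq ?_)
  rw [← mul_assoc, Real.sqrt_mul' _ (sq_nonneg e), Real.sqrt_sq he]

/-- The constant in front of the size of the interpolation error: for the superconvergent norms in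
the first component, for the space derivative in the second one. -/
def errConst (k : ℕ) (K L ρ T : ℝ) : ℝ × ℝ :=
  (√(2 * L ^ 2 * K * superConst k K L ρ T) + (√(K * (1 + weightConst L) * superConst k K L ρ T)
    + √(18 * L ^ 2 * (1 + K) ^ 2 + 4 * L ^ 2 * K * superConst k K L ρ T)
    + √((k + 1) * (2 * L ^ 2 * K) * superConst k K L ρ T)),
  √(2 * k * (4 * ρ ^ 2 * L ^ 2 + derivConst k K L ρ * (1 + 2 * ρ
      * (Real.exp (stabConst k K L ρ 1 * (T + 1)) * stabConst k K L ρ 1 * T ^ 2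
        + rateConst k K L ρ T)))))

/-- All the error bounds, with the size `Ks` of the derivatives of the solution in place of its
norm. -/
theorem IsSmoothSol.errors_le {α : ℝ → ℝ} {g u p q : ℝ → ℝ → ℝ} {u₀ : ℝ → ℝ} {T K L ρ Ks : ℝ}
    {M : Mesh N} {s : Fin N → Fin (k + 2) → ℝ} {U : ℝ → Fin N → ℝ[X]} (hk : 1 ≤ k) (hT : 0 < T)
    (hK : ∀ s : Fin (k + 2) → ℝ,
      (IsGaussPartition s → ∃ A, IsRefElement K s A ∧ A 0 = 0 ∧ A (Fin.last (k + 1)) = 0) ∧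
      (IsRightRadauPartition s → ∃ A, IsRefElement K s A ∧ A 0 = 0) ∧
      (IsLeftRadauPartition s → ∃ A, IsRefElement K s A ∧ A (Fin.last (k + 1)) = 0))
    (hα : Reg 0 L α) (hL : 1 ≤ L) (hper : α 0 = α (2 * π)) (hu : IsSmoothSol k α g T Ks u p q)
    (hu₀ : ∀ x ∈ Icc 0 (2 * π), u 0 x = u₀ x) (hρ : M.ShapeRegular ρ)
    (hU : IsSVSolution α g T M s U) (hU₀ : ∀ i, U 0 i = interp α M s u₀ i) {t : ℝ}
    (ht : t ∈ Icc 0 T) :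
    (IsRSV α M s ∨ (IsLSV s ∧ 2 ≤ k) →
      errFlux α M s (u t) (U t)
        ≤ (errConst k K L ρ T).1 * (interpSize k K L Ks M.size * M.size) ∧
      errDownwind α M (u t) (U t) + errCell α M (u t) (U t) + errNode α M s (u t) (U t)
        ≤ (errConst k K L ρ T).1 * (interpSize k K L Ks M.size * M.size)) ∧
    (IsRSV α M s ∨ IsLSV s →
      errDeriv α M s (u t) (U t) ≤ (errConst k K L ρ T).2 * interpSize k K L Ks M.size) := by
  obtain ⟨Ut, hUt, hcons⟩ : ∃ Ut : ℝ → Fin N → ℝ[X],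
      (∀ t ∈ Icc 0 T, ∀ i m, HasDerivWithinAt (fun τ => (U τ i).coeff m) ((Ut t i).coeff m)
        (Icc 0 T) t) ∧ ∀ t ∈ Icc 0 T, ∀ (i : Fin N) (j : Fin (k + 1)),
      (∫ x in (pt M s i j.castSucc)..(pt M s i j.succ), (Ut t i).eval x)
        + α (pt M s i j.succ) * numFlux α M s (U t) i j.succ
        - α (pt M s i j.castSucc) * numFlux α M s (U t) i j.castSucc
      = ∫ x in (pt M s i j.castSucc)..(pt M s i j.succ), g t x := by
    choose! Ut h1 h2 using hU.conservation
    exact ⟨Ut, h1, h2⟩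
  have hh := M.size_pos
  have hKs : 0 ≤ Ks := (hu.reg_u t ht).nonneg
  have hsys : IsRSV α M s ∨ IsLSV s → ∃ A, IsErrorSystem T K L ρ M.size
      (interpSize k K L Ks M.size) (fun i => α (M.right i)) M.len
      (fun i j => α (pt M s i j)) s A (fun t => refErr α M s (u t) (U t))
      (fun t => refErr α M s (p t) (Ut t)) := fun hsv => by
    obtain ⟨A, hD⟩ := exists_isDiscretization hK hα hper hρ hsv
    have hs : ∀ i, IsRefPartition (s i) := fun i => (hD.ref i).partition
    exact ⟨A, isErrorSystem hk hT hα hL hper hD hu hU.natDegree_le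
      (fun i => (hU₀ i).trans (interp_congr hs (fun x hx => (hu₀ x hx).symm) i)) hUt hcons⟩
  -- `interpSize` dominates both interpolation bounds
  have hsize : 1 ≤ K → (1 + K) ^ 2 * (Ks * M.size ^ (k + 1)) ≤ interpSize k K L Ks M.size :=
    fun h1 => by
      unfold interpSize
      rw [mul_assoc]
      exact le_mul_of_one_le_left (by positivity) (by linarith)
  have hsize' : 1 ≤ K → (1 + K) * (Ks * M.size ^ (k + 1)) ≤ interpSize k K L Ks M.size :=
    fun h1 => by
      refine le_trans ?_ (hsize h1)
      have : 1 + K ≤ (1 + K) ^ 2 := by nlinarith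
      gcongr
  refine ⟨fun hsv => ?_, fun hsv => ?_⟩
  · obtain ⟨A, hS⟩ := hsys (hsv.imp id And.left)
    have hD := hS.disc
    have hK1 := hD.one_le
    have hQ := hS.weighted_le hk (hasLeadingResidual hk hT hα hper hD hu hsv hcons) ht
    change weightedSq α M (refErr α M s (u t) (U t)) ≤ _ at hQ
    have hv := hU.natDegree_le t ht
    have he : 0 ≤ interpSize k K L Ks M.size * M.size := mul_nonneg hS.eps_nonneg hh.le
    have hW := weightConst_nonneg hD.L_nonneg
    have hf := le_sqrt_mul (by positivity) he (errFlux_le hα hL hD.ref (u t) hv) hQ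
    have hn := le_sqrt_mul (by positivity) he (errNode_le hα hL hD.ref (u t) hv) hQ
    have hd := le_sqrt_mul (by positivity) he
      (errDownwind_le hk hper hD (hu.periodic t ht) hv) hQ
    have hc := errCell_le hα hL hD.ref (fun i hi => polyInt_basis_inflow hk hα hsv hi)
      (hu.reg_u t ht).continuousOn (ε := interpSize k K L Ks M.size)
      (fun i r hr => (((hu.reg_u t ht).of_le (by omega)).abs_interpErr_le (hD.ref i) hr).trans
        (hsize' hK1))
      (fun i hi r hr => (((hu.reg_u t ht).of_le (by omega)).abs_interpErr_sub_le hα hi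
        (hD.ref i) hr).trans (by
          calc _ = (1 + K) ^ 2 * (Ks * M.size ^ (k + 1)) * M.size := by ring
            _ ≤ _ := mul_le_mul_of_nonneg_right (hsize hK1) hh.le)) hv
    have hc' := le_sqrt_mul (x := errCell α M (u t) (U t)) (a := 1) (Q := 18 * L ^ 2 * (1 + K) ^ 2
        * (interpSize k K L Ks M.size * M.size) ^ 2
        + 4 * L ^ 2 * K * weightedSq α M (refErr α M s (u t) (U t)))
      (b := 18 * L ^ 2 * (1 + K) ^ 2 + 4 * L ^ 2 * K * superConst k K L ρ T) zero_le_one he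
      (by rw [one_mul]; exact hc) (by
        have := mul_le_mul_of_nonneg_left hQ (by positivity : 0 ≤ 4 * L ^ 2 * K)
        linarith)
    rw [one_mul] at hc'
    have s1 := Real.sqrt_nonneg (2 * L ^ 2 * K * superConst k K L ρ T)
    have s2 := Real.sqrt_nonneg (K * (1 + weightConst L) * superConst k K L ρ T)
    have s3 := Real.sqrt_nonneg (18 * L ^ 2 * (1 + K) ^ 2 + 4 * L ^ 2 * K * superConst k K L ρ T)
    have s4 := Real.sqrt_nonneg ((k + 1) * (2 * L ^ 2 * K) * superConst k K L ρ T)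
    simp only [errConst]
    refine ⟨hf.trans (mul_le_mul_of_nonneg_right (by linarith) he), ?_⟩
    refine (add_le_add (add_le_add hd hc') hn).trans ?_
    rw [← add_mul, ← add_mul]
    exact mul_le_mul_of_nonneg_right (by linarith) he
  · obtain ⟨A, hS⟩ := hsys hsv
    have h1 := errDeriv_le hk hT hα hS ht ((hu.reg_u t ht).of_le (by omega))
      (hsize' hS.disc.one_le) rfl
    rwa [Real.sqrt_mul' _ (sq_nonneg _), Real.sqrt_sq hS.eps_nonneg] at h1

end

end SpectralVolume

end

theorem theorem5p2 (k : ℕ) (hk : 1 ≤ k) (α : ℝ → ℝ) (hα : ContDiff ℝ ∞ α)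
    (hαper : α 0 = α (2 * π)) (g : ℝ → ℝ → ℝ) (hg : ContDiff ℝ ∞ fun p : ℝ × ℝ => g p.1 p.2)
    (T : ℝ) (hT : 0 < T) (ρ : ℝ) :
    ∃ C : ℝ, ∀ (u₀ : ℝ → ℝ) (u : ℝ → ℝ → ℝ),
      SpectralVolume.IsExactSolution α g u₀ T u →
      SpectralVolume.supSobolevNormInf (k + 3) T u < ⊤ →
      ∀ (N : ℕ) (M : SpectralVolume.Mesh N), M.ShapeRegular ρ →
      ∀ (s : Fin N → Fin (k + 2) → ℝ) (U : ℝ → Fin N → ℝ[X]),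
      SpectralVolume.IsSVSolution α g T M s U →
      (∀ i, U 0 i = SpectralVolume.interp α M s u₀ i) →
      ∀ t ∈ Set.Icc 0 T,
        (SpectralVolume.IsRSV α M s ∨ (SpectralVolume.IsLSV s ∧ 2 ≤ k) →
          SpectralVolume.errFlux α M s (u t) (U t)
              ≤ C * M.size ^ (k + 2) * (SpectralVolume.supSobolevNormInf (k + 3) T u).toReal ∧
          SpectralVolume.errDownwind α M (u t) (U t) + SpectralVolume.errCell α M (u t) (U t)
              + SpectralVolume.errNode α M s (u t) (U t)
            ≤ C * M.size ^ (k + 2) * (SpectralVolume.supSobolevNormInf (k + 3) T u).toReal) ∧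
        (SpectralVolume.IsRSV α M s ∨ SpectralVolume.IsLSV s →
          SpectralVolume.errDeriv α M s (u t) (U t)
            ≤ C * M.size ^ (k + 1) * (SpectralVolume.supSobolevNormInf (k + 3) T u).toReal) := by
  obtain ⟨K, hK⟩ := SpectralVolume.exists_isRefElement hk
  obtain ⟨L₀, hL₀⟩ := SpectralVolume.exists_reg_of_contDiff 0 (G := fun p : ℝ × ℝ => α p.2)
    (hα.comp contDiff_snd) 0
  have hL : SpectralVolume.Reg 0 (max L₀ 1) α :=
    (hL₀ 0 ⟨le_rfl, le_rfl⟩).mono (le_max_left _ _)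
  set L := max L₀ 1 with hLdef
  have hL1 : 1 ≤ L := le_max_right _ _
  obtain ⟨B, hB, hsol⟩ := SpectralVolume.exists_isSmoothSol (k := k) hα hg hT
  set c₁ := (SpectralVolume.errConst k K L ρ T).1 with hc₁
  set c₂ := (SpectralVolume.errConst k K L ρ T).2 with hc₂
  have hc₁0 : 0 ≤ c₁ := by
    rw [hc₁, SpectralVolume.errConst]
    positivity
  have hc₂0 : 0 ≤ c₂ := Real.sqrt_nonneg _
  refine ⟨(c₁ + c₂) * ((1 + 2 * L) * (1 + K) ^ 2 * B),
    fun u₀ u hu hfin N M hρ s U hU hU₀ t ht => ?_⟩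
  set S := (SpectralVolume.supSobolevNormInf (k + 3) T u).toReal with hS
  have hS0 : 0 ≤ S := ENNReal.toReal_nonneg
  have hh := M.size_pos
  -- A number above the norm of `u` bounds the derivatives of the continuous representative; the
  -- norm itself is an infimum over weak derivatives, so the estimates are proved for every `K' > S`
  -- and pass to the limit.
  have key : ∀ K' > S, ∃ p q, SpectralVolume.IsSmoothSol k α g T (B * K') u p q := fun K' hK' => by
    refine hsol u₀ u K' hu fun τ hτ => ?_
    refine SpectralVolume.reg_of_sobolevNormInf_lt (hu.continuousOn τ hτ) ?_
    calc SpectralVolume.sobolevNormInf (k + 3) (u τ)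
        ≤ SpectralVolume.supSobolevNormInf (k + 3) T u :=
          le_iSup₂ (f := fun τ _ => SpectralVolume.sobolevNormInf (k + 3) (u τ)) τ hτ
      _ = ENNReal.ofReal S := (ENNReal.ofReal_toReal hfin.ne).symm
      _ < ENNReal.ofReal K' := (ENNReal.ofReal_lt_ofReal_iff (hS0.trans_lt hK')).2 hK'
  choose! p q hpq using key
  have herr := fun K' (hK' : K' > S) =>
    (hpq K' hK').errors_le hk hT hK hL hL1 hαper hu.initial hρ hU hU₀ ht
  have hlim : ∀ {x d : ℝ}, (∀ K' > S, x ≤ d * K') → x ≤ d * S := fun {x d} h => by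
    have h1 : Filter.Tendsto (fun K' => d * K') (nhdsWithin S (Set.Ioi S)) (nhds (d * S)) :=
      ((continuous_const.mul continuous_id).tendsto S).mono_left nhdsWithin_le_nhds
    exact ge_of_tendsto h1 (by filter_upwards [self_mem_nhdsWithin] with K' hK' using h K' hK')
  have hfac : 0 ≤ (1 + 2 * L) * (1 + K) ^ 2 * B := by positivity
  have hsize : ∀ K', SpectralVolume.interpSize k K L (B * K') M.size
      = (1 + 2 * L) * (1 + K) ^ 2 * B * M.size ^ (k + 1) * K' := fun K' => by
    unfold SpectralVolume.interpSize; ring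
  have hbig : ∀ K' > S, c₁ * (SpectralVolume.interpSize k K L (B * K') M.size * M.size)
      ≤ (c₁ + c₂) * ((1 + 2 * L) * (1 + K) ^ 2 * B) * M.size ^ (k + 2) * K' := fun K' hK' => by
    have hK0 : 0 ≤ K' := hS0.trans hK'.le
    rw [hsize]
    calc _ = c₁ * ((1 + 2 * L) * (1 + K) ^ 2 * B) * M.size ^ (k + 2) * K' := by ring
      _ ≤ _ := by gcongr; linarith
  have hbig' : ∀ K' > S, c₂ * SpectralVolume.interpSize k K L (B * K') M.size
      ≤ (c₁ + c₂) * ((1 + 2 * L) * (1 + K) ^ 2 * B) * M.size ^ (k + 1) * K' := fun K' hK' => by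
    have hK0 : 0 ≤ K' := hS0.trans hK'.le
    rw [hsize]
    calc _ = c₂ * ((1 + 2 * L) * (1 + K) ^ 2 * B) * M.size ^ (k + 1) * K' := by ring
      _ ≤ _ := by gcongr; linarith
  refine ⟨fun hsv => ⟨hlim fun K' hK' => ?_, hlim fun K' hK' => ?_⟩,
    fun hsv => hlim fun K' hK' => ?_⟩
  · exact ((herr K' hK').1 hsv).1.trans (hbig K' hK')
  · exact ((herr K' hK').1 hsv).2.trans (hbig K' hK')
  · exact ((herr K' hK').2 hsv).trans (hbig' K' hK')
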